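/- \textbf{Setting.} Let $d\in\mathbb N$, $p\in(0,1)$, $\beta^*\in\mathbb R^d$. Let $(x_k,\epsilon_k,D_k)$, $k\in\mathbb Z$, be i.i.d. triples, where $x_k$ is a random vector in $\mathbb R^d$, $\epsilon_k$ is a real random variable with $\mathbb E\epsilon_k=0$ and $\mathrm{Var}(\epsilon_k)=1$, $D_k$ is a random $d\times d$ diagonal matrix with i.i.d. $\mathrm{Bernoulli}(p)$ diagonal entries, and $x_k,\epsilon_k,D_k$ are independent of each other. Assume $\min_i\mathbb E[(x_1x_1^\top)_{ii}]>0$, and put $y_k=x_k^\top\beta^*+\epsilon_k$. For a learning rate $\alpha>0$ and a fixed initial vector $\beta_0\in\mathbb R^d$, define the SGD iterates with dropout and their averages by $$\beta_k=f_k(\beta_{k-1}),\qquad f_k(u)=u+\alpha D_kx_k\,(y_k-x_k^\top D_ku),\qquad k\ge1,\qquad \bar\beta_n=\frac1n\sum_{k=1}^n\beta_k .$$ Let $\breve\beta$ be the minimizer of $b\mapsto\mathbb E[\tfrac12(y_1-x_1^\top D_1b)^2]$ over $\mathbb R^d$, let $\beta_k^\circ=\lim_{m\to\infty}f_k\circ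 f_{k-1}\circ\cdots\circ f_{k-m}(u)$, $k\in\mathbb Z$, be the stationary sequence, and let $$\breve\Sigma(\alpha)=\sum_{k=-\infty}^{\infty}\mathbb E\big[(\beta_0^\circ-\breve\beta)(\beta_k^\circ-\breve\beta)^\top\big]$$ be its long-run covariance matrix. For $c>0$ and $\zeta>1$ let $\eta_m=\lfloor cm^\zeta\rfloor$ and $B_m=\{\eta_m,\dots,\eta_{m+1}-1\}$ for $m\ge1$; for $n\ge\max(1,\eta_1)$ let $\psi(n)$ be the largest $m\ge1$ with $\eta_m\le n$ and, with $v^{\otimes2}=vv^\top$, define the online non-overlapping batch-means estimator $$\hat\Sigma_n(\alpha)=\frac1n\sum_{m=1}^{\psi(n)-1}\Big(\sum_{k\in B_m}(\beta_k-\bar\beta_n)\Big)^{\otimes2}+\frac1n\Big(\sum_{k=\eta_{\psi(n)}}^{n}(\beta_k-\bar\beta_n)\Big)^{\otimes2}.$$ \textbf{Theorem} (Precision of $\hat\Sigma_n(\alpha)$). Suppose that for some $q\ge4$ we have $\mathbb E|\epsilon_1|^{2q}+\mathbb E\|x_1\|_2^{2q}<\infty$ and $$\frac{\alpha(q-1)}2\sup_{\|v\|_2=1}\frac{(1+\alpha\mu_q(v))^{q-2}\mu_q(v)^2}{p\,v^\top\mathbb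 E[X_p]\,v}<1,$$ where $\mu_q(v)=(\mathbb E\|D_1x_1x_1^\top D_1v\|_2^q)^{1/q}$ and $X_p=p\,x_1x_1^\top+(1-p)\,\mathrm{Diag}(x_1x_1^\top)$. Then $\breve\beta$ exists and is unique; almost surely, for all $k\in\mathbb Z$, the limit $\beta_k^\circ$ exists for every $u\in\mathbb R^d$ and does not depend on $u$; the expectations in $\breve\Sigma(\alpha)$ exist and the series converges absolutely; and there is a constant $C$ that does not depend on $n$ such that, with $\|\cdot\|$ the operator norm induced by the Euclidean norm, $$\mathbb E\|\hat\Sigma_n(\alpha)-\breve\Sigma(\alpha)\|\le C\,n^{(1/\zeta-1)\vee(-1/(2\zeta))}\qquad\text{for all } n\ge\max(1,\eta_1).$$ In particular, for $\zeta=3/2$, $\mathbb E\|\hat\Sigma_n(\alpha)-\breve\Sigma(\alpha)\|\le C\,n^{-1/3}$. -/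

import Mathlib

open MeasureTheory ProbabilityTheory Filter Topology
open scoped ENNReal Matrix

namespace DropoutSGD

/-- `ℝ^d` with the Euclidean norm. -/
abbrev Vec (d : ℕ) : Type := EuclideanSpace ℝ (Fin d)

/-- Matrix times vector, as a vector of the Euclidean space. -/
noncomputable def mulV {d : ℕ} (A : Matrix (Fin d) (Fin d) ℝ) (v : Vec d) : Vec d :=
  WithLp.toLp 2 (A *ᵥ v.ofLp)

/-- The matrix `v vᵀ`. -/
def outer {d : ℕ} (v : Vec d) : Matrix (Fin d) (Fin d) ℝ :=
  Matrix.vecMulVec v.ofLp v.ofLp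

/-- The operator norm of a matrix induced by the Euclidean norm. -/
noncomputable def opNorm {d : ℕ} (A : Matrix (Fin d) (Fin d) ℝ) : ℝ :=
  ‖Matrix.toEuclideanCLM (n := Fin d) (𝕜 := ℝ) A‖

/-- `A_p = p A + (1 - p) Diag(A)`. -/
def rescale {d : ℕ} (p : ℝ) (A : Matrix (Fin d) (Fin d) ℝ) : Matrix (Fin d) (Fin d) ℝ :=
  p • A + (1 - p) • Matrix.diagonal A.diag

/-- The random inputs, one triple for every time `k ∈ ℤ`: the covariate vector `x k`, the
regression noise `noise k` and the diagonal `mask k` of the dropout matrix. -/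
structure Inputs (Ω : Type*) (d : ℕ) where
  x : ℤ → Ω → Vec d
  noise : ℤ → Ω → ℝ
  mask : ℤ → Ω → Fin d → ℝ

namespace Inputs

variable {Ω : Type*} {d : ℕ} (I : Inputs Ω d)

/-- The dropout matrix `D_k`. -/
def D (k : ℤ) (ω : Ω) : Matrix (Fin d) (Fin d) ℝ := Matrix.diagonal (I.mask k ω)

/-- The Gram matrix `x_k x_kᵀ`. -/
def gram (k : ℤ) (ω : Ω) : Matrix (Fin d) (Fin d) ℝ := outer (I.x k ω)

/-- The response `y_k = x_kᵀ β* + ε_k`. -/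
noncomputable def y (βstar : Vec d) (k : ℤ) (ω : Ω) : ℝ :=
  (I.x k ω).ofLp ⬝ᵥ βstar.ofLp + I.noise k ω

/-- One SGD step with dropout, `u ↦ u + α D_k x_k (y_k - x_kᵀ D_k u)`. -/
noncomputable def step (βstar : Vec d) (α : ℝ) (k : ℤ) (ω : Ω) (u : Vec d) : Vec d :=
  u + (α * (I.y βstar k ω - (I.x k ω).ofLp ⬝ᵥ (mulV (I.D k ω) u).ofLp)) •
    mulV (I.D k ω) (I.x k ω)

/-- The SGD dropout iterates started from the vector `β₀`. -/
noncomputable def iterate (βstar : Vec d) (α : ℝ) (β₀ : Vec d) : ℕ → Ω → Vec d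
  | 0, _ => β₀
  | k + 1, ω => I.step βstar α ((k : ℤ) + 1) ω (iterate βstar α β₀ k ω)

/-- The average `(1/n) ∑_{k=1}^n β_k`. -/
noncomputable def average (βstar : Vec d) (α : ℝ) (β₀ : Vec d) (n : ℕ) (ω : Ω) : Vec d :=
  (1 / (n : ℝ)) • ∑ k ∈ Finset.Icc 1 n, I.iterate βstar α β₀ k ω

/-- The backward composition `f_k ∘ f_{k-1} ∘ ⋯ ∘ f_{k-m}` applied to `u`, where `f_j` is the
SGD step at time `j`. -/
noncomputable def backward (βstar : Vec d) (α : ℝ) (k : ℤ) (ω : Ω) : ℕ → Vec d → Vec d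
  | 0, u => I.step βstar α k ω u
  | m + 1, u => backward βstar α k ω m (I.step βstar α (k - ((m : ℤ) + 1)) ω u)

/-- The stationary SGD dropout sequence `β°_k`, `k ∈ ℤ`: the limit of the backward
compositions. -/
noncomputable def stationary (βstar : Vec d) (α : ℝ) (k : ℤ) (ω : Ω) : Vec d :=
  limUnder atTop fun m : ℕ => I.backward βstar α k ω m 0

variable [MeasurableSpace Ω] (P : Measure Ω)

/-- The modelling assumptions. The triples (covariate, noise, dropout matrix) are i.i.d. over
time; within each triple the three components are independent; the diagonal of a dropout matrix
has i.i.d. Bernoulli(`p`) entries; the noise is centred with unit variance; and the model is in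
reduced form. -/
structure IsModel (p : ℝ) : Prop where
  measurable_x : ∀ k, Measurable (I.x k)
  measurable_noise : ∀ k, Measurable (I.noise k)
  measurable_mask : ∀ k, Measurable (I.mask k)
  indep_time : iIndepFun (fun (k : ℤ) (ω : Ω) => (I.x k ω, I.noise k ω, I.mask k ω)) P
  indep_x_noise : ∀ k, IndepFun (I.x k) (I.noise k) P
  indep_data_mask : ∀ k, IndepFun (fun ω => (I.x k ω, I.noise k ω)) (I.mask k) P
  indep_mask : ∀ k, iIndepFun (fun (i : Fin d) (ω : Ω) => I.mask k ω i) P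
  ident_x : ∀ k, IdentDistrib (I.x k) (I.x 1) P P
  ident_noise : ∀ k, IdentDistrib (I.noise k) (I.noise 1) P P
  mask_law : ∀ k i, P.map (fun ω => I.mask k ω i) =
    ENNReal.ofReal p • Measure.dirac (1 : ℝ) + ENNReal.ofReal (1 - p) • Measure.dirac (0 : ℝ)
  noise_mean : ∫ ω, I.noise 1 ω ∂P = 0
  noise_var : variance (I.noise 1) P = 1
  reduced : ∀ i : Fin d, 0 < ∫ ω, I.gram 1 ω i i ∂P

/-- Finite moments of order `2q` of the noise and of the covariates. -/
def FiniteMoments (q : ℝ) : Prop :=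
  MemLp (I.noise 1) (ENNReal.ofReal (2 * q)) P ∧ MemLp (I.x 1) (ENNReal.ofReal (2 * q)) P

/-- `μ_q(v) = (E ‖D X D v‖^q)^{1/q}`, with `X = x xᵀ`. -/
noncomputable def mu (q : ℝ) (v : Vec d) : ℝ :=
  (∫ ω, ‖mulV (I.D 1 ω * I.gram 1 ω * I.D 1 ω) v‖ ^ q ∂P) ^ (1 / q)

/-- The matrix `E[X_p]`, with `X = x xᵀ`. -/
noncomputable def meanGram (p : ℝ) : Matrix (Fin d) (Fin d) ℝ :=
  Matrix.of fun i j => ∫ ω, rescale p (I.gram 1 ω) i j ∂P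

/-- The learning-rate condition
`(α (q-1) / 2) sup_{‖v‖=1} (1 + α μ_q(v))^{q-2} μ_q(v)² / (p vᵀ E[X_p] v) < 1`;
the supremum is taken in `[0, ∞]`. -/
def LearningRateCondition (p q α : ℝ) : Prop :=
  ENNReal.ofReal (α * (q - 1) / 2) *
    (⨆ (v : Vec d) (_ : ‖v‖ = 1),
      ENNReal.ofReal ((1 + α * I.mu P q v) ^ (q - 2) * I.mu P q v ^ 2 /
        (p * (v.ofLp ⬝ᵥ (mulV (I.meanGram P p) v).ofLp)))) < 1

/-- The risk `b ↦ E[(y - xᵀ D b)² / 2]`. -/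
noncomputable def risk (βstar b : Vec d) : ℝ :=
  ∫ ω, (1 / 2 : ℝ) * (I.y βstar 1 ω - (I.x 1 ω).ofLp ⬝ᵥ (mulV (I.D 1 ω) b).ofLp) ^ 2 ∂P

/-- A minimizer of the risk over `ℝ^d`. -/
noncomputable def minimizer (βstar : Vec d) : Vec d :=
  Classical.epsilon fun b : Vec d => ∀ b' : Vec d, I.risk P βstar b ≤ I.risk P βstar b'

/-- The integrand of the `(i, j)` entry of the lag-`k` autocovariance
`E[(β°_0 - β) (β°_k - β)ᵀ]` of the stationary sequence, `β` being the risk minimizer. -/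
noncomputable def lagProduct (βstar : Vec d) (α : ℝ) (k : ℤ) (i j : Fin d) (ω : Ω) : ℝ :=
  (I.stationary βstar α 0 ω i - I.minimizer P βstar i) *
    (I.stationary βstar α k ω j - I.minimizer P βstar j)

/-- The long-run covariance matrix `∑_{k ∈ ℤ} E[(β°_0 - β) (β°_k - β)ᵀ]`. -/
noncomputable def longRunCov (βstar : Vec d) (α : ℝ) : Matrix (Fin d) (Fin d) ℝ :=
  Matrix.of fun i j => ∑' k : ℤ, ∫ ω, I.lagProduct P βstar α k i j ω ∂P

end Inputs

/-- The block endpoints `η_m = ⌊c m^ζ⌋`. -/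
noncomputable def blockStart (c ζ : ℝ) (m : ℕ) : ℕ := ⌊c * (m : ℝ) ^ ζ⌋₊

/-- `ψ(n)`: the largest index `m ≥ 1` with `η_m ≤ n`. -/
noncomputable def lastBlock (η : ℕ → ℕ) (n : ℕ) : ℕ := sSup {m : ℕ | 1 ≤ m ∧ η m ≤ n}

/-- The non-overlapping batch-means estimator after `n` iterations, with blocks
`B_m = {η_m, …, η_{m+1} - 1}`. -/
noncomputable def Inputs.estimator {Ω : Type*} {d : ℕ} (I : Inputs Ω d) (βstar : Vec d) (α : ℝ)
    (β₀ : Vec d) (η : ℕ → ℕ) (n : ℕ) (ω : Ω) : Matrix (Fin d) (Fin d) ℝ :=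
  (1 / (n : ℝ)) • ∑ m ∈ Finset.Ico 1 (lastBlock η n),
      outer (∑ k ∈ Finset.Ico (η m) (η (m + 1)),
        (I.iterate βstar α β₀ k ω - I.average βstar α β₀ n ω)) +
    (1 / (n : ℝ)) • outer (∑ k ∈ Finset.Icc (η (lastBlock η n)) n,
        (I.iterate βstar α β₀ k ω - I.average βstar α β₀ n ω))

end DropoutSGD

/-! Centred at the risk minimizer, SGD with dropout is a random affine recursion `u ↦ A u + b` with
i.i.d. coefficients, where `A = I - α w wᵀ` and `w = D x`. The normal equations say that `E b = 0`,
and the learning-rate condition with `q ≥ 4` gives `E ‖A v‖⁴ ≤ r⁴ ‖v‖⁴` for some `r < 1`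
(`exists_contraction`). Nothing else about SGD matters for the rate, which is proved for every
`AffineRecursion`.

The contraction has two consequences. Orbits driven by the same inputs merge geometrically in `L⁴`,
so starting in the remote past produces the stationary solution `Z` (`exists_isStationary`). And
given the past, the next state has mean `B u`, where `B = E A` and `‖B‖ ≤ r`. Hence the lag-`k`
autocovariance is governed by `B^k`, and the autocovariances sum to `longRun`; moreover `I - B`
applied to a sum of states is a martingale up to boundary terms, and a fourth-moment Burkholder
inequality bounds a block sum of length `L` by a multiple of `√L` in `L⁴` (`lpNorm_blockSum_le`).

Take `M` blocks of lengths `L_m ≤ Λ`, and let `σ` be the long-run covariance. Before division by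
`n`, the `L¹` error has four sources. Fluctuation: squared block sums minus their conditional
expectations at the block start are martingale differences with second moments `O(L_m²)`, which
costs `√(∑ L_m²) ≲ √(nΛ)`. Bias: these conditional expectations equal `L_m σ + O(1)` in `L¹`,
uniformly in `L_m` (`exists_abs_integral_blockSum_sub_le`), which costs `M`; conditioning is
expressed by testing against bounded weights from the past. Centring at the sample average costs `∑
L_m √L_m / √n ≲ √(nΛ)`. The mismatch between the times covered by the blocks and `1, …, n` costs
`O(1)`.

For `η_m = ⌊c m^ζ⌋` one has `M ≲ n^(1/ζ)` and `Λ ≲ n^(1 - 1/ζ)`, so the terms become `n^(-1/(2ζ))`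
and `n^(1/ζ - 1)`. The argument runs for pairs of directions `a`, `c`; coordinate vectors give the
matrix entries, and finitely many entries control the operator norm. -/

namespace DropoutSGD

/-! ### Second and fourth moments, `L²` and `L⁴` norms -/

section FourthMoments

variable {Ω : Type*} [MeasurableSpace Ω] {P : Measure Ω}
  {E F : Type*} [NormedAddCommGroup E] [NormedAddCommGroup F]

lemma integrable_norm_pow_four {X : Ω → E} (hX : MemLp X 4 P) :
    Integrable (fun ω => ‖X ω‖ ^ 4) P := by
  have h := hX.integrable_norm_pow (p := 4) (by norm_num)
  exact h

lemma lpNorm_four_pow {X : Ω → E} (hX : MemLp X 4 P) :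
    lpNorm X 4 P ^ 4 = ∫ ω, ‖X ω‖ ^ 4 ∂P := by
  rw [lpNorm_eq_integral_norm_rpow_toReal (by norm_num) (by norm_num) hX.1]
  have h4 : (4 : ℝ≥0∞).toReal = 4 := by norm_num
  rw [h4]
  have h0 : 0 ≤ ∫ ω, ‖X ω‖ ^ (4 : ℝ) ∂P := integral_nonneg fun ω => by positivity
  rw [← Real.rpow_natCast, ← Real.rpow_mul h0]
  norm_num

lemma lpNorm_two_sq {X : Ω → E} (hX : MemLp X 2 P) :
    lpNorm X 2 P ^ 2 = ∫ ω, ‖X ω‖ ^ 2 ∂P := by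
  rw [lpNorm_eq_integral_norm_rpow_toReal (by norm_num) (by norm_num) hX.1]
  have h4 : (2 : ℝ≥0∞).toReal = 2 := by norm_num
  rw [h4]
  have h0 : 0 ≤ ∫ ω, ‖X ω‖ ^ (2 : ℝ) ∂P := integral_nonneg fun ω => by positivity
  rw [← Real.rpow_natCast, ← Real.rpow_mul h0]
  norm_num

lemma integrable_norm_mul_norm {X : Ω → E} {Y : Ω → F} (hX : MemLp X 2 P) (hY : MemLp Y 2 P) :
    Integrable (fun ω => ‖X ω‖ * ‖Y ω‖) P :=
  MemLp.integrable_mul (p := 2) (q := 2) hX.norm hY.norm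

lemma integral_norm_mul_norm_le_two {X : Ω → E} {Y : Ω → F} (hX : MemLp X 2 P)
    (hY : MemLp Y 2 P) :
    ∫ ω, ‖X ω‖ * ‖Y ω‖ ∂P ≤ lpNorm X 2 P * lpNorm Y 2 P := by
  have h := integral_mul_norm_le_Lp_mul_Lq (μ := P) (f := fun ω => ‖X ω‖) (g := fun ω => ‖Y ω‖)
    (p := 2) (q := 2) Real.HolderConjugate.two_two
    (by simpa using hX.norm) (by simpa using hY.norm)
  simp only [norm_norm] at h
  refine h.trans (le_of_eq ?_)
  rw [lpNorm_eq_integral_norm_rpow_toReal (by norm_num) (by norm_num) hX.1,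
    lpNorm_eq_integral_norm_rpow_toReal (by norm_num) (by norm_num) hY.1]
  norm_num

lemma lpNorm_le_of_eLpNorm_le {X : Ω → E} {p : ℝ≥0∞} (hX : MemLp X p P) {c : ℝ} (hc : 0 ≤ c)
    (h : eLpNorm X p P ≤ ENNReal.ofReal c) : lpNorm X p P ≤ c := by
  rw [← toReal_eLpNorm hX.1]
  exact ENNReal.toReal_le_of_le_ofReal hc h

lemma lpNorm_le_of_norm_le {X : Ω → E} {Y : Ω → F} {p : ℝ≥0∞} (hX : AEStronglyMeasurable X P)
    (hY : MemLp Y p P) (h : ∀ᵐ ω ∂P, ‖X ω‖ ≤ ‖Y ω‖) : lpNorm X p P ≤ lpNorm Y p P := by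
  rw [← toReal_eLpNorm hX, ← toReal_eLpNorm hY.1]
  exact ENNReal.toReal_mono hY.eLpNorm_ne_top (eLpNorm_mono_ae h)

variable [IsProbabilityMeasure P]

lemma memLp_two_of_four {X : Ω → E} (hX : MemLp X 4 P) : MemLp X 2 P :=
  hX.mono_exponent (by norm_num)

lemma integrable_of_memLp_four {X : Ω → E} (hX : MemLp X 4 P) : Integrable X P :=
  hX.integrable (by norm_num)

lemma lpNorm_mono_exponent {X : Ω → E} {p q : ℝ≥0∞} (hpq : p ≤ q) (hX : MemLp X q P) :
    lpNorm X p P ≤ lpNorm X q P := by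
  rw [← toReal_eLpNorm hX.1, ← toReal_eLpNorm hX.1]
  exact ENNReal.toReal_mono hX.eLpNorm_ne_top (eLpNorm_le_eLpNorm_of_exponent_le hpq hX.1)

lemma integral_norm_mul_norm_le {X : Ω → E} {Y : Ω → F} (hX : MemLp X 4 P) (hY : MemLp Y 4 P) :
    ∫ ω, ‖X ω‖ * ‖Y ω‖ ∂P ≤ lpNorm X 4 P * lpNorm Y 4 P := by
  refine (integral_norm_mul_norm_le_two (memLp_two_of_four hX) (memLp_two_of_four hY)).trans ?_
  exact mul_le_mul (lpNorm_mono_exponent (by norm_num) hX)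
    (lpNorm_mono_exponent (by norm_num) hY) lpNorm_nonneg lpNorm_nonneg

lemma integral_norm_le_lpNorm {X : Ω → E} {p : ℝ≥0∞} (hp : 1 ≤ p) (hX : MemLp X p P) :
    ∫ ω, ‖X ω‖ ∂P ≤ lpNorm X p P := by
  rw [← lpNorm_one_eq_integral_norm hX.1]
  exact lpNorm_mono_exponent hp hX

/-- The map `x ↦ ⟨a, x⟩ x` is locally Lipschitz, so it is continuous from `L⁴` to `L¹`. -/
lemma norm_integral_inner_smul_sub_le {E : Type*} [NormedAddCommGroup E] [InnerProductSpace ℝ E]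
    {X Y : Ω → E} {W : Ω → ℝ} (hW : ∀ ω, |W ω| ≤ 1)
    (hX : MemLp X 4 P) (hY : MemLp Y 4 P) (a : E) :
    ∫ ω, ‖W ω • (inner ℝ a (X ω) • X ω) - W ω • (inner ℝ a (Y ω) • Y ω)‖ ∂P ≤
      ‖a‖ * (lpNorm (X - Y) 4 P * (lpNorm X 4 P + lpNorm Y 4 P)) := by
  have hXY : MemLp (X - Y) 4 P := hX.sub hY
  have i1 := integrable_norm_mul_norm (memLp_two_of_four hXY) (memLp_two_of_four hX)
  have i2 := integrable_norm_mul_norm (memLp_two_of_four hXY) (memLp_two_of_four hY)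
  calc _ ≤ ∫ ω, ‖a‖ * (‖(X - Y) ω‖ * ‖X ω‖ + ‖(X - Y) ω‖ * ‖Y ω‖) ∂P := by
        refine integral_mono_of_nonneg (.of_forall fun ω => norm_nonneg _)
          ((i1.add i2).const_mul _) (.of_forall fun ω => ?_)
        have e : W ω • (inner ℝ a (X ω) • X ω) - W ω • (inner ℝ a (Y ω) • Y ω) =
            W ω • (inner ℝ a (X ω - Y ω) • X ω + inner ℝ a (Y ω) • (X ω - Y ω)) := by
          rw [inner_sub_right]; module
        simp only [e, norm_smul, Real.norm_eq_abs, Pi.sub_apply]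
        refine (mul_le_of_le_one_left (norm_nonneg _) (hW ω)).trans ((norm_add_le _ _).trans ?_)
        rw [norm_smul, norm_smul, mul_add]
        refine add_le_add ?_ ?_
        · rw [← mul_assoc]
          exact mul_le_mul_of_nonneg_right (norm_inner_le_norm _ _) (norm_nonneg _)
        · calc _ ≤ (‖a‖ * ‖Y ω‖) * ‖X ω - Y ω‖ :=
                mul_le_mul_of_nonneg_right (norm_inner_le_norm _ _) (norm_nonneg _)
            _ = _ := by ring
    _ = ‖a‖ * (∫ ω, ‖(X - Y) ω‖ * ‖X ω‖ ∂P + ∫ ω, ‖(X - Y) ω‖ * ‖Y ω‖ ∂P) := by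
        rw [integral_const_mul, integral_add i1 i2]
    _ ≤ _ := by
        rw [mul_add (lpNorm (X - Y) 4 P)]
        exact mul_le_mul_of_nonneg_left (add_le_add (integral_norm_mul_norm_le hXY hX)
          (integral_norm_mul_norm_le hXY hY)) (norm_nonneg _)

end FourthMoments

end DropoutSGD

/-! ### Random affine recursions that contract in `L⁴` -/

namespace DropoutSGD

/-- A random affine recursion `u ↦ A(θ_k) u + b(θ_k)` driven by an i.i.d. sequence `θ`, which is
centred and contracts in `L⁴`. -/
structure AffineRecursion {Ω Θ : Type*} [MeasurableSpace Ω] [MeasurableSpace Θ] (P : Measure Ω)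
    {d : ℕ} (θ : ℤ → Ω → Θ) (A : Θ → Vec d →L[ℝ] Vec d) (b : Θ → Vec d)
    (B : Vec d →L[ℝ] Vec d) (r : ℝ) : Prop where
  measurable_input : ∀ k, Measurable (θ k)
  indep : iIndepFun θ P
  ident : ∀ k l, P.map (θ k) = P.map (θ l)
  measurable_A : ∀ v, Measurable fun t => A t v
  measurable_b : Measurable b
  mean_A : ∀ k v, ∫ ω, A (θ k ω) v ∂P = B v
  mean_b : ∀ k, ∫ ω, b (θ k ω) ∂P = 0
  memLp_b : ∀ k, MemLp (fun ω => b (θ k ω)) 4 P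
  contracts : ∀ k v, ∫⁻ ω, ‖A (θ k ω) v‖ₑ ^ 4 ∂P ≤ ENNReal.ofReal r ^ 4 * ‖v‖ₑ ^ 4
  nonneg : 0 ≤ r
  lt_one : r < 1

/-- The `σ`-algebra of the inputs up to time `k`. -/
@[reducible] def past {Ω Θ : Type*} [MeasurableSpace Θ] (θ : ℤ → Ω → Θ) (k : ℤ) :
    MeasurableSpace Ω :=
  ⨆ j ∈ Set.Iic k, MeasurableSpace.comap (θ j) inferInstance

/-- The state at time `s + j` of the recursion started from `v` at time `s`. -/
def orbit {Ω Θ : Type*} {d : ℕ} (θ : ℤ → Ω → Θ) (A : Θ → Vec d →L[ℝ] Vec d) (b : Θ → Vec d)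
    (s : ℤ) (v : Ω → Vec d) : ℕ → Ω → Vec d
  | 0 => v
  | j + 1 => fun ω => A (θ (s + j + 1) ω) (orbit θ A b s v j ω) + b (θ (s + j + 1) ω)

section Orbit

variable {Ω Θ : Type*} {d : ℕ} {θ : ℤ → Ω → Θ} {A : Θ → Vec d →L[ℝ] Vec d} {b : Θ → Vec d}

lemma orbit_zero (s : ℤ) (v : Ω → Vec d) : orbit θ A b s v 0 = v := rfl

lemma orbit_succ (s : ℤ) (v : Ω → Vec d) (j : ℕ) (ω : Ω) : orbit θ A b s v (j + 1) ω =
    A (θ (s + j + 1) ω) (orbit θ A b s v j ω) + b (θ (s + j + 1) ω) := rfl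

/-- The flow property: an orbit can be restarted from its current state. It turns each block into a
block sum of a fresh orbit. -/
lemma orbit_add (s : ℤ) (v : Ω → Vec d) (i j : ℕ) :
    orbit θ A b s v (i + j) = orbit θ A b (s + i) (orbit θ A b s v i) j := by
  induction j with
  | zero => rfl
  | succ j ih =>
    funext ω
    rw [← add_assoc, orbit_succ, orbit_succ, ih]
    push_cast
    simp only [add_assoc]

variable [MeasurableSpace Θ]

lemma measurable_input_past (k : ℤ) {j : ℤ} (hj : j ≤ k) : Measurable[past θ k] (θ j) := by
  have h : MeasurableSpace.comap (θ j) inferInstance ≤ past θ k :=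
    le_iSup₂_of_le (f := fun j (_ : j ∈ Set.Iic k) => MeasurableSpace.comap (θ j) inferInstance)
      j hj le_rfl
  exact (comap_measurable (θ j)).mono h le_rfl

lemma past_mono {k l : ℤ} (h : k ≤ l) : past θ k ≤ past θ l :=
  iSup₂_le fun _ hj => (measurable_input_past l (le_trans hj h)).comap_le

/-- Measurability of `A` is assumed only for each fixed vector; linearity in the vector and a finite
basis upgrade it to joint measurability. -/
lemma measurable_apply (hA : ∀ v, Measurable fun t => A t v) :
    Measurable fun z : Θ × Vec d => A z.1 z.2 := by
  have h : (fun z : Θ × Vec d => A z.1 z.2) = fun z => ∑ i : Fin d,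
      z.2 i • A z.1 (EuclideanSpace.basisFun (Fin d) ℝ i) := by
    funext z
    conv_lhs => rw [← (EuclideanSpace.basisFun (Fin d) ℝ).sum_repr z.2]
    simp
  rw [h]
  refine Finset.measurable_sum _ fun i _ => ?_
  have h1 : Measurable fun z : Θ × Vec d => z.2 i := by fun_prop
  exact h1.smul ((hA _).comp measurable_fst)

lemma measurable_step (hA : ∀ v, Measurable fun t => A t v) (hb : Measurable b)
    {m : MeasurableSpace Ω} {V : Ω → Vec d} {k : ℤ} (hV : Measurable[m] V)
    (hθ : Measurable[m] (θ k)) : Measurable[m] fun ω => A (θ k ω) (V ω) + b (θ k ω) :=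
  ((measurable_apply hA).comp (hθ.prodMk hV)).add (hb.comp hθ)

/-- The `σ`-algebra is arbitrary because two are needed: the past, and the one generated by the
inputs after the starting time. -/
lemma measurable_orbit (hA : ∀ v, Measurable fun t => A t v) (hb : Measurable b)
    {m : MeasurableSpace Ω} {s : ℤ} {v : Ω → Vec d} (hv : Measurable[m] v)
    (j : ℕ) (hθ : ∀ i : ℤ, s < i → i ≤ s + j → Measurable[m] (θ i)) :
    Measurable[m] (orbit θ A b s v j) := by
  induction j with
  | zero => exact hv
  | succ j ih =>
    refine measurable_step hA hb (ih fun i h1 h2 => hθ i h1 (by push_cast; omega)) ?_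
    exact hθ _ (by omega) (by push_cast; omega)

end Orbit

variable {Ω Θ : Type*} [mΩ : MeasurableSpace Ω] [MeasurableSpace Θ] {P : Measure Ω}
  {d : ℕ} {θ : ℤ → Ω → Θ} {A : Θ → Vec d →L[ℝ] Vec d} {b : Θ → Vec d}
  {B : Vec d →L[ℝ] Vec d} {r : ℝ}

namespace AffineRecursion

variable (R : AffineRecursion P θ A b B r)
include R

lemma past_le (k : ℤ) : past θ k ≤ mΩ :=
  iSup₂_le fun j _ => (R.measurable_input j).comap_le

lemma measurable_orbit_past {s : ℤ} {v : Ω → Vec d} (hv : Measurable[past θ s] v) (j : ℕ) :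
    Measurable[past θ (s + j)] (orbit θ A b s v j) :=
  measurable_orbit R.measurable_A R.measurable_b (hv.mono (past_mono (by omega)) le_rfl) j
    fun _ _ h => measurable_input_past _ h

lemma indep_past {β γ : Type*} [MeasurableSpace β] [MeasurableSpace γ] {k : ℤ} {X : Ω → β}
    {Y : Ω → γ} (hX : Measurable[past θ k] X)
    (hY : Measurable[⨆ j ∈ Set.Ioi k, MeasurableSpace.comap (θ j) inferInstance] Y) :
    IndepFun X Y P := by
  rw [IndepFun_iff_Indep]
  refine indep_of_indep_of_le_left (indep_of_indep_of_le_right ?_ hY.comap_le) hX.comap_le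
  exact indep_iSup_of_disjoint (fun j => (R.measurable_input j).comap_le) R.indep
    (Set.Iic_disjoint_Ioi le_rfl)

lemma indep_input {β : Type*} [MeasurableSpace β] {k : ℤ} {X : Ω → β}
    (hX : Measurable[past θ k] X) : IndepFun X (θ (k + 1)) P := by
  refine R.indep_past hX ?_
  exact (comap_measurable (θ (k + 1))).mono (le_iSup₂_of_le
    (f := fun j (_ : j ∈ Set.Ioi k) => MeasurableSpace.comap (θ j) inferInstance)
      (k + 1) (by simp) le_rfl) le_rfl

lemma lpNorm_b_eq (k l : ℤ) :
    lpNorm (fun ω => b (θ k ω)) 4 P = lpNorm (fun ω => b (θ l ω)) 4 P := by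
  rw [← toReal_eLpNorm (R.memLp_b k).1, ← toReal_eLpNorm (R.memLp_b l).1]
  have h : ∀ k, eLpNorm (fun ω => b (θ k ω)) 4 P = eLpNorm b 4 (P.map (θ k)) := fun k => by
    rw [eLpNorm_map_measure R.measurable_b.aestronglyMeasurable (R.measurable_input k).aemeasurable]
    rfl
  rw [h, h, R.ident k l]

variable [IsProbabilityMeasure P]

/-- A state known at time `k` is independent of the input at time `k + 1`, so by Tonelli it can be
frozen and `contracts` applied for each of its values. The lower integral requires no prior
integrability. -/
lemma lintegral_A_le {k : ℤ} {V : Ω → Vec d} (hV : Measurable[past θ k] V) :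
    ∫⁻ ω, ‖A (θ (k + 1) ω) (V ω)‖ₑ ^ 4 ∂P ≤ ENNReal.ofReal r ^ 4 * ∫⁻ ω, ‖V ω‖ₑ ^ 4 ∂P := by
  have hV' : Measurable V := hV.mono (R.past_le k) le_rfl
  have hθ := R.measurable_input (k + 1)
  have hm := measurable_apply R.measurable_A
  have hmap := (R.indep_input hV).symm.map_prod_eq_prod_map_map hθ.aemeasurable hV'.aemeasurable
  have hg : Measurable fun z : Θ × Vec d => ‖A z.1 z.2‖ₑ ^ 4 := hm.enorm.pow_const 4
  have e1 : ∫⁻ ω, ‖A (θ (k + 1) ω) (V ω)‖ₑ ^ 4 ∂P =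
      ∫⁻ z, ‖A z.1 z.2‖ₑ ^ 4 ∂(P.map fun ω => (θ (k + 1) ω, V ω)) := by
    rw [lintegral_map hg (hθ.prodMk hV')]
  have : IsProbabilityMeasure (P.map (θ (k + 1))) := Measure.isProbabilityMeasure_map hθ.aemeasurable
  have : IsProbabilityMeasure (P.map V) := Measure.isProbabilityMeasure_map hV'.aemeasurable
  rw [e1, hmap, lintegral_prod_symm _ hg.aemeasurable, ← lintegral_const_mul _ (by fun_prop)]
  rw [lintegral_map (by exact hg.lintegral_prod_left') hV']
  refine lintegral_mono fun ω => ?_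
  have := R.contracts (k + 1) (V ω)
  rwa [lintegral_map (by exact hg.comp measurable_prodMk_right) hθ]

lemma eLpNorm_A_le {k : ℤ} {V : Ω → Vec d} (hV : Measurable[past θ k] V) :
    eLpNorm (fun ω => A (θ (k + 1) ω) (V ω)) 4 P ≤ ENNReal.ofReal r * eLpNorm V 4 P := by
  have h := R.lintegral_A_le hV
  rw [eLpNorm_eq_lintegral_rpow_enorm_toReal (by norm_num) (by norm_num),
    eLpNorm_eq_lintegral_rpow_enorm_toReal (by norm_num) (by norm_num)]
  have h4 : (4 : ℝ≥0∞).toReal = (4 : ℕ) := by norm_num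
  simp only [h4, ENNReal.rpow_natCast]
  calc _ ≤ (ENNReal.ofReal r ^ 4 * ∫⁻ ω, ‖V ω‖ₑ ^ 4 ∂P) ^ (1 / ((4 : ℕ) : ℝ)) :=
        ENNReal.rpow_le_rpow h (by positivity)
    _ = _ := by
        rw [ENNReal.mul_rpow_of_nonneg _ _ (by positivity), ← ENNReal.rpow_natCast,
          ← ENNReal.rpow_mul]
        norm_num

lemma memLp_A {k : ℤ} {V : Ω → Vec d} (hV : Measurable[past θ k] V) (hV4 : MemLp V 4 P) :
    MemLp (fun ω => A (θ (k + 1) ω) (V ω)) 4 P := by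
  refine ⟨((measurable_apply R.measurable_A).comp ((R.measurable_input _).prodMk
    (hV.mono (R.past_le k) le_rfl))).aestronglyMeasurable, ?_⟩
  exact (R.eLpNorm_A_le hV).trans_lt (ENNReal.mul_lt_top ENNReal.ofReal_lt_top hV4.2)

lemma lpNorm_A_le {k : ℤ} {V : Ω → Vec d} (hV : Measurable[past θ k] V) (hV4 : MemLp V 4 P) :
    lpNorm (fun ω => A (θ (k + 1) ω) (V ω)) 4 P ≤ r * lpNorm V 4 P := by
  refine lpNorm_le_of_eLpNorm_le (R.memLp_A hV hV4) (mul_nonneg R.nonneg lpNorm_nonneg) ?_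
  rw [ENNReal.ofReal_mul R.nonneg, ofReal_lpNorm hV4]
  exact R.eLpNorm_A_le hV

lemma memLp_A_const (k : ℤ) (v : Vec d) : MemLp (fun ω => A (θ k ω) v) 4 P := by
  have h := R.memLp_A (k := k - 1) (V := fun _ => v) measurable_const (memLp_const v)
  rwa [sub_add_cancel] at h

/-- Jensen: a mean is bounded by the `L⁴` norm. The powers of `B` therefore decay geometrically and
`I - B` is bounded below by `1 - r`. -/
lemma norm_B_le (v : Vec d) : ‖B v‖ ≤ r * ‖v‖ := by
  rw [← R.mean_A (0 + 1) v]
  refine (norm_integral_le_integral_norm _).trans ?_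
  refine (integral_norm_le_lpNorm (p := 4) (by norm_num) (R.memLp_A_const _ v)).trans ?_
  refine (R.lpNorm_A_le (V := fun _ => v) measurable_const (memLp_const v)).trans ?_
  rw [lpNorm_const' (by norm_num) (by norm_num)]
  simp

lemma norm_B_pow_le (v : Vec d) (k : ℕ) : ‖(B ^ k) v‖ ≤ r ^ k * ‖v‖ := by
  induction k with
  | zero => simp
  | succ k ih =>
    rw [pow_succ', pow_succ', mul_apply_eq_comp, mul_assoc]
    exact (R.norm_B_le _).trans (mul_le_mul_of_nonneg_left ih R.nonneg)

lemma memLp_orbit {s : ℤ} {v : Ω → Vec d} (hv : Measurable[past θ s] v) (hv4 : MemLp v 4 P)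
    (j : ℕ) : MemLp (orbit θ A b s v j) 4 P := by
  induction j with
  | zero => exact hv4
  | succ j ih => exact (R.memLp_A (R.measurable_orbit_past hv j) ih).add (R.memLp_b _)

/-- Synchronous coupling: with common inputs the constants `b` cancel in the difference, which
follows the purely linear recursion. -/
lemma lpNorm_orbit_sub_le {s : ℤ} {v v' : Ω → Vec d} (hv : Measurable[past θ s] v)
    (hv4 : MemLp v 4 P) (hv' : Measurable[past θ s] v') (hv4' : MemLp v' 4 P) (j : ℕ) :
    lpNorm (orbit θ A b s v j - orbit θ A b s v' j) 4 P ≤ r ^ j * lpNorm (v - v') 4 P := by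
  induction j with
  | zero => simp [orbit_zero]
  | succ j ih =>
    have e : orbit θ A b s v (j + 1) - orbit θ A b s v' (j + 1) =
        fun ω => A (θ (s + j + 1) ω) ((orbit θ A b s v j - orbit θ A b s v' j) ω) := by
      funext ω
      simp [orbit_succ]
    rw [e, pow_succ', mul_assoc]
    refine (R.lpNorm_A_le ((R.measurable_orbit_past hv j).sub (R.measurable_orbit_past hv' j))
      ((R.memLp_orbit hv hv4 j).sub (R.memLp_orbit hv' hv4' j))).trans ?_
    exact mul_le_mul_of_nonneg_left ih R.nonneg

/-- The orbits are bounded in `L⁴`, uniformly in time. -/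
lemma lpNorm_orbit_le {s : ℤ} {v : Ω → Vec d} (hv : Measurable[past θ s] v) (hv4 : MemLp v 4 P)
    (j : ℕ) : lpNorm (orbit θ A b s v j) 4 P ≤
      lpNorm v 4 P + lpNorm (fun ω => b (θ 0 ω)) 4 P / (1 - r) := by
  have h1 : 0 < 1 - r := sub_pos.2 R.lt_one
  set β := lpNorm (fun ω => b (θ 0 ω)) 4 P
  have hβ : 0 ≤ β := lpNorm_nonneg
  have hN : 0 ≤ lpNorm v 4 P := lpNorm_nonneg
  induction j with
  | zero => exact le_add_of_nonneg_right (by positivity)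
  | succ j ih =>
    have h2 := lpNorm_add_le (g := fun ω => b (θ (s + j + 1) ω))
      (R.memLp_A (R.measurable_orbit_past hv j) (R.memLp_orbit hv hv4 j)) (by norm_num)
    rw [R.lpNorm_b_eq _ 0] at h2
    have h3 := R.lpNorm_A_le (R.measurable_orbit_past hv j) (R.memLp_orbit hv hv4 j)
    refine h2.trans ?_
    have h4 : r * lpNorm (orbit θ A b s v j) 4 P ≤ r * (lpNorm v 4 P + β / (1 - r)) :=
      mul_le_mul_of_nonneg_left ih R.nonneg
    have h5 : r * lpNorm v 4 P ≤ lpNorm v 4 P := mul_le_of_le_one_left hN R.lt_one.le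
    -- The constant `β / (1 - r)` is the fixed point of `t ↦ r t + β`, which makes the bound stable
    -- under one step.
    have h6 : r * (β / (1 - r)) + β = β / (1 - r) := by field_simp; ring
    rw [mul_add] at h4
    linarith

/-- One step of the recursion in mean, tested against a random variable of the past. -/
lemma integral_smul_step {k : ℤ} {Y : Ω → ℝ} {U : Ω → Vec d} (hY : Measurable[past θ k] Y)
    (hU : Measurable[past θ k] U) (hYi : Integrable Y P)
    (hYU : Integrable (fun ω => Y ω • U ω) P) :
    Integrable (fun ω => Y ω • (A (θ (k + 1) ω) (U ω) + b (θ (k + 1) ω))) P ∧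
    ∫ ω, Y ω • (A (θ (k + 1) ω) (U ω) + b (θ (k + 1) ω)) ∂P = B (∫ ω, Y ω • U ω ∂P) := by
  -- In coordinates, `A (U)` is a sum of a scalar from the past times a vector that depends on the
  -- new input alone, so independence factors each term.
  have hcoord : ∀ i : Fin d, Measurable[past θ k] fun ω => Y ω * U ω i := fun i =>
    hY.mul ((by fun_prop : Measurable fun u : Vec d => u i).comp hU)
  have hint : ∀ i : Fin d, Integrable (fun ω => Y ω * U ω i) P := fun i => by
    have h := ((EuclideanSpace.proj i : Vec d →L[ℝ] ℝ)).integrable_comp hYU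
    exact h.congr (.of_forall fun ω => by simp)
  have hval : ∀ i : Fin d, ∫ ω, Y ω * U ω i ∂P = (∫ ω, Y ω • U ω ∂P) i := fun i => by
    have h := ((EuclideanSpace.proj i : Vec d →L[ℝ] ℝ)).integral_comp_comm hYU
    simpa using h
  set e := fun i : Fin d => EuclideanSpace.basisFun (Fin d) ℝ i
  have hdec : (fun ω => Y ω • (A (θ (k + 1) ω) (U ω) + b (θ (k + 1) ω))) = fun ω =>
      ∑ i : Fin d, (Y ω * U ω i) • A (θ (k + 1) ω) (e i) + Y ω • b (θ (k + 1) ω) := by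
    funext ω
    rw [smul_add]
    congr 1
    conv_lhs => rw [← (EuclideanSpace.basisFun (Fin d) ℝ).sum_repr (U ω)]
    simp [Finset.smul_sum, smul_smul, e]
  have ind : ∀ i, IndepFun (fun ω => Y ω * U ω i) (fun ω => A (θ (k + 1) ω) (e i)) P := fun i =>
    (R.indep_input (hcoord i)).comp measurable_id (R.measurable_A (e i))
  have indb : IndepFun Y (fun ω => b (θ (k + 1) ω)) P :=
    (R.indep_input hY).comp measurable_id R.measurable_b
  have hAi : ∀ i, Integrable (fun ω => A (θ (k + 1) ω) (e i)) P := fun i =>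
    integrable_of_memLp_four (R.memLp_A_const _ _)
  have hbi : Integrable (fun ω => b (θ (k + 1) ω)) P := integrable_of_memLp_four (R.memLp_b _)
  have i1 : ∀ i, Integrable (fun ω => (Y ω * U ω i) • A (θ (k + 1) ω) (e i)) P := fun i =>
    (ind i).integrable_smul (hint i) (hAi i)
  have i2 : Integrable (fun ω => Y ω • b (θ (k + 1) ω)) P := indb.integrable_smul hYi hbi
  rw [hdec]
  refine ⟨(integrable_finsetSum _ fun i _ => i1 i).add i2, ?_⟩
  rw [integral_add (integrable_finsetSum _ fun i _ => i1 i) i2,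
    integral_finsetSum _ fun i _ => i1 i,
    indb.integral_fun_smul_eq_smul_integral hYi.1 hbi.1, R.mean_b, smul_zero, add_zero]
  conv_rhs => rw [← (EuclideanSpace.basisFun (Fin d) ℝ).sum_repr (∫ ω, Y ω • U ω ∂P)]
  rw [map_sum]
  refine Finset.sum_congr rfl fun i _ => ?_
  rw [(ind i).integral_fun_smul_eq_smul_integral (hint i).1 (hAi i).1, R.mean_A, hval, map_smul]
  simp [e]

/-- Only the number of steps matters for the law of an orbit started at `0`, because the inputs are
identically distributed and each is independent of the current state. This is where stationarity of
`Z` comes from. -/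
lemma map_orbit_zero (s s' : ℤ) (j : ℕ) :
    P.map (orbit θ A b s (fun _ => 0) j) = P.map (orbit θ A b s' (fun _ => 0) j) := by
  induction j with
  | zero => rfl
  | succ j ih =>
    have hF : Measurable fun z : Θ × Vec d => A z.1 z.2 + b z.1 :=
      (measurable_apply R.measurable_A).add (R.measurable_b.comp measurable_fst)
    have key : ∀ s, P.map (orbit θ A b s (fun _ => 0) (j + 1)) =
        ((P.map (θ 0)).prod (P.map (orbit θ A b s (fun _ => 0) j))).map
          fun z => A z.1 z.2 + b z.1 := fun s => by
      have hm := R.measurable_orbit_past (s := s) (v := fun _ => 0) measurable_const j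
      have hm' := hm.mono (R.past_le _) le_rfl
      have hθ := R.measurable_input (s + j + 1)
      rw [R.ident 0 (s + j + 1),
        ← (R.indep_input hm).symm.map_prod_eq_prod_map_map hθ.aemeasurable hm'.aemeasurable,
        Measure.map_map hF (hθ.prodMk hm')]
      rfl
    rw [key s, key s', ih]

end AffineRecursion

end DropoutSGD

/-! ### A fourth-moment Burkholder inequality and the size of block sums -/

namespace DropoutSGD

section Burkholder

variable {Ω : Type*} [MeasurableSpace Ω] {P : Measure Ω}
  {E : Type*} [NormedAddCommGroup E]

lemma integral_sq_mul_sq_le {X Y : Ω → E} (hX : MemLp X 4 P) (hY : MemLp Y 4 P) :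
    Integrable (fun ω => ‖X ω‖ ^ 2 * ‖Y ω‖ ^ 2) P ∧
    ∫ ω, ‖X ω‖ ^ 2 * ‖Y ω‖ ^ 2 ∂P ≤ lpNorm X 4 P ^ 2 * lpNorm Y 4 P ^ 2 := by
  have h2 : ∀ {X : Ω → E}, MemLp X 4 P → MemLp (fun ω => ‖X ω‖ ^ 2) 2 P := fun hX => by
    rw [memLp_two_iff_integrable_sq (by have := hX.1; fun_prop)]
    refine (integrable_norm_pow_four hX).congr (.of_forall fun ω => ?_)
    simp only; ring
  have hn : ∀ {X : Ω → E}, MemLp X 4 P → lpNorm (fun ω => ‖X ω‖ ^ 2) 2 P = lpNorm X 4 P ^ 2 :=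
    fun {X} hX => by
    have h := lpNorm_two_sq (h2 hX)
    have h' := lpNorm_four_pow hX
    rw [← abs_of_nonneg (lpNorm_nonneg (f := fun ω => ‖X ω‖ ^ 2) (p := 2) (μ := P)),
      ← abs_of_nonneg (sq_nonneg (lpNorm X 4 P))]
    rw [← sq_eq_sq_iff_abs_eq_abs, h, ← pow_mul, h']
    refine integral_congr_ae (.of_forall fun ω => ?_)
    simp only [Real.norm_eq_abs, sq_abs]; ring
  have hi := integrable_norm_mul_norm (h2 hX) (h2 hY)
  have hl := integral_norm_mul_norm_le_two (h2 hX) (h2 hY)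
  rw [hn hX, hn hY] at hl
  simp only [norm_pow, norm_norm] at hi hl
  exact ⟨hi, hl⟩

variable [InnerProductSpace ℝ E]

/-- Expand `(‖M‖² + 2⟨M, x⟩ + ‖x‖²)²`. The term linear in `x` is kept exactly, since it integrates
to zero for martingale increments. The rest is bounded by Cauchy–Schwarz and `2‖M‖‖x‖³ ≤ ‖M‖²‖x‖² +
‖x‖⁴`, which gives `8 = 4 + 2 + 2` and `3 = 1 + 2`. -/
lemma norm_add_pow_four_le (M x : E) :
    ‖M + x‖ ^ 4 ≤ ‖M‖ ^ 4 + 4 * (‖M‖ ^ 2 * inner ℝ M x) + 8 * (‖M‖ ^ 2 * ‖x‖ ^ 2)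
      + 3 * ‖x‖ ^ 4 := by
  have h := norm_add_sq_real M x
  have e : ‖M + x‖ ^ 4 = (‖M‖ ^ 2 + 2 * inner ℝ M x + ‖x‖ ^ 2) ^ 2 := by rw [← h]; ring
  have hi : |inner ℝ M x| ≤ ‖M‖ * ‖x‖ := abs_real_inner_le_norm M x
  have h1 : (inner ℝ M x) ^ 2 ≤ (‖M‖ * ‖x‖) ^ 2 := sq_le_sq' (abs_le.1 hi).1 (abs_le.1 hi).2
  have h2 : inner ℝ M x * ‖x‖ ^ 2 ≤ (‖M‖ * ‖x‖) * ‖x‖ ^ 2 :=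
    mul_le_mul_of_nonneg_right (abs_le.1 hi).2 (by positivity)
  have h3 : 0 ≤ (‖M‖ * ‖x‖ - ‖x‖ ^ 2) ^ 2 := sq_nonneg _
  rw [e]
  nlinarith

/-- A fourth-moment Burkholder inequality: sums of `L` terms, each orthogonal to the cube of the
preceding partial sum, have `L⁴` norm of order `√L`. -/
lemma lpNorm_four_sq_le_of_orthogonal {M x : ℕ → Ω → E} {σ : ℝ} (hM0 : M 0 = 0)
    (hM : ∀ n, M (n + 1) = M n + x n) (hx : ∀ n, MemLp (x n) 4 P) (hσ : ∀ n, lpNorm (x n) 4 P ≤ σ)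
    (horth : ∀ n, ∫ ω, ‖M n ω‖ ^ 2 * inner ℝ (M n ω) (x n ω) ∂P = 0) (n : ℕ) :
    MemLp (M n) 4 P ∧ lpNorm (M n) 4 P ^ 2 ≤ 4 * n * σ ^ 2 := by
  have hσ0 : 0 ≤ σ := lpNorm_nonneg.trans (hσ 0)
  induction n with
  | zero => rw [hM0]; simp
  | succ n ih =>
    obtain ⟨ihm, ih⟩ := ih
    have hm : MemLp (M (n + 1)) 4 P := by rw [hM]; exact ihm.add (hx n)
    refine ⟨hm, ?_⟩
    have i0 := integrable_norm_pow_four ihm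
    have i3 := integrable_norm_pow_four (hx n)
    obtain ⟨i2, l2⟩ := integral_sq_mul_sq_le ihm (hx n)
    have i1 : Integrable (fun ω => ‖M n ω‖ ^ 2 * inner ℝ (M n ω) (x n ω)) P := by
      refine (i0.add i2).mono' ?_ (.of_forall fun ω => ?_)
      · have h1 := ihm.1
        have h2 := (hx n).1
        exact (h1.norm.pow 2).mul (h1.inner h2)
      · have hi : |inner ℝ (M n ω) (x n ω)| ≤ ‖M n ω‖ * ‖x n ω‖ := abs_real_inner_le_norm _ _
        rw [norm_mul, norm_pow, norm_norm, Real.norm_eq_abs]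
        calc _ ≤ ‖M n ω‖ ^ 2 * (‖M n ω‖ * ‖x n ω‖) := by gcongr
          _ ≤ ‖M n ω‖ ^ 4 + ‖M n ω‖ ^ 2 * ‖x n ω‖ ^ 2 := by
            nlinarith [sq_nonneg (‖M n ω‖ * (‖M n ω‖ - ‖x n ω‖)), sq_nonneg (‖M n ω‖ * ‖x n ω‖),
              sq_nonneg (‖M n ω‖ ^ 2)]
    have key : lpNorm (M (n + 1)) 4 P ^ 4 ≤
        lpNorm (M n) 4 P ^ 4 + 8 * (lpNorm (M n) 4 P ^ 2 * lpNorm (x n) 4 P ^ 2) +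
          3 * lpNorm (x n) 4 P ^ 4 := by
      rw [lpNorm_four_pow hm, lpNorm_four_pow ihm, lpNorm_four_pow (hx n)]
      calc _ ≤ ∫ ω, ‖M n ω‖ ^ 4 + 4 * (‖M n ω‖ ^ 2 * inner ℝ (M n ω) (x n ω)) +
              8 * (‖M n ω‖ ^ 2 * ‖x n ω‖ ^ 2) + 3 * ‖x n ω‖ ^ 4 ∂P := by
            refine integral_mono (integrable_norm_pow_four hm)
              (((i0.add (i1.const_mul 4)).add (i2.const_mul 8)).add (i3.const_mul 3)) fun ω => ?_
            simp only [hM, Pi.add_apply]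
            exact norm_add_pow_four_le _ _
        _ = ∫ ω, ‖M n ω‖ ^ 4 ∂P + 8 * ∫ ω, ‖M n ω‖ ^ 2 * ‖x n ω‖ ^ 2 ∂P +
              3 * ∫ ω, ‖x n ω‖ ^ 4 ∂P := by
            have j1 : Integrable (fun ω => ‖M n ω‖ ^ 4 +
                4 * (‖M n ω‖ ^ 2 * inner ℝ (M n ω) (x n ω))) P := i0.add (i1.const_mul 4)
            have j2 : Integrable (fun ω => ‖M n ω‖ ^ 4 + 4 * (‖M n ω‖ ^ 2 *
                inner ℝ (M n ω) (x n ω)) + 8 * (‖M n ω‖ ^ 2 * ‖x n ω‖ ^ 2)) P :=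
              j1.add (i2.const_mul 8)
            rw [integral_add j2 (i3.const_mul 3), integral_add j1 (i2.const_mul 8),
              integral_add i0 (i1.const_mul 4), integral_const_mul, integral_const_mul,
              integral_const_mul, horth]
            ring
        _ ≤ _ := by linarith
    have hN := lpNorm_nonneg (f := M n) (p := 4) (μ := P)
    have hX := lpNorm_nonneg (f := x n) (p := 4) (μ := P)
    have hX2 : lpNorm (x n) 4 P ^ 2 ≤ σ ^ 2 := pow_le_pow_left₀ hX (hσ n) 2
    have hX4 : lpNorm (x n) 4 P ^ 4 ≤ σ ^ 4 := pow_le_pow_left₀ hX (hσ n) 4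
    have hM4 : lpNorm (M n) 4 P ^ 4 ≤ (4 * n * σ ^ 2) ^ 2 := by
      calc _ = (lpNorm (M n) 4 P ^ 2) ^ 2 := by ring
        _ ≤ _ := pow_le_pow_left₀ (by positivity) ih 2
    have hmid : lpNorm (M n) 4 P ^ 2 * lpNorm (x n) 4 P ^ 2 ≤ (4 * n * σ ^ 2) * σ ^ 2 :=
      mul_le_mul ih hX2 (by positivity) (by positivity)
    -- The induction closes because `16 n² + 32 n + 3 ≤ 16 (n + 1)²`; this fixes the constant `4`.
    refine abs_le_of_sq_le_sq' ?_ (by positivity) |>.2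
    push_cast
    nlinarith [pow_nonneg hσ0 4]

end Burkholder

variable {Ω Θ : Type*} [mΩ : MeasurableSpace Ω] [MeasurableSpace Θ] {P : Measure Ω}
  {d : ℕ} {θ : ℤ → Ω → Θ} {A : Θ → Vec d →L[ℝ] Vec d} {b : Θ → Vec d}
  {B : Vec d →L[ℝ] Vec d} {r : ℝ}

/-- The sum of the first `L` states of an orbit. -/
def blockSum (θ : ℤ → Ω → Θ) (A : Θ → Vec d →L[ℝ] Vec d) (b : Θ → Vec d)
    (s : ℤ) (v : Ω → Vec d) (L : ℕ) : Ω → Vec d :=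
  fun ω => ∑ j ∈ Finset.range L, orbit θ A b s v j ω

namespace AffineRecursion

variable (R : AffineRecursion P θ A b B r) [IsProbabilityMeasure P]
include R

/-- The martingale-difference property: the innovation `A U + b - B U` is orthogonal to every vector
`G` of the past. It reduces to `integral_smul_step` with the coordinates of `G` as weights. -/
lemma integral_inner_step {k : ℤ} {G U : Ω → Vec d} (hG : Measurable[past θ k] G)
    (hU : Measurable[past θ k] U) (hGi : Integrable G P)
    (hGU : Integrable (fun ω => ‖G ω‖ * ‖U ω‖) P) :
    ∫ ω, inner ℝ (G ω) (A (θ (k + 1) ω) (U ω) + b (θ (k + 1) ω) - B (U ω)) ∂P = 0 := by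
  have hG' := hG.mono (R.past_le k) le_rfl
  have hU' := hU.mono (R.past_le k) le_rfl
  have hYm : ∀ i : Fin d, Measurable[past θ k] fun ω => G ω i := fun i =>
    (by fun_prop : Measurable fun u : Vec d => u i).comp hG
  have hYi : ∀ i : Fin d, Integrable (fun ω => G ω i) P := fun i =>
    (EuclideanSpace.proj i : Vec d →L[ℝ] ℝ).integrable_comp hGi
  have hYU : ∀ i : Fin d, Integrable (fun ω => G ω i • U ω) P := fun i => by
    refine hGU.mono' (((hYm i).mono (R.past_le k) le_rfl).smul hU').aestronglyMeasurable
      (.of_forall fun ω => ?_)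
    rw [norm_smul]
    exact mul_le_mul_of_nonneg_right (PiLp.norm_apply_le _ _) (norm_nonneg _)
  have hz : ∀ i : Fin d,
      Integrable (fun ω => G ω i • (A (θ (k + 1) ω) (U ω) + b (θ (k + 1) ω) - B (U ω))) P ∧
      ∫ ω, G ω i • (A (θ (k + 1) ω) (U ω) + b (θ (k + 1) ω) - B (U ω)) ∂P = 0 := fun i => by
    obtain ⟨j1, e1⟩ := R.integral_smul_step (hYm i) hU (hYi i) (hYU i)
    have j2 : Integrable (fun ω => G ω i • B (U ω)) P := by
      simpa using B.integrable_comp (hYU i)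
    have e2 : ∫ ω, G ω i • B (U ω) ∂P = B (∫ ω, G ω i • U ω ∂P) := by
      rw [← B.integral_comp_comm (hYU i)]
      simp
    simp only [smul_sub]
    refine ⟨j1.sub j2, ?_⟩
    rw [integral_sub j1 j2, e1, e2, sub_self]
  have hpr : ∀ i : Fin d,
      Integrable (fun ω => G ω i * (A (θ (k + 1) ω) (U ω) + b (θ (k + 1) ω) - B (U ω)) i) P ∧
      ∫ ω, G ω i * (A (θ (k + 1) ω) (U ω) + b (θ (k + 1) ω) - B (U ω)) i ∂P = 0 := fun i => by
    have h1 := (EuclideanSpace.proj i : Vec d →L[ℝ] ℝ).integrable_comp (hz i).1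
    have h2 := (EuclideanSpace.proj i : Vec d →L[ℝ] ℝ).integral_comp_comm (hz i).1
    rw [(hz i).2] at h2
    simp only [PiLp.proj_apply, PiLp.smul_apply, smul_eq_mul, PiLp.zero_apply] at h1 h2
    exact ⟨h1, h2⟩
  have e : (fun ω => inner ℝ (G ω) (A (θ (k + 1) ω) (U ω) + b (θ (k + 1) ω) - B (U ω))) =
      fun ω => ∑ i : Fin d, G ω i * (A (θ (k + 1) ω) (U ω) + b (θ (k + 1) ω) - B (U ω)) i := by
    funext ω
    rw [PiLp.inner_apply]
    exact Finset.sum_congr rfl fun i _ => by simp [mul_comm]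
  rw [e, integral_finsetSum _ fun i _ => (hpr i).1]
  exact Finset.sum_eq_zero fun i _ => (hpr i).2

omit [IsProbabilityMeasure P] in
lemma measurable_blockSum {s : ℤ} {v : Ω → Vec d} (hv : Measurable[past θ s] v) (L : ℕ) {k : ℤ}
    (hk : s + L ≤ k + 1) : Measurable[past θ k] (blockSum θ A b s v L) := by
  refine Finset.measurable_sum _ fun j hj => ?_
  have := Finset.mem_range.1 hj
  exact (R.measurable_orbit_past hv j).mono (past_mono (by omega)) le_rfl

lemma memLp_blockSum {s : ℤ} {v : Ω → Vec d} (hv : Measurable[past θ s] v) (hv4 : MemLp v 4 P)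
    (L : ℕ) : MemLp (blockSum θ A b s v L) 4 P :=
  memLp_finsetSum _ fun j _ => R.memLp_orbit hv hv4 j

/-- Block sums of length `L` have `L⁴` norm of order `√L`. -/
lemma lpNorm_blockSum_le {s : ℤ} {v : Ω → Vec d} (hv : Measurable[past θ s] v)
    (hv4 : MemLp v 4 P) (L : ℕ) : lpNorm (blockSum θ A b s v L) 4 P ≤
      6 * (lpNorm v 4 P + lpNorm (fun ω => b (θ 0 ω)) 4 P / (1 - r)) / (1 - r) * √L := by
  have h1 : 0 < 1 - r := sub_pos.2 R.lt_one
  set K := lpNorm v 4 P + lpNorm (fun ω => b (θ 0 ω)) 4 P / (1 - r)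
  have hK : 0 ≤ K := add_nonneg lpNorm_nonneg (div_nonneg lpNorm_nonneg h1.le)
  set T := blockSum θ A b s v
  set U := orbit θ A b s v
  have hT4 : ∀ L, MemLp (T L) 4 P := R.memLp_blockSum hv hv4
  have hU4 : ∀ L, MemLp (U L) 4 P := R.memLp_orbit hv hv4
  have hUK : ∀ L, lpNorm (U L) 4 P ≤ K := R.lpNorm_orbit_le hv hv4
  have hUm : ∀ L : ℕ, Measurable[past θ (s + L)] (U L) := R.measurable_orbit_past hv
  -- The martingale approximation: `(I - B) T` plus the boundary terms telescopes into the sum of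
  -- the innovations `x`.
  set M : ℕ → Ω → Vec d := fun L ω => T L ω - B (T L ω) + U L ω - U 0 ω
  set x : ℕ → Ω → Vec d := fun L ω => U (L + 1) ω - B (U L ω)
  have hBU4 : ∀ L, MemLp (fun ω => B (U L ω)) 4 P := fun L => B.comp_memLp' (hU4 L)
  have hBle : ∀ {V : Ω → Vec d}, MemLp V 4 P → lpNorm (fun ω => B (V ω)) 4 P ≤ lpNorm V 4 P :=
    fun {V} hV => lpNorm_le_of_norm_le (B.comp_memLp' hV).1 hV (.of_forall fun ω =>
      (R.norm_B_le _).trans (mul_le_of_le_one_left (norm_nonneg _) R.lt_one.le))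
  have hx : ∀ n, MemLp (x n) 4 P := fun n => (hU4 (n + 1)).sub (hBU4 n)
  have hσ : ∀ n, lpNorm (x n) 4 P ≤ 2 * K := fun n => by
    have h := lpNorm_sub_le (g := fun ω => B (U n ω)) (hU4 (n + 1)) (by norm_num)
    have h' := hBle (hU4 n)
    have e : x n = U (n + 1) - fun ω => B (U n ω) := rfl
    rw [e]
    linarith [hUK (n + 1), hUK n]
  have hM0 : M 0 = 0 := by
    funext ω
    simp [M, T, blockSum]
  have hMs : ∀ n, M (n + 1) = M n + x n := fun n => by
    funext ω
    have e : T (n + 1) ω = T n ω + U n ω := Finset.sum_range_succ _ _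
    simp only [M, x, e, map_add, Pi.add_apply]
    abel
  have hMm : ∀ n : ℕ, Measurable[past θ (s + n)] (M n) := fun n => by
    have hTm : Measurable[past θ (s + n)] (T n) :=
      R.measurable_blockSum hv n (by omega)
    have hU0 : Measurable[past θ (s + n)] (U 0) := hv.mono (past_mono (by omega)) le_rfl
    exact ((hTm.sub (B.continuous.measurable.comp hTm)).add (hUm n)).sub hU0
  have hM4 : ∀ n, MemLp (M n) 4 P := fun n =>
    (((hT4 n).sub (B.comp_memLp' (hT4 n))).add (hU4 n)).sub (hU4 0)
  have horth : ∀ n, ∫ ω, ‖M n ω‖ ^ 2 * inner ℝ (M n ω) (x n ω) ∂P = 0 := fun n => by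
    have hmM := (hMm n).mono (R.past_le _) le_rfl
    have i4 := integrable_norm_pow_four (hM4 n)
    -- With `G = ‖M‖² M`, orthogonality to the innovation is exactly the condition of the Burkholder
    -- inequality.
    have hG : Measurable[past θ (s + n)] fun ω => ‖M n ω‖ ^ 2 • M n ω :=
      (by fun_prop : Measurable fun u : Vec d => ‖u‖ ^ 2 • u).comp (hMm n)
    have hGm := hG.mono (R.past_le _) le_rfl
    have h := R.integral_inner_step hG (hUm n) ?_ ?_
    · simp only [inner_smul_left] at h
      exact h
    · refine (i4.add (integrable_const 1)).mono' hGm.aestronglyMeasurable (.of_forall fun ω => ?_)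
      simp only [norm_smul, norm_pow, norm_norm, Pi.add_apply]
      nlinarith [sq_nonneg (‖M n ω‖ ^ 2 - ‖M n ω‖), sq_nonneg (‖M n ω‖ - 1),
        sq_nonneg (‖M n ω‖ ^ 2 - 1), norm_nonneg (M n ω)]
    · refine (i4.add (integral_sq_mul_sq_le (hM4 n) (hU4 n)).1).mono'
        (hGm.norm.mul ((hUm n).mono (R.past_le _) le_rfl).norm).aestronglyMeasurable
        (.of_forall fun ω => ?_)
      simp only [norm_mul, norm_smul, norm_pow, norm_norm, Pi.add_apply]
      nlinarith [sq_nonneg (‖M n ω‖ * (‖M n ω‖ - ‖U n ω‖)), sq_nonneg (‖M n ω‖ * ‖U n ω‖),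
              sq_nonneg (‖M n ω‖ ^ 2)]
  -- For `L ≥ 1` one has `√L ≥ 1`, so the two boundary states, each bounded by `K`, are absorbed: `4
  -- K √L + 2 K ≤ 6 K √L`.
  rcases Nat.eq_zero_or_pos L with rfl | hL
  · have : T 0 = 0 := by funext ω; simp [T, blockSum]
    simp [this]
  have hMb := (lpNorm_four_sq_le_of_orthogonal hM0 hMs hx hσ horth L).2
  have hsq : √(L : ℝ) ^ 2 = L := Real.sq_sqrt (by positivity)
  have hL1 : (1 : ℝ) ≤ √L := Real.one_le_sqrt.2 (by exact_mod_cast hL)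
  have hMb' : lpNorm (M L) 4 P ≤ 4 * K * √L := by
    refine abs_le_of_sq_le_sq' ?_ (by positivity) |>.2
    calc _ ≤ 4 * (L : ℝ) * (2 * K) ^ 2 := hMb
      _ = _ := by rw [mul_pow _ √(L : ℝ), hsq]; ring
  -- Inverting `I - B` costs a factor `(1 - r)⁻¹`, since `‖T - B T‖ ≥ (1 - r) ‖T‖` pointwise.
  have hpt : lpNorm (T L) 4 P ≤ lpNorm (fun ω => (1 - r)⁻¹ • (M L ω - U L ω + U 0 ω)) 4 P := by
    refine lpNorm_le_of_norm_le (hT4 L).1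
      ((((hM4 L).sub (hU4 L)).add (hU4 0)).const_smul (1 - r)⁻¹) (.of_forall fun ω => ?_)
    have e : M L ω - U L ω + U 0 ω = T L ω - B (T L ω) := by simp only [M]; abel
    simp only [e]
    rw [norm_smul, norm_inv, Real.norm_of_nonneg h1.le, le_inv_mul_iff₀ h1]
    have := norm_sub_norm_le (T L ω) (B (T L ω))
    linarith [R.norm_B_le (T L ω)]
  have h2 : lpNorm (fun ω => (1 - r)⁻¹ • (M L ω - U L ω + U 0 ω)) 4 P ≤
      (1 - r)⁻¹ * (lpNorm (M L) 4 P + lpNorm (U L) 4 P + lpNorm (U 0) 4 P) := by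
    have e : (fun ω => (1 - r)⁻¹ • (M L ω - U L ω + U 0 ω)) = (1 - r)⁻¹ • (M L - U L + U 0) := rfl
    rw [e, lpNorm_const_smul, Real.nnnorm_of_nonneg (by positivity), NNReal.coe_mk]
    have h3 := lpNorm_add_le (g := U 0) ((hM4 L).sub (hU4 L)) (by norm_num)
    have h4 := lpNorm_sub_le (g := U L) (hM4 L) (by norm_num)
    gcongr
    linarith
  refine hpt.trans (h2.trans ?_)
  rw [mul_div_right_comm, div_eq_inv_mul, mul_assoc, mul_assoc]
  gcongr
  nlinarith [hUK L, hUK 0]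

end AffineRecursion

end DropoutSGD

/-! ### Geometric convergence and the stationary solution -/

namespace DropoutSGD

section GeometricConvergence

variable {Ω : Type*} [MeasurableSpace Ω] {P : Measure Ω} {E : Type*} [NormedAddCommGroup E]
  {r C : ℝ}

/-- Summable `L⁴` norms force almost sure absolute summability, which turns geometric decay in `L⁴`
into pathwise convergence. -/
lemma ae_summable_norm_of_lpNorm_le {X : ℕ → Ω → E} (hr0 : 0 ≤ r) (hr1 : r < 1)
    (hX : ∀ m, MemLp (X m) 4 P) (h : ∀ m, lpNorm (X m) 4 P ≤ C * r ^ m) :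
    ∀ᵐ ω ∂P, Summable fun m => ‖X m ω‖ := by
  refine summable_norm_of_tsum_eLpNorm_ne_top (p := 4) (by norm_num) (fun m => (hX m).1) ?_
  have hs : Summable fun m => C * r ^ m := (summable_geometric_of_lt_one hr0 hr1).mul_left C
  refine ((ENNReal.tsum_le_tsum fun m => ?_).trans_lt hs.tsum_ofReal_lt_top).ne
  rw [← ofReal_lpNorm (hX m)]
  exact ENNReal.ofReal_le_ofReal (h m)

variable [CompleteSpace E]

lemma exists_limit_of_lpNorm_sub_le {O : ℕ → Ω → E} (hr0 : 0 ≤ r) (hr1 : r < 1)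
    (hO : ∀ m, MemLp (O m) 4 P) (h : ∀ m, lpNorm (O (m + 1) - O m) 4 P ≤ C * r ^ m) :
    ∃ Z : Ω → E, (∀ᵐ ω ∂P, Tendsto (fun m => O m ω) atTop (𝓝 (Z ω))) ∧ MemLp Z 4 P ∧
      ∀ m, lpNorm (Z - O m) 4 P ≤ C / (1 - r) * r ^ m := by
  have h1 : 0 < 1 - r := sub_pos.2 hr1
  have hC : 0 ≤ C := by simpa using lpNorm_nonneg.trans (h 0)
  have hsum := ae_summable_norm_of_lpNorm_le hr0 hr1 (fun m => (hO (m + 1)).sub (hO m)) h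
  have hconv : ∀ᵐ ω ∂P, ∃ z, Tendsto (fun m => O m ω) atTop (𝓝 z) := by
    filter_upwards [hsum] with ω hω
    refine cauchySeq_tendsto_of_complete (cauchySeq_of_summable_dist ?_)
    refine hω.congr fun m => ?_
    rw [dist_comm, dist_eq_norm]
    rfl
  choose! Z hZ using fun (ω : Ω) (h : ∃ z, Tendsto (fun m => O m ω) atTop (𝓝 z)) => h
  have hZ' : ∀ᵐ ω ∂P, Tendsto (fun m => O m ω) atTop (𝓝 (Z ω)) := by
    filter_upwards [hconv] with ω hω using hZ ω hω
  have hZm : AEStronglyMeasurable Z P := aestronglyMeasurable_of_tendsto_ae atTop (fun m => (hO m).1) hZ'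
  -- The factor `1 - r ^ p` is the exact partial geometric sum, so the triangle inequality closes
  -- the induction without loss.
  have hdiff : ∀ m p, lpNorm (O (m + p) - O m) 4 P ≤ C / (1 - r) * r ^ m * (1 - r ^ p) := by
    intro m p
    induction p with
    | zero => simp
    | succ p ih =>
      have h2 := lpNorm_sub_le_lpNorm_sub_add_lpNorm_sub (hO (m + p + 1)) (hO (m + p)) (h := O m)
        (by norm_num)
      have h3 := h (m + p)
      rw [← add_assoc]
      refine h2.trans ((add_le_add h3 ih).trans (le_of_eq ?_))
      field_simp
      ring
  have hele : ∀ m, eLpNorm (Z - O m) 4 P ≤ ENNReal.ofReal (C / (1 - r) * r ^ m) := fun m => by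
    have ht : ∀ᵐ ω ∂P, Tendsto (fun p => (O (m + p) - O m) ω) atTop (𝓝 ((Z - O m) ω)) := by
      filter_upwards [hZ'] with ω hω
      have := (tendsto_add_atTop_iff_nat m).2 hω
      simp only [add_comm _ m] at this
      exact this.sub_const _
    -- Fatou: the bounds on `O (m + p) - O m`, uniform in `p`, pass to the limit. Measurability of
    -- `Z` is only almost everywhere.
    refine (Lp.eLpNorm_lim_le_liminf_eLpNorm (fun p => ((hO (m + p)).sub (hO m)).1) _ ht).trans ?_
    refine liminf_le_of_frequently_le' (Frequently.of_forall fun p => ?_)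
    rw [← ofReal_lpNorm ((hO (m + p)).sub (hO m))]
    refine ENNReal.ofReal_le_ofReal ((hdiff m p).trans ?_)
    refine mul_le_of_le_one_right (by positivity) ?_
    have := pow_nonneg hr0 p
    linarith
  have hmem : ∀ m, MemLp (Z - O m) 4 P := fun m =>
    ⟨hZm.sub (hO m).1, (hele m).trans_lt ENNReal.ofReal_lt_top⟩
  refine ⟨Z, hZ', ?_, fun m => lpNorm_le_of_eLpNorm_le (hmem m) (by positivity) (hele m)⟩
  have := (hmem 0).add (hO 0)
  rwa [sub_add_cancel] at this

omit [CompleteSpace E] in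
-- The pairing is bilinear and bounded on `L⁴ × L⁴`, hence jointly continuous. It carries
-- autocovariances from orbits over to the stationary solution.
lemma tendsto_integral_inner_smul [IsProbabilityMeasure P] [InnerProductSpace ℝ E]
    {X Y : ℕ → Ω → E} {x y : Ω → E}
    (hX : ∀ m, MemLp (X m) 4 P) (hY : ∀ m, MemLp (Y m) 4 P) (hx : MemLp x 4 P) (hy : MemLp y 4 P)
    (hXx : Tendsto (fun m => lpNorm (X m - x) 4 P) atTop (𝓝 0))
    (hYy : Tendsto (fun m => lpNorm (Y m - y) 4 P) atTop (𝓝 0)) (a : E) :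
    Tendsto (fun m => ∫ ω, inner ℝ a (X m ω) • Y m ω ∂P) atTop
      (𝓝 (∫ ω, inner ℝ a (x ω) • y ω ∂P)) := by
  have hint : ∀ {u v : Ω → E}, MemLp u 4 P → MemLp v 4 P →
      Integrable (fun ω => inner ℝ a (u ω) • v ω) P ∧
      ‖∫ ω, inner ℝ a (u ω) • v ω ∂P‖ ≤ ‖a‖ * (lpNorm u 4 P * lpNorm v 4 P) := by
    intro u v hu hv
    have hi := (integrable_norm_mul_norm (memLp_two_of_four hu) (memLp_two_of_four hv)).const_mul ‖a‖
    have hb : ∀ ω, ‖inner ℝ a (u ω) • v ω‖ ≤ ‖a‖ * (‖u ω‖ * ‖v ω‖) := fun ω => by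
      rw [norm_smul, ← mul_assoc]
      exact mul_le_mul_of_nonneg_right (norm_inner_le_norm _ _) (norm_nonneg _)
    refine ⟨hi.mono' ((aestronglyMeasurable_const.inner hu.1).smul hv.1) (.of_forall hb), ?_⟩
    refine (norm_integral_le_of_norm_le hi (.of_forall hb)).trans ?_
    rw [integral_const_mul]
    exact mul_le_mul_of_nonneg_left (integral_norm_mul_norm_le hu hv) (norm_nonneg _)
  rw [tendsto_iff_norm_sub_tendsto_zero]
  have hlim : Tendsto (fun m => ‖a‖ * (lpNorm (X m - x) 4 P * (lpNorm (Y m - y) 4 P + lpNorm y 4 P)) +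
      ‖a‖ * (lpNorm x 4 P * lpNorm (Y m - y) 4 P)) atTop (𝓝 0) := by
    have := (((hXx.mul (hYy.add_const (lpNorm y 4 P))).const_mul ‖a‖).add
      ((hYy.const_mul (lpNorm x 4 P)).const_mul ‖a‖))
    simpa using this
  refine squeeze_zero (fun m => norm_nonneg _) (fun m => ?_) hlim
  have e : ∫ ω, inner ℝ a (X m ω) • Y m ω ∂P - ∫ ω, inner ℝ a (x ω) • y ω ∂P =
      ∫ ω, inner ℝ a ((X m - x) ω) • Y m ω ∂P + ∫ ω, inner ℝ a (x ω) • (Y m - y) ω ∂P := by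
    rw [← integral_sub (hint (hX m) (hY m)).1 (hint hx hy).1,
      ← integral_add (hint ((hX m).sub hx) (hY m)).1 (hint hx ((hY m).sub hy)).1]
    refine integral_congr_ae (.of_forall fun ω => ?_)
    simp only [Pi.sub_apply, inner_sub_right]
    module
  rw [e]
  refine (norm_add_le _ _).trans (add_le_add ?_ (hint hx ((hY m).sub hy)).2)
  refine (hint ((hX m).sub hx) (hY m)).2.trans ?_
  have h3 := lpNorm_le_lpNorm_add_lpNorm_sub' (f := Y m) hy (p := 4) (by norm_num)
  have h0 := lpNorm_nonneg (f := X m - x) (p := 4) (μ := P)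
  gcongr
  linarith

end GeometricConvergence

variable {Ω Θ : Type*} [mΩ : MeasurableSpace Ω] [MeasurableSpace Θ] {P : Measure Ω}
  {d : ℕ} {θ : ℤ → Ω → Θ} {A : Θ → Vec d →L[ℝ] Vec d} {b : Θ → Vec d}
  {B : Vec d →L[ℝ] Vec d} {r : ℝ}

omit mΩ [MeasurableSpace Θ] in
-- Orbits are affine in their starting vector, so convergence from `0` and from the basis vectors
-- implies convergence from every `u` outside one null set, although there are uncountably many `u`.
lemma orbit_const_eq (s : ℤ) (u : Vec d) (j : ℕ) (ω : Ω) :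
    orbit θ A b s (fun _ => u) j ω = orbit θ A b s (fun _ => 0) j ω + ∑ i : Fin d, u i •
      (orbit θ A b s (fun _ => EuclideanSpace.basisFun (Fin d) ℝ i) j ω -
        orbit θ A b s (fun _ => 0) j ω) := by
  induction j with
  | zero =>
    simp only [orbit_zero, sub_zero, zero_add]
    conv_lhs => rw [← (EuclideanSpace.basisFun (Fin d) ℝ).sum_repr u]
    simp
  | succ j ih =>
    simp only [orbit_succ, add_sub_add_right_eq_sub]
    rw [ih]
    simp only [map_add, map_sum, map_smul, map_sub]
    abel

/-- `Z` is the stationary solution of the recursion: the limit of the orbits started in the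
remote past. -/
structure IsStationary (P : Measure Ω) (θ : ℤ → Ω → Θ) (A : Θ → Vec d →L[ℝ] Vec d)
    (b : Θ → Vec d) (r : ℝ) (K : ℝ) (Z : ℤ → Ω → Vec d) : Prop where
  tendsto : ∀ᵐ ω ∂P, ∀ (k : ℤ) (u : Vec d),
    Tendsto (fun m : ℕ => orbit θ A b (k - m) (fun _ => u) m ω) atTop (𝓝 (Z k ω))
  memLp : ∀ k, MemLp (Z k) 4 P
  lpNorm_sub_le : ∀ (k : ℤ) (m : ℕ),
    lpNorm (Z k - orbit θ A b (k - m) (fun _ => 0) m) 4 P ≤ K * r ^ m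

namespace AffineRecursion

variable (R : AffineRecursion P θ A b B r) [IsProbabilityMeasure P]
include R

lemma memLp_orbit_const (s : ℤ) (u : Vec d) (j : ℕ) : MemLp (orbit θ A b s (fun _ => u) j) 4 P :=
  R.memLp_orbit measurable_const (memLp_const u) j

theorem exists_isStationary : ∃ (K : ℝ) (Z : ℤ → Ω → Vec d), IsStationary P θ A b r K Z := by
  set C := lpNorm (fun ω => b (θ 0 ω)) 4 P
  have hstep : ∀ (k : ℤ) (m : ℕ), lpNorm (orbit θ A b (k - (m + 1 : ℕ)) (fun _ => 0) (m + 1) -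
      orbit θ A b (k - m) (fun _ => 0) m) 4 P ≤ C * r ^ m := fun k m => by
    -- Starting one step earlier amounts to starting at time `k - m` from the state `b` instead of
    -- `0`, so consecutive approximations differ by two coupled orbits run for `m` steps.
    have e1 := orbit_add (θ := θ) (A := A) (b := b) (k - (m + 1 : ℕ)) (fun _ => 0) 1 m
    have e2 : k - (m + 1 : ℕ) + (1 : ℕ) = k - m := by push_cast; ring
    rw [e2, add_comm 1 m] at e1
    rw [e1, mul_comm]
    have hm : Measurable[past θ (k - m)] (orbit θ A b (k - (m + 1 : ℕ)) (fun _ => 0) 1) := by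
      have := R.measurable_orbit_past (s := k - (m + 1 : ℕ)) (v := fun _ => 0) measurable_const 1
      rwa [e2] at this
    have h := R.lpNorm_orbit_sub_le hm (R.memLp_orbit_const _ 0 1) (v' := fun _ => 0)
      measurable_const (memLp_const 0) m
    refine h.trans (mul_le_mul_of_nonneg_left (le_of_eq ?_) (pow_nonneg R.nonneg m))
    refine Eq.trans ?_ (R.lpNorm_b_eq (k - (m + 1 : ℕ) + (0 : ℕ) + 1) 0)
    congr 1
    funext ω
    simp [orbit_succ, orbit_zero]
  choose Z hZ1 hZ2 hZ3 using fun k : ℤ => exists_limit_of_lpNorm_sub_le R.nonneg R.lt_one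
    (fun m => R.memLp_orbit_const (k - (m : ℕ)) 0 m) (hstep k)
  refine ⟨C / (1 - r), Z, ?_, hZ2, hZ3⟩
  have hlin : ∀ᵐ ω ∂P, ∀ (k : ℤ) (i : Fin d), Tendsto (fun m : ℕ =>
      orbit θ A b (k - m) (fun _ => EuclideanSpace.basisFun (Fin d) ℝ i) m ω -
        orbit θ A b (k - m) (fun _ => 0) m ω) atTop (𝓝 0) := by
    rw [ae_all_iff]
    intro k
    rw [ae_all_iff]
    intro i
    have h := ae_summable_norm_of_lpNorm_le (C := lpNorm ((fun _ => EuclideanSpace.basisFun (Fin d) ℝ i) -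
      fun _ => (0 : Vec d) : Ω → Vec d) 4 P) R.nonneg R.lt_one (fun m => (R.memLp_orbit_const (k - (m : ℕ))
      (EuclideanSpace.basisFun (Fin d) ℝ i) m).sub (R.memLp_orbit_const (k - (m : ℕ)) 0 m))
      (fun m => (R.lpNorm_orbit_sub_le measurable_const (memLp_const _) measurable_const
        (memLp_const _) m).trans_eq (mul_comm _ _))
    filter_upwards [h] with ω hω
    exact tendsto_zero_iff_norm_tendsto_zero.2 hω.tendsto_atTop_zero
  filter_upwards [ae_all_iff.2 hZ1, hlin] with ω h1 h2 k u
  have h3 := (h1 k).add (tendsto_finsetSum Finset.univ fun i _ => (h2 k i).const_smul (u i))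
  simp only [smul_zero, Finset.sum_const_zero, add_zero] at h3
  refine h3.congr fun m => (orbit_const_eq _ u m ω).symm

end AffineRecursion

namespace IsStationary

variable {K : ℝ} {Z : ℤ → Ω → Vec d} (hZ : IsStationary P θ A b r K Z)
  (R : AffineRecursion P θ A b B r) [IsProbabilityMeasure P]
include hZ R

omit hZ in
lemma integral_orbit_eq (s s' : ℤ) (j : ℕ) (a : Vec d) :
    ∫ ω, inner ℝ a (orbit θ A b s (fun _ => 0) j ω) • orbit θ A b s (fun _ => 0) j ω ∂P =
    ∫ ω, inner ℝ a (orbit θ A b s' (fun _ => 0) j ω) • orbit θ A b s' (fun _ => 0) j ω ∂P := by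
  have key : ∀ s, ∫ ω, inner ℝ a (orbit θ A b s (fun _ => 0) j ω) •
      orbit θ A b s (fun _ => 0) j ω ∂P =
      ∫ v, inner ℝ a v • v ∂(P.map (orbit θ A b s (fun _ => 0) j)) := fun s => by
    rw [integral_map (R.memLp_orbit_const s 0 j).1.aemeasurable (by fun_prop)]
  rw [key s, key s', R.map_orbit_zero s s' j]

omit [IsProbabilityMeasure P] in
lemma tendsto_lpNorm (k : ℤ) :
    Tendsto (fun m : ℕ => lpNorm (orbit θ A b (k - m) (fun _ => 0) m - Z k) 4 P) atTop (𝓝 0) := by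
  have h : Tendsto (fun m : ℕ => K * r ^ m) atTop (𝓝 0) := by
    simpa using (tendsto_pow_atTop_nhds_zero_of_lt_one R.nonneg R.lt_one).const_mul K
  refine squeeze_zero (fun m => lpNorm_nonneg) (fun m => ?_) h
  rw [lpNorm_sub_comm]
  exact hZ.lpNorm_sub_le k m

/-- The lag-`n` autocovariance of the stationary solution. -/
lemma integral_inner_smul (t : ℤ) (n : ℕ) (a : Vec d) :
    ∫ ω, inner ℝ a (Z t ω) • Z (t + n) ω ∂P = (B ^ n) (∫ ω, inner ℝ a (Z 0 ω) • Z 0 ω ∂P) := by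
  -- The identity is proved for orbits, which are measurable with respect to the past, and then
  -- passed to the limit; `Z` itself need not have a version adapted to the past.
  have hlag : ∀ (m n : ℕ), ∫ ω, inner ℝ a (orbit θ A b (t - m) (fun _ => 0) m ω) •
      orbit θ A b (t - m) (fun _ => 0) (m + n) ω ∂P =
      (B ^ n) (∫ ω, inner ℝ a (orbit θ A b (t - m) (fun _ => 0) m ω) •
        orbit θ A b (t - m) (fun _ => 0) m ω ∂P) := by
    intro m n
    induction n with
    | zero => simp
    | succ n ih =>
      have hm := R.measurable_orbit_past (s := t - m) (v := fun _ => 0) measurable_const m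
      have hm' := R.measurable_orbit_past (s := t - m) (v := fun _ => 0) measurable_const (m + n)
      have h4 := R.memLp_orbit_const (t - m) 0 m
      have h4' := R.memLp_orbit_const (t - m) 0 (m + n)
      have hY : Measurable[past θ (t - m + (m + n : ℕ))]
          fun ω => inner ℝ a (orbit θ A b (t - m) (fun _ => 0) m ω) :=
        (by fun_prop : Measurable fun u : Vec d => inner ℝ a u).comp
          (hm.mono (past_mono (by push_cast; omega)) le_rfl)
      have hi := integrable_norm_mul_norm (memLp_two_of_four h4) (memLp_two_of_four h4')
      have hYi : Integrable (fun ω => inner ℝ a (orbit θ A b (t - m) (fun _ => 0) m ω)) P :=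
        (innerSL ℝ a).integrable_comp (integrable_of_memLp_four h4)
      have := (R.integral_smul_step hY hm' hYi ?_).2
      · rw [pow_succ', mul_apply_eq_comp, ← ih, ← this]
        rfl
      · refine (hi.const_mul ‖a‖).mono' (hYi.1.smul h4'.1) (.of_forall fun ω => ?_)
        rw [norm_smul, ← mul_assoc]
        exact mul_le_mul_of_nonneg_right (norm_inner_le_norm _ _) (norm_nonneg _)
  have hlim : ∀ (t : ℤ) (n : ℕ), Tendsto (fun m : ℕ => ∫ ω, inner ℝ a (orbit θ A b (t - m) (fun _ => 0) m ω) •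
      orbit θ A b (t - m) (fun _ => 0) (m + n) ω ∂P) atTop
      (𝓝 (∫ ω, inner ℝ a (Z t ω) • Z (t + n) ω ∂P)) := by
    intro t n
    refine tendsto_integral_inner_smul (fun m => R.memLp_orbit_const _ 0 m)
      (fun m => R.memLp_orbit_const _ 0 (m + n)) (hZ.memLp t) (hZ.memLp _)
      (hZ.tendsto_lpNorm R t) ?_ a
    have h := (hZ.tendsto_lpNorm R (t + n)).comp (tendsto_add_atTop_nat n)
    refine h.congr fun m => ?_
    simp only [Function.comp_apply]
    congr 3
    push_cast
    ring
  have h0 : ∀ t, ∫ ω, inner ℝ a (Z t ω) • Z t ω ∂P = ∫ ω, inner ℝ a (Z 0 ω) • Z 0 ω ∂P := fun t => by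
    have h1 := hlim t 0
    have h2 := hlim 0 0
    simp only [add_zero, Nat.cast_zero] at h1 h2
    refine tendsto_nhds_unique h1 (h2.congr fun m => ?_)
    exact integral_orbit_eq R _ _ m a
  have h1 := hlim t n
  simp only [hlag] at h1
  refine tendsto_nhds_unique h1 ?_
  have h2 := hlim t 0
  simp only [add_zero, Nat.cast_zero] at h2
  rw [h0 t] at h2
  exact ((B ^ n).continuous.tendsto _).comp h2

end IsStationary

end DropoutSGD

/-! ### The long-run covariance and conditional second moments of block sums -/

namespace DropoutSGD

/-- `∑_{k ≥ 1} B^k v`. -/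
noncomputable def powSeries {d : ℕ} (B : Vec d →L[ℝ] Vec d) (v : Vec d) : Vec d :=
  ∑' k : ℕ, (B ^ (k + 1)) v

/-- The vector `E[⟨a, Z⟩ Z]`. -/
noncomputable def covVec {Ω : Type*} [MeasurableSpace Ω] (P : Measure Ω) {d : ℕ} (Z : Ω → Vec d)
    (a : Vec d) : Vec d := ∫ ω, inner ℝ a (Z ω) • Z ω ∂P

/-- The long-run covariance of `⟨a, Z⟩` and `⟨c, Z⟩`, in closed form. -/
noncomputable def longRun {Ω : Type*} [MeasurableSpace Ω] (P : Measure Ω) {d : ℕ}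
    (B : Vec d →L[ℝ] Vec d) (Z : Ω → Vec d) (a c : Vec d) : ℝ :=
  inner ℝ c (covVec P Z a) + inner ℝ c (powSeries B (covVec P Z a)) +
    inner ℝ a (powSeries B (covVec P Z c))

variable {Ω Θ : Type*} [mΩ : MeasurableSpace Ω] [MeasurableSpace Θ] {P : Measure Ω}
  {d : ℕ} {θ : ℤ → Ω → Θ} {A : Θ → Vec d →L[ℝ] Vec d} {b : Θ → Vec d}
  {B : Vec d →L[ℝ] Vec d} {r : ℝ}

lemma sum_le_of_recursion {e δ : ℕ → ℝ} {r : ℝ} (hr1 : r < 1) (he : ∀ j, 0 ≤ e j)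
    (hδ : ∀ j, 0 ≤ δ j) (h : ∀ j, e (j + 1) ≤ r * (e j + δ j)) (L : ℕ) :
    ∑ j ∈ Finset.range L, e j ≤ (e 0 + ∑ j ∈ Finset.range L, δ j) / (1 - r) := by
  have h1 : 0 < 1 - r := sub_pos.2 hr1
  rw [le_div_iff₀ h1]
  -- Keeping the last term `e L` on the left is what makes the induction go through.
  have key : (∑ j ∈ Finset.range L, e j) * (1 - r) + e L ≤ e 0 + ∑ j ∈ Finset.range L, δ j := by
    induction L with
    | zero => simp
    | succ L ih =>
      rw [Finset.sum_range_succ, Finset.sum_range_succ]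
      have h2 := h L
      have h3 : r * δ L ≤ δ L := mul_le_of_le_one_left (hδ L) hr1.le
      nlinarith
  linarith [he L]

lemma sum_geometric_le {r : ℝ} (hr0 : 0 ≤ r) (hr1 : r < 1) (L : ℕ) :
    ∑ j ∈ Finset.range L, r ^ j ≤ 1 / (1 - r) := by
  rw [one_div, ← tsum_geometric_of_lt_one hr0 hr1]
  exact (summable_geometric_of_lt_one hr0 hr1).sum_le_tsum _ fun j _ => pow_nonneg hr0 j

lemma integral_add_add_add {f g h k : Ω → ℝ} (hf : Integrable f P) (hg : Integrable g P)
    (hh : Integrable h P) (hk : Integrable k P) : ∫ ω, f ω + g ω + h ω + k ω ∂P =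
      ∫ ω, f ω ∂P + ∫ ω, g ω ∂P + ∫ ω, h ω ∂P + ∫ ω, k ω ∂P := by
  have h1 : Integrable (fun ω => f ω + g ω) P := hf.add hg
  have h2 : Integrable (fun ω => f ω + g ω + h ω) P := h1.add hh
  rw [integral_add h2 hk, integral_add h1 hh, integral_add hf hg]

lemma integrable_inner_mul_inner {U V : Ω → Vec d} (hU : MemLp U 4 P) (hV : MemLp V 4 P)
    [IsProbabilityMeasure P] (a c : Vec d) :
    Integrable (fun ω => inner ℝ a (U ω) * inner ℝ c (V ω)) P := by
  have h1 : MemLp (fun ω => inner ℝ a (U ω)) 2 P := (innerSL ℝ a).comp_memLp' (memLp_two_of_four hU)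
  have h2 : MemLp (fun ω => inner ℝ c (V ω)) 2 P := (innerSL ℝ c).comp_memLp' (memLp_two_of_four hV)
  exact h1.integrable_mul h2

lemma integrable_inner_smul {U V : Ω → Vec d} (hU : MemLp U 4 P) (hV : MemLp V 4 P)
    [IsProbabilityMeasure P] (a : Vec d) :
    Integrable (fun ω => inner ℝ a (U ω) • V ω) P := by
  have hm : AEStronglyMeasurable (fun ω => inner ℝ a (U ω)) P :=
    (innerSL ℝ a).continuous.comp_aestronglyMeasurable hU.1
  refine ((integrable_norm_mul_norm (memLp_two_of_four hU) (memLp_two_of_four hV)).const_mul ‖a‖).mono'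
    (hm.smul hV.1) (.of_forall fun ω => ?_)
  rw [norm_smul, ← mul_assoc]
  exact mul_le_mul_of_nonneg_right (norm_inner_le_norm _ _) (norm_nonneg _)

namespace AffineRecursion

variable (R : AffineRecursion P θ A b B r) [IsProbabilityMeasure P]
include R

lemma summable_pow (v : Vec d) : Summable fun k : ℕ => (B ^ (k + 1)) v := by
  refine Summable.of_norm_bounded (g := fun k => r ^ k * ‖v‖)
    ((summable_geometric_of_lt_one R.nonneg R.lt_one).mul_right _) fun k => ?_
  refine (R.norm_B_pow_le v (k + 1)).trans (mul_le_mul_of_nonneg_right ?_ (norm_nonneg _))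
  rw [pow_succ]
  exact mul_le_of_le_one_right (pow_nonneg R.nonneg k) R.lt_one.le

/-- That is, `powSeries B v = (I - B)⁻¹ B v`. In this form it is the fixed point of the recursion
for the cross moments of block sums and states. -/
lemma powSeries_eq (v : Vec d) : powSeries B v = B (powSeries B v + v) := by
  have hs := R.summable_pow v
  conv_lhs => rw [powSeries, hs.tsum_eq_zero_add]
  rw [map_add, powSeries, B.map_tsum hs]
  simp only [zero_add, pow_one]
  rw [add_comm]
  congr 1
  exact tsum_congr fun k => by rw [pow_succ' B (k + 1), mul_apply_eq_comp]

end AffineRecursion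

namespace IsStationary

variable {K : ℝ} {Z : ℤ → Ω → Vec d} (hZ : IsStationary P θ A b r K Z)
  (R : AffineRecursion P θ A b B r) [IsProbabilityMeasure P]
include hZ R

/-- A lag `k ≥ 0` contributes `⟨c, B^k E[⟨a, Z⟩ Z]⟩`. A negative lag becomes a positive one after a
shift in time, with `a` and `c` exchanged; lag zero is counted only in the first half. -/
theorem hasSum_longRun (a c : Vec d) :
    HasSum (fun k : ℤ => ∫ ω, inner ℝ a (Z 0 ω) * inner ℝ c (Z k ω) ∂P)
      (longRun P B (Z 0) a c) := by
  have hval : ∀ (t : ℤ) (n : ℕ) (a c : Vec d),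
      ∫ ω, inner ℝ a (Z t ω) * inner ℝ c (Z (t + n) ω) ∂P =
        inner ℝ c ((B ^ n) (covVec P (Z 0) a)) := by
    intro t n a c
    rw [covVec, ← hZ.integral_inner_smul R t n a,
      ← integral_inner (integrable_inner_smul (hZ.memLp t) (hZ.memLp _) a)]
    refine integral_congr_ae (.of_forall fun ω => ?_)
    simp [inner_smul_right]
  refine HasSum.of_nat_of_neg_add_one ?_ ?_
  · have e : ∀ n : ℕ, ∫ ω, inner ℝ a (Z 0 ω) * inner ℝ c (Z n ω) ∂P =
        inner ℝ c ((B ^ n) (covVec P (Z 0) a)) := fun n => by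
      have := hval 0 n a c
      rwa [zero_add] at this
    simp only [e]
    rw [← hasSum_nat_add_iff' 1]
    simp only [Finset.range_one, Finset.sum_singleton, pow_zero, one_apply_eq_self,
      add_sub_cancel_left]
    exact (innerSL ℝ c).hasSum (R.summable_pow _).hasSum
  · have e : ∀ n : ℕ, ∫ ω, inner ℝ a (Z 0 ω) * inner ℝ c (Z (-((n : ℤ) + 1)) ω) ∂P =
        inner ℝ a ((B ^ (n + 1)) (covVec P (Z 0) c)) := fun n => by
      have := hval (-((n : ℤ) + 1)) (n + 1) c a
      rw [Nat.cast_add_one, neg_add_cancel] at this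
      rw [← this]
      exact integral_congr_ae (.of_forall fun ω => mul_comm _ _)
    simp only [e]
    exact (innerSL ℝ a).hasSum (R.summable_pow _).hasSum

/-- Conditionally on the past, the second moments of the states of an orbit converge
geometrically fast to those of the stationary solution. -/
lemma norm_integral_weighted_sub_le {s : ℤ} {v : Ω → Vec d} (hv : Measurable[past θ s] v)
    (hv4 : MemLp v 4 P) {Y : Ω → ℝ} (hY : Measurable[past θ s] Y) (hY1 : ∀ ω, |Y ω| ≤ 1)
    (a : Vec d) (j : ℕ) :
    ‖∫ ω, Y ω • (inner ℝ a (orbit θ A b s v j ω) • orbit θ A b s v j ω) ∂P -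
      (∫ ω, Y ω ∂P) • covVec P (Z 0) a‖ ≤
    ‖a‖ * ((lpNorm v 4 P + K) * (2 * (lpNorm v 4 P + lpNorm (Z 0) 4 P +
      lpNorm (fun ω => b (θ 0 ω)) 4 P / (1 - r)))) * r ^ j := by
  have h1 : 0 < 1 - r := sub_pos.2 R.lt_one
  set β := lpNorm (fun ω => b (θ 0 ω)) 4 P / (1 - r)
  have hβ : 0 ≤ β := div_nonneg lpNorm_nonneg h1.le
  set N := lpNorm v 4 P
  have hN : 0 ≤ N := lpNorm_nonneg
  set N0 := lpNorm (Z 0) 4 P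
  have hN0 : 0 ≤ N0 := lpNorm_nonneg
  have hrj : 0 ≤ r ^ j := pow_nonneg R.nonneg j
  set U := orbit θ A b s v j
  -- Three comparisons: `U` is close to `O`, which forgets `v`; `O` uses only inputs after time `s`,
  -- so it is independent of `Y`; and `O'` has the law of `O` but ends at time `0`, where it is
  -- close to `Z 0`.
  set O := orbit θ A b s (fun _ => 0) j
  set O' := orbit θ A b (0 - (j : ℤ)) (fun _ => 0) j
  have hU4 : MemLp U 4 P := R.memLp_orbit hv hv4 j
  have hO4 : MemLp O 4 P := R.memLp_orbit_const s 0 j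
  have hO4' : MemLp O' 4 P := R.memLp_orbit_const _ 0 j
  have hYm := hY.mono (R.past_le s) le_rfl
  have hYi : Integrable Y P := (integrable_const (1 : ℝ)).mono' hYm.aestronglyMeasurable
    (.of_forall hY1)
  have hUN : lpNorm U 4 P ≤ N + β := R.lpNorm_orbit_le hv hv4 j
  have hz : lpNorm (fun _ : Ω => (0 : Vec d)) 4 P = 0 := lpNorm_fun_zero _ _
  have hON : lpNorm O 4 P ≤ β := by
    have := R.lpNorm_orbit_le (s := s) (v := fun _ => 0) measurable_const (memLp_const 0) j
    rwa [hz, zero_add] at this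
  have hON' : lpNorm O' 4 P ≤ β := by
    have := R.lpNorm_orbit_le (s := 0 - (j : ℤ)) (v := fun _ => 0) measurable_const (memLp_const 0) j
    rwa [hz, zero_add] at this
  have hUO : lpNorm (U - O) 4 P ≤ r ^ j * N := by
    have := R.lpNorm_orbit_sub_le hv hv4 (v' := fun _ => 0) measurable_const (memLp_const 0) j
    have e : (v - fun _ => (0 : Vec d)) = v := by funext ω; simp
    rwa [e] at this
  have hZO : lpNorm (Z 0 - O') 4 P ≤ K * r ^ j := hZ.lpNorm_sub_le 0 j
  have hK : 0 ≤ K := by simpa using lpNorm_nonneg.trans (hZ.lpNorm_sub_le 0 0)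
  have iY : ∀ {V : Ω → Vec d}, MemLp V 4 P →
      Integrable (fun ω => Y ω • (inner ℝ a (V ω) • V ω)) P := fun {V} hV =>
    (integrable_inner_smul hV hV a).norm.mono'
      (hYm.aestronglyMeasurable.smul (integrable_inner_smul hV hV a).1) (.of_forall fun ω => by
        rw [norm_smul]
        exact mul_le_of_le_one_left (norm_nonneg _) (hY1 ω))
  have hind : ∫ ω, Y ω • (inner ℝ a (O ω) • O ω) ∂P =
      (∫ ω, Y ω ∂P) • ∫ ω, inner ℝ a (O' ω) • O' ω ∂P := by
    have hOm : Measurable[⨆ j ∈ Set.Ioi s, MeasurableSpace.comap (θ j) inferInstance] O :=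
      measurable_orbit R.measurable_A R.measurable_b measurable_const j fun i hi _ =>
        (comap_measurable (θ i)).mono (le_iSup₂_of_le
          (f := fun j (_ : j ∈ Set.Ioi s) => MeasurableSpace.comap (θ j) inferInstance)
          i hi le_rfl) le_rfl
    have ind := (R.indep_past hY hOm).comp measurable_id
      (by fun_prop : Measurable fun u : Vec d => inner ℝ a u • u)
    have h := ind.integral_fun_smul_eq_smul_integral hYi.1 (integrable_inner_smul hO4 hO4 a).1
    rw [integral_orbit_eq R (0 - (j : ℤ)) s j a]
    exact h
  have d1 : ‖∫ ω, Y ω • (inner ℝ a (U ω) • U ω) ∂P - ∫ ω, Y ω • (inner ℝ a (O ω) • O ω) ∂P‖ ≤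
      ‖a‖ * (r ^ j * N * (N + β + β)) := by
    rw [← integral_sub (iY hU4) (iY hO4)]
    refine (norm_integral_le_integral_norm _).trans
      ((norm_integral_inner_smul_sub_le hY1 hU4 hO4 a).trans ?_)
    gcongr
    exact add_nonneg lpNorm_nonneg lpNorm_nonneg
  have d2 : ‖∫ ω, inner ℝ a (O' ω) • O' ω ∂P - covVec P (Z 0) a‖ ≤
      ‖a‖ * (K * r ^ j * (N0 + β)) := by
    rw [covVec, ← integral_sub (integrable_inner_smul hO4' hO4' a)
      (integrable_inner_smul (hZ.memLp 0) (hZ.memLp 0) a), ← norm_neg, ← integral_neg]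
    refine (norm_integral_le_integral_norm _).trans ?_
    have h := norm_integral_inner_smul_sub_le (W := fun _ => 1) (by simp) (hZ.memLp 0) hO4' a
    simp only [one_smul] at h
    simp only [neg_sub]
    refine h.trans ?_
    gcongr
    exact add_nonneg lpNorm_nonneg lpNorm_nonneg
  have hYle : |∫ ω, Y ω ∂P| ≤ 1 := by
    have := norm_integral_le_of_norm_le (f := Y) (integrable_const (1 : ℝ)) (.of_forall hY1) (μ := P)
    simpa using this
  have e : ∫ ω, Y ω • (inner ℝ a (U ω) • U ω) ∂P - (∫ ω, Y ω ∂P) • covVec P (Z 0) a =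
      (∫ ω, Y ω • (inner ℝ a (U ω) • U ω) ∂P - ∫ ω, Y ω • (inner ℝ a (O ω) • O ω) ∂P) +
      (∫ ω, Y ω ∂P) • (∫ ω, inner ℝ a (O' ω) • O' ω ∂P - covVec P (Z 0) a) := by
    rw [hind]; module
  rw [e]
  refine (norm_add_le _ _).trans ((add_le_add d1 ?_).trans
    (b := ‖a‖ * (r ^ j * N * (N + β + β)) + ‖a‖ * (K * r ^ j * (N0 + β))) ?_)
  · rw [norm_smul]
    exact (mul_le_of_le_one_left (norm_nonneg _) hYle).trans d2
  · have e2 : ‖a‖ * ((N + K) * (2 * (N + N0 + β))) * r ^ j =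
      ‖a‖ * (r ^ j * N * (2 * (N + N0 + β))) + ‖a‖ * (K * r ^ j * (2 * (N + N0 + β))) := by ring
    rw [e2]
    gcongr <;> linarith

/-- Conditionally on the past, a block sum has second moments `L` times the long-run covariance,
up to a bounded error. -/
theorem exists_abs_integral_blockSum_sub_le (N : ℝ) (a c : Vec d) :
    ∃ C : ℝ, 0 ≤ C ∧ ∀ (s : ℤ) (v : Ω → Vec d), Measurable[past θ s] v → MemLp v 4 P →
      lpNorm v 4 P ≤ N → ∀ Y : Ω → ℝ, Measurable[past θ s] Y → (∀ ω, |Y ω| ≤ 1) → ∀ L : ℕ,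
      |∫ ω, Y ω * (inner ℝ a (blockSum θ A b s v L ω) * inner ℝ c (blockSum θ A b s v L ω)) ∂P -
        (∫ ω, Y ω ∂P) * (L * longRun P B (Z 0) a c)| ≤ C := by
  have h1 : 0 < 1 - r := sub_pos.2 R.lt_one
  have hK : 0 ≤ K := by simpa using lpNorm_nonneg.trans (hZ.lpNorm_sub_le 0 0)
  set β := lpNorm (fun ω => b (θ 0 ω)) 4 P / (1 - r) with hβdef
  have hβ : 0 ≤ β := div_nonneg lpNorm_nonneg h1.le
  set N0 := lpNorm (Z 0) 4 P with hN0def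
  have hN0 : 0 ≤ N0 := lpNorm_nonneg
  -- The number `N` is an arbitrary real, so `|N|` is used to keep the constants nonnegative.
  set D : Vec d → ℝ := fun a => ‖a‖ * ((|N| + K) * (2 * (|N| + N0 + β)))
  have hD : ∀ a, 0 ≤ D a := fun a => by positivity
  set w : Vec d → Vec d := fun a => powSeries B (covVec P (Z 0) a)
  set S : Vec d → ℝ := fun a => (‖w a‖ + D a * (1 / (1 - r))) / (1 - r)
  have hS : ∀ a, 0 ≤ S a := fun a =>
    div_nonneg (add_nonneg (norm_nonneg _) (mul_nonneg (hD a) (one_div_pos.2 h1).le)) h1.le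
  refine ⟨‖c‖ * (D a * (1 / (1 - r))) + ‖c‖ * S a + ‖a‖ * S c, by
    have := hS a; have := hS c; have := hD a; positivity, ?_⟩
  intro s v hv hv4 hvN Y hY hY1 L
  have hYm := hY.mono (R.past_le s) le_rfl
  have hYle : |∫ ω, Y ω ∂P| ≤ 1 := by
    have := norm_integral_le_of_norm_le (f := Y) (integrable_const (1 : ℝ)) (.of_forall hY1) (μ := P)
    simpa using this
  set y := ∫ ω, Y ω ∂P
  set U := orbit θ A b s v
  set T := blockSum θ A b s v
  have hU4 : ∀ j, MemLp (U j) 4 P := R.memLp_orbit hv hv4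
  have hT4 : ∀ j, MemLp (T j) 4 P := R.memLp_blockSum hv hv4
  have hTs : ∀ j ω, T (j + 1) ω = T j ω + U j ω := fun j ω => Finset.sum_range_succ _ _
  have iY : ∀ {F : Type _} [NormedAddCommGroup F] [NormedSpace ℝ F] {V : Ω → F},
      Integrable V P → Integrable (fun ω => Y ω • V ω) P := fun {F _ _ V} hV =>
    hV.norm.mono' (hYm.aestronglyMeasurable.smul hV.1) (.of_forall fun ω => by
        rw [norm_smul]
        exact mul_le_of_le_one_left (norm_nonneg _) (hY1 ω))
  -- The weighted moments `V` (state with state) and `W` (partial sum with state) satisfy `W_{j+1} =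
  -- B (W_j + V_j)`. As `V_j` tends to `y • covVec` geometrically, `W_j` tends to `y • w`, with
  -- summable errors.
  set V : Vec d → ℕ → Vec d := fun a j => ∫ ω, Y ω • (inner ℝ a (U j ω) • U j ω) ∂P
  set W : Vec d → ℕ → Vec d := fun a j => ∫ ω, Y ω • (inner ℝ a (T j ω) • U j ω) ∂P
  have hV : ∀ a j, ‖V a j - y • covVec P (Z 0) a‖ ≤ D a * r ^ j := fun a j => by
    refine (hZ.norm_integral_weighted_sub_le R hv hv4 hY hY1 a j).trans ?_
    have hrj : 0 ≤ r ^ j := pow_nonneg R.nonneg j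
    have hn : lpNorm v 4 P ≤ |N| := hvN.trans (le_abs_self N)
    have hn0 : 0 ≤ lpNorm v 4 P := lpNorm_nonneg
    simp only [D]
    gcongr
  have hW0 : ∀ a, W a 0 = 0 := fun a => by
    simp [W, T, blockSum]
  have hWs : ∀ a j, W a (j + 1) = B (W a j + V a j) := fun a j => by
    have hm := R.measurable_orbit_past hv j
    -- `T (j + 1)` contains the states up to time `s + j` only, so it is still known one step before
    -- `U (j + 1)`.
    have hTm : Measurable[past θ (s + j)] (T (j + 1)) :=
      R.measurable_blockSum hv (j + 1) (by push_cast; omega)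
    have hYT : Measurable[past θ (s + j)] fun ω => Y ω * inner ℝ a (T (j + 1) ω) :=
      (hY.mono (past_mono (by omega)) le_rfl).mul
        ((by fun_prop : Measurable fun u : Vec d => inner ℝ a u).comp hTm)
    have i1 : Integrable (fun ω => Y ω * inner ℝ a (T (j + 1) ω)) P :=
      iY ((innerSL ℝ a).integrable_comp (integrable_of_memLp_four (hT4 (j + 1))))
    have i2 : Integrable (fun ω => (Y ω * inner ℝ a (T (j + 1) ω)) • U j ω) P := by
      simp only [mul_smul]
      exact iY (integrable_inner_smul (hT4 (j + 1)) (hU4 j) a)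
    have h := (R.integral_smul_step hYT hm i1 i2).2
    have e1 : W a (j + 1) = ∫ ω, (Y ω * inner ℝ a (T (j + 1) ω)) •
        (A (θ (s + j + 1) ω) (U j ω) + b (θ (s + j + 1) ω)) ∂P := by
      refine integral_congr_ae (.of_forall fun ω => ?_)
      simp only [mul_smul]
      rfl
    have e2 : W a j + V a j = ∫ ω, (Y ω * inner ℝ a (T (j + 1) ω)) • U j ω ∂P := by
      rw [← integral_add (iY (integrable_inner_smul (hT4 j) (hU4 j) a))
        (iY (integrable_inner_smul (hU4 j) (hU4 j) a))]
      refine integral_congr_ae (.of_forall fun ω => ?_)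
      simp only [hTs, inner_add_right]
      module
    rw [e1, e2, h]
  have hWsum : ∀ a, ∑ j ∈ Finset.range L, ‖W a j - y • w a‖ ≤ S a := fun a => by
    refine (sum_le_of_recursion R.lt_one (fun j => norm_nonneg _)
      (fun j => mul_nonneg (hD a) (pow_nonneg R.nonneg j)) (fun j => ?_) L).trans ?_
    · have e : W a (j + 1) - y • w a = B ((W a j - y • w a) + (V a j - y • covVec P (Z 0) a)) := by
        have := R.powSeries_eq (covVec P (Z 0) a)
        rw [hWs]
        conv_lhs => rw [show w a = B (w a + covVec P (Z 0) a) from this]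
        rw [← map_smul, ← map_sub]
        congr 1
        module
      rw [e]
      refine (R.norm_B_le _).trans (mul_le_mul_of_nonneg_left ?_ R.nonneg)
      exact (norm_add_le _ _).trans (by linarith [hV a j])
    · have h2 : ‖W a 0 - y • w a‖ ≤ ‖w a‖ := by
        rw [hW0, zero_sub, norm_neg, norm_smul]
        exact mul_le_of_le_one_left (norm_nonneg _) hYle
      have h3 : ∑ j ∈ Finset.range L, D a * r ^ j ≤ D a * (1 / (1 - r)) := by
        rw [← Finset.mul_sum]
        exact mul_le_mul_of_nonneg_left (sum_geometric_le R.nonneg R.lt_one L) (hD a)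
      simp only [S]
      gcongr
  have hVsum : ∑ j ∈ Finset.range L, ‖V a j - y • covVec P (Z 0) a‖ ≤ D a * (1 / (1 - r)) := by
    refine (Finset.sum_le_sum fun j _ => hV a j).trans ?_
    rw [← Finset.mul_sum]
    exact mul_le_mul_of_nonneg_left (sum_geometric_le R.nonneg R.lt_one L) (hD a)
  -- Polarizing `T (n + 1) = T n + U n` shows that each step adds one `V` and two `W` terms. Their
  -- limiting values add up to `y` times `longRun`, so the difference is a sum of the deviations
  -- bounded above.
  have hX : ∀ n : ℕ, ∫ ω, Y ω * (inner ℝ a (T n ω) * inner ℝ c (T n ω)) ∂P -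
      y * (n * longRun P B (Z 0) a c) = ∑ j ∈ Finset.range n,
        (inner ℝ c (V a j - y • covVec P (Z 0) a) + inner ℝ c (W a j - y • w a) +
          inner ℝ a (W c j - y • w c)) := by
    intro n
    induction n with
    | zero => simp [T, blockSum]
    | succ n ih =>
      rw [Finset.sum_range_succ, ← ih]
      have jT := iY (integrable_inner_mul_inner (hT4 n) (hT4 n) a c)
      have j1 := iY (integrable_inner_smul (hU4 n) (hU4 n) a)
      have j2 := iY (integrable_inner_smul (hT4 n) (hU4 n) a)
      have j3 := iY (integrable_inner_smul (hT4 n) (hU4 n) c)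
      have e1 : inner ℝ c (V a n) = ∫ ω, inner ℝ c (Y ω • (inner ℝ a (U n ω) • U n ω)) ∂P :=
        (integral_inner j1 c).symm
      have e2 : inner ℝ c (W a n) = ∫ ω, inner ℝ c (Y ω • (inner ℝ a (T n ω) • U n ω)) ∂P :=
        (integral_inner j2 c).symm
      have e3 : inner ℝ a (W c n) = ∫ ω, inner ℝ a (Y ω • (inner ℝ c (T n ω) • U n ω)) ∂P :=
        (integral_inner j3 a).symm
      have k1 := j1.const_inner (𝕜 := ℝ) c
      have k2 := j2.const_inner (𝕜 := ℝ) c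
      have k3 := j3.const_inner (𝕜 := ℝ) a
      have e : ∫ ω, Y ω * (inner ℝ a (T (n + 1) ω) * inner ℝ c (T (n + 1) ω)) ∂P =
          ∫ ω, Y ω * (inner ℝ a (T n ω) * inner ℝ c (T n ω)) ∂P + inner ℝ c (V a n) +
            inner ℝ c (W a n) + inner ℝ a (W c n) := by
        rw [e1, e2, e3]
        refine Eq.trans ?_ (integral_add_add_add jT k1 k2 k3)
        refine integral_congr_ae (.of_forall fun ω => ?_)
        simp only [hTs, inner_add_right, inner_smul_right]
        ring
      rw [e]
      simp only [inner_sub_right, inner_smul_right, longRun, w]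
      push_cast
      ring
  rw [hX]
  refine (Finset.abs_sum_le_sum_abs _ _).trans ?_
  calc _ ≤ ∑ j ∈ Finset.range L, (‖c‖ * ‖V a j - y • covVec P (Z 0) a‖ + ‖c‖ * ‖W a j - y • w a‖ +
          ‖a‖ * ‖W c j - y • w c‖) := by
        refine Finset.sum_le_sum fun j _ => ?_
        refine (abs_add_le _ _).trans (add_le_add ((abs_add_le _ _).trans (add_le_add ?_ ?_)) ?_) <;>
          exact abs_real_inner_le_norm _ _
    _ ≤ _ := by
        rw [Finset.sum_add_distrib, Finset.sum_add_distrib, ← Finset.mul_sum, ← Finset.mul_sum,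
          ← Finset.mul_sum]
        have := hWsum a
        have := hWsum c
        gcongr

end IsStationary

end DropoutSGD

/-! ### Fluctuation and bias of batch means, and the effect of centring -/

namespace DropoutSGD

section ConditionalCentring

variable {Ω : Type*} [mΩ : MeasurableSpace Ω] {P : Measure Ω} [IsProbabilityMeasure P]

lemma integral_mul_condExp {m : MeasurableSpace Ω} (hm : m ≤ mΩ) {f g : Ω → ℝ}
    (hf : StronglyMeasurable[m] f) (hf2 : MemLp f 2 P) (hg2 : MemLp g 2 P) :
    ∫ ω, f ω * (P[g | m]) ω ∂P = ∫ ω, f ω * g ω ∂P := by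
  have h := condExp_mul_of_stronglyMeasurable_left hf (hf2.integrable_mul hg2)
    (hg2.integrable (by norm_num))
  calc _ = ∫ ω, (P[f * g | m]) ω ∂P := (integral_congr_ae h).symm
    _ = _ := integral_condExp hm

/-- Sums of conditionally centred square-integrable variables have the size of the root of the sum
of the second moments. -/
lemma integral_abs_sum_sub_condExp_le {F : ℕ → MeasurableSpace Ω} (hF : ∀ m, F m ≤ mΩ)
    (hFm : Monotone F) {X : ℕ → Ω → ℝ} (hX : ∀ m, StronglyMeasurable[F (m + 1)] (X m))
    (hX2 : ∀ m, MemLp (X m) 2 P) (n : ℕ) :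
    ∫ ω, |∑ m ∈ Finset.range n, (X m ω - (P[X m | F m]) ω)| ∂P ≤
      2 * √(∑ m ∈ Finset.range n, ∫ ω, X m ω ^ 2 ∂P) := by
  have hC2 : ∀ m, MemLp (P[X m | F m]) 2 P := fun m => (hX2 m).condExp (by norm_num)
  have hD2 : ∀ m, MemLp (fun ω => X m ω - (P[X m | F m]) ω) 2 P := fun m => (hX2 m).sub (hC2 m)
  have hSm : ∀ n, StronglyMeasurable[F n]
      fun ω => ∑ m ∈ Finset.range n, (X m ω - (P[X m | F m]) ω) := fun n => by
    refine Finset.stronglyMeasurable_fun_sum _ fun m hm => ?_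
    have hm' := Finset.mem_range.1 hm
    exact ((hX m).mono (hFm hm')).sub (stronglyMeasurable_condExp.mono (hFm hm'.le))
  have hS2 : ∀ n, MemLp (fun ω => ∑ m ∈ Finset.range n, (X m ω - (P[X m | F m]) ω)) 2 P :=
    fun n => memLp_finsetSum _ fun m _ => hD2 m
  -- The factor `4` comes from the triangle inequality and the `L²` contractivity of conditional
  -- expectation.
  have hDle : ∀ m, ∫ ω, (X m ω - (P[X m | F m]) ω) ^ 2 ∂P ≤ 4 * ∫ ω, X m ω ^ 2 ∂P := fun m => by
    have h1 := lpNorm_sub_le (g := P[X m | F m]) (hX2 m) (by norm_num)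
    have h2 := (hX2 m).lpNorm_condExp_le_lpNorm (m := F m) (by norm_num)
    have h3 := lpNorm_two_sq (hX2 m)
    have h4 := lpNorm_two_sq (hD2 m)
    simp only [Real.norm_eq_abs, sq_abs] at h3 h4
    rw [← h3, ← h4]
    have h5 : lpNorm (fun ω => X m ω - (P[X m | F m]) ω) 2 P ≤ 2 * lpNorm (X m) 2 P := by
      refine le_trans h1 ?_
      linarith
    calc _ ≤ (2 * lpNorm (X m) 2 P) ^ 2 := pow_le_pow_left₀ lpNorm_nonneg h5 2
      _ = _ := by ring
  have hsq : ∀ n, ∫ ω, (∑ m ∈ Finset.range n, (X m ω - (P[X m | F m]) ω)) ^ 2 ∂P ≤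
      4 * ∑ m ∈ Finset.range n, ∫ ω, X m ω ^ 2 ∂P := by
    intro n
    induction n with
    | zero => simp
    | succ n ih =>
      set S := fun ω => ∑ m ∈ Finset.range n, (X m ω - (P[X m | F m]) ω)
      set D := fun ω => X n ω - (P[X n | F n]) ω
      -- Conditionally centred increments are orthogonal to the preceding sum, so second moments
      -- add.
      have h0 : ∫ ω, S ω * D ω ∂P = 0 := by
        have e := integral_mul_condExp (hF n) (hSm n) (hS2 n) (hX2 n)
        simp only [D, mul_sub]
        have i4 : Integrable (fun ω => S ω * X n ω) P := (hS2 n).integrable_mul (hX2 n)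
        have i5 : Integrable (fun ω => S ω * (P[X n | F n]) ω) P := (hS2 n).integrable_mul (hC2 n)
        rw [integral_sub i4 i5, e, sub_self]
      have i1 : Integrable (fun ω => S ω ^ 2) P := (hS2 n).integrable_sq
      have i2 : Integrable (fun ω => D ω ^ 2) P := (hD2 n).integrable_sq
      have i3 : Integrable (fun ω => S ω * D ω) P := (hS2 n).integrable_mul (hD2 n)
      have e : ∫ ω, (∑ m ∈ Finset.range (n + 1), (X m ω - (P[X m | F m]) ω)) ^ 2 ∂P =
          ∫ ω, S ω ^ 2 ∂P + ∫ ω, D ω ^ 2 ∂P := by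
        have : ∀ ω, (∑ m ∈ Finset.range (n + 1), (X m ω - (P[X m | F m]) ω)) ^ 2 =
            S ω ^ 2 + D ω ^ 2 + 2 * (S ω * D ω) := fun ω => by
          rw [Finset.sum_range_succ]; ring
        simp only [this]
        have i4 : Integrable (fun ω => S ω ^ 2 + D ω ^ 2) P := i1.add i2
        rw [integral_add i4 (i3.const_mul 2), integral_const_mul, h0, mul_zero, add_zero]
        exact integral_add i1 i2
      rw [e, Finset.sum_range_succ, mul_add]
      exact add_le_add ih (hDle n)
  have h1 := integral_norm_le_lpNorm (p := 2) (by norm_num) (hS2 n)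
  have h2 := lpNorm_two_sq (hS2 n)
  simp only [Real.norm_eq_abs, sq_abs] at h1 h2
  refine h1.trans ?_
  rw [show (2 : ℝ) = √4 by rw [show (4 : ℝ) = 2 ^ 2 by norm_num]; simp,
    ← Real.sqrt_mul (by norm_num)]
  refine Real.le_sqrt_of_sq_le ?_
  have h3 := hsq n
  rw [← h2] at h3
  exact h3

/-- The `L¹` distance of a conditional expectation to a constant, by duality. -/
lemma integral_abs_condExp_sub_le {m : MeasurableSpace Ω} (hm : m ≤ mΩ) {X : Ω → ℝ} {c C : ℝ}
    (hX2 : MemLp X 2 P)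
    (h : ∀ Y : Ω → ℝ, Measurable[m] Y → (∀ ω, |Y ω| ≤ 1) →
      |∫ ω, Y ω * X ω ∂P - (∫ ω, Y ω ∂P) * c| ≤ C) :
    ∫ ω, |(P[X | m]) ω - c| ∂P ≤ C := by
  set g := P[X | m]
  have hg : Measurable[m] g := stronglyMeasurable_condExp.measurable
  have hg2 : MemLp g 2 P := hX2.condExp (by norm_num)
  -- The extremal weight is the sign of `g - c`.
  set Y : Ω → ℝ := fun ω => if c ≤ g ω then 1 else -1
  have hY : Measurable[m] Y :=
    Measurable.ite (hg measurableSet_Ici) measurable_const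
      measurable_const
  have hY1 : ∀ ω, |Y ω| ≤ 1 := fun ω => by
    simp only [Y]; split_ifs <;> simp
  have hY2 : MemLp Y 2 P := MemLp.of_bound (hY.mono hm le_rfl).aestronglyMeasurable 1 (.of_forall hY1)
  have hYi : Integrable Y P := hY2.integrable (by norm_num)
  have e : ∀ ω, |g ω - c| = Y ω * g ω - Y ω * c := fun ω => by
    simp only [Y]
    split_ifs with h
    · rw [abs_of_nonneg (sub_nonneg.2 h)]; ring
    · rw [abs_of_nonpos (by linarith)]; ring
  simp only [e]
  have i1 : Integrable (fun ω => Y ω * g ω) P := hY2.integrable_mul hg2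
  rw [integral_sub i1 (hYi.mul_const c), integral_mul_const,
    integral_mul_condExp (mΩ := mΩ) hm hY.stronglyMeasurable hY2 hX2]
  exact (le_abs_self _).trans (h Y hY hY1)

end ConditionalCentring

variable {Ω Θ : Type*} [mΩ : MeasurableSpace Ω] [MeasurableSpace Θ] {P : Measure Ω}
  {d : ℕ} {θ : ℤ → Ω → Θ} {A : Θ → Vec d →L[ℝ] Vec d} {b : Θ → Vec d}
  {B : Vec d →L[ℝ] Vec d} {r : ℝ}

omit mΩ [MeasurableSpace Θ] in
lemma sum_Ico_orbit (v : Ω → Vec d) (s t : ℕ) (ω : Ω) :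
    ∑ k ∈ Finset.Ico s t, orbit θ A b 0 v k ω =
      blockSum θ A b s (orbit θ A b 0 v s) (t - s) ω := by
  rw [Finset.sum_Ico_eq_sum_range, blockSum]
  refine Finset.sum_congr rfl fun j _ => ?_
  rw [orbit_add, zero_add]

lemma memLp_inner_mul_inner [IsProbabilityMeasure P] {U : Ω → Vec d} (hU : MemLp U 4 P)
    (a c : Vec d) : MemLp (fun ω => inner ℝ a (U ω) * inner ℝ c (U ω)) 2 P ∧
      ∫ ω, (inner ℝ a (U ω) * inner ℝ c (U ω)) ^ 2 ∂P ≤ ‖a‖ ^ 2 * ‖c‖ ^ 2 * lpNorm U 4 P ^ 4 := by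
  have hm : AEStronglyMeasurable (fun ω => inner ℝ a (U ω) * inner ℝ c (U ω)) P :=
    ((innerSL ℝ a).continuous.comp_aestronglyMeasurable hU.1).mul
      ((innerSL ℝ c).continuous.comp_aestronglyMeasurable hU.1)
  have hb : ∀ ω, (inner ℝ a (U ω) * inner ℝ c (U ω)) ^ 2 ≤ ‖a‖ ^ 2 * ‖c‖ ^ 2 * ‖U ω‖ ^ 4 :=
    fun ω => by
    rw [← sq_abs, abs_mul]
    calc _ ≤ ((‖a‖ * ‖U ω‖) * (‖c‖ * ‖U ω‖)) ^ 2 := by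
          gcongr <;> exact abs_real_inner_le_norm _ _
      _ = _ := by ring
  have hi := (integrable_norm_pow_four hU).const_mul (‖a‖ ^ 2 * ‖c‖ ^ 2)
  refine ⟨(memLp_two_iff_integrable_sq hm).2 (hi.mono' (hm.pow 2) (.of_forall fun ω => ?_)), ?_⟩
  · rw [Real.norm_of_nonneg (sq_nonneg _)]
    exact hb ω
  · rw [lpNorm_four_pow hU, ← integral_const_mul]
    exact integral_mono_of_nonneg (.of_forall fun ω => sq_nonneg _) hi (.of_forall hb)

namespace IsStationary

variable {K : ℝ} {Z : ℤ → Ω → Vec d} (hZ : IsStationary P θ A b r K Z)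
  (R : AffineRecursion P θ A b B r) [IsProbabilityMeasure P]
include hZ R

/-- Batch means without centring: the sum over blocks of the squared block sums. -/
theorem exists_integral_abs_sum_blocks_le {v : Ω → Vec d} (hv : Measurable[past θ 0] v)
    (hv4 : MemLp v 4 P) (a c : Vec d) :
    ∃ C : ℝ, 0 ≤ C ∧ ∀ (τ : ℕ → ℕ), Monotone τ → ∀ n : ℕ,
      ∫ ω, |∑ m ∈ Finset.range n,
        (inner ℝ a (∑ k ∈ Finset.Ico (τ m) (τ (m + 1)), orbit θ A b 0 v k ω) *
          inner ℝ c (∑ k ∈ Finset.Ico (τ m) (τ (m + 1)), orbit θ A b 0 v k ω) -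
        ((τ (m + 1) - τ m : ℕ) : ℝ) * longRun P B (Z 0) a c)| ∂P ≤
      C * (√(∑ m ∈ Finset.range n, ((τ (m + 1) - τ m : ℕ) : ℝ) ^ 2) + n) := by
  have h1 : 0 < 1 - r := sub_pos.2 R.lt_one
  set β := lpNorm (fun ω => b (θ 0 ω)) 4 P / (1 - r)
  have hβ : 0 ≤ β := div_nonneg lpNorm_nonneg h1.le
  -- `N` bounds all states in `L⁴`, so the bias estimate applies at every block start with one
  -- constant, independent of `τ` and `n`.
  set N := lpNorm v 4 P + β
  have hN : 0 ≤ N := add_nonneg lpNorm_nonneg hβ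
  obtain ⟨C, hC0, hC⟩ := hZ.exists_abs_integral_blockSum_sub_le R N a c
  set κ := 6 * (N + β) / (1 - r)
  have hκ : 0 ≤ κ := div_nonneg (by positivity) h1.le
  refine ⟨max (2 * (‖a‖ * ‖c‖ * κ ^ 2)) C, le_max_of_le_right hC0, fun τ hτ n => ?_⟩
  set U : ℕ → Ω → Vec d := orbit θ A b 0 v
  have hUm : ∀ k : ℕ, Measurable[past θ k] (U k) := fun k => by
    have := R.measurable_orbit_past hv k
    rwa [zero_add] at this
  have hU4 : ∀ k, MemLp (U k) 4 P := R.memLp_orbit hv hv4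
  have hUN : ∀ k, lpNorm (U k) 4 P ≤ N := R.lpNorm_orbit_le hv hv4
  set L : ℕ → ℕ := fun m => τ (m + 1) - τ m
  set T : ℕ → Ω → Vec d := fun m => blockSum θ A b (τ m) (U (τ m)) (L m)
  have hT4 : ∀ m, MemLp (T m) 4 P := fun m => R.memLp_blockSum (hUm _) (hU4 _) _
  have hTN : ∀ m, lpNorm (T m) 4 P ≤ κ * √(L m) := fun m => by
    refine (R.lpNorm_blockSum_le (hUm _) (hU4 _) _).trans ?_
    simp only [κ]
    gcongr
    exact hUN _
  set X : ℕ → Ω → ℝ := fun m ω => inner ℝ a (T m ω) * inner ℝ c (T m ω)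
  set σ := longRun P B (Z 0) a c
  have hX2 : ∀ m, MemLp (X m) 2 P := fun m => (memLp_inner_mul_inner (hT4 m) a c).1
  -- Block `m` starts at the state of time `τ m`, which is known in `F m`, and its last state is
  -- known in `F (m + 1)`; hence `X m` is adapted with a shift by one.
  set F : ℕ → MeasurableSpace Ω := fun m => past θ (τ m)
  have hF : ∀ m, F m ≤ mΩ := fun m => R.past_le _
  have hFm : Monotone F := fun i j hij => past_mono (by exact_mod_cast hτ hij)
  have hXm : ∀ m, StronglyMeasurable[F (m + 1)] (X m) := fun m => by
    have hTm : Measurable[past θ (τ (m + 1) : ℕ)] (T m) := by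
      refine R.measurable_blockSum (hUm _) _ ?_
      have := hτ (show m ≤ m + 1 by omega)
      simp only [L]
      omega
    exact ((by fun_prop : Measurable fun u : Vec d => inner ℝ a u * inner ℝ c u).comp
      hTm).stronglyMeasurable
  have hC2 : ∀ m, MemLp (P[X m | F m]) 2 P := fun m => (hX2 m).condExp (by norm_num)
  have hbias : ∀ m, ∫ ω, |(P[X m | F m]) ω - L m * σ| ∂P ≤ C := fun m =>
    integral_abs_condExp_sub_le (hF m) (hX2 m) fun Y hY hY1 =>
      hC _ _ (hUm _) (hU4 _) (hUN _) Y hY hY1 _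
  have hfl := integral_abs_sum_sub_condExp_le hF hFm hXm hX2 n
  have hsq : ∑ m ∈ Finset.range n, ∫ ω, X m ω ^ 2 ∂P ≤
      (‖a‖ * ‖c‖ * κ ^ 2) ^ 2 * ∑ m ∈ Finset.range n, (L m : ℝ) ^ 2 := by
    rw [Finset.mul_sum]
    refine Finset.sum_le_sum fun m _ => (memLp_inner_mul_inner (hT4 m) a c).2.trans ?_
    calc _ ≤ ‖a‖ ^ 2 * ‖c‖ ^ 2 * (κ * √(L m)) ^ 4 := by
          gcongr
          · exact lpNorm_nonneg
          · exact hTN m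
      _ = ‖a‖ ^ 2 * ‖c‖ ^ 2 * κ ^ 4 * (√(L m : ℝ) ^ 2) ^ 2 := by ring
      _ = _ := by rw [Real.sq_sqrt (Nat.cast_nonneg _)]; ring
  have hfl' : ∫ ω, |∑ m ∈ Finset.range n, (X m ω - (P[X m | F m]) ω)| ∂P ≤
      2 * (‖a‖ * ‖c‖ * κ ^ 2) * √(∑ m ∈ Finset.range n, (L m : ℝ) ^ 2) := by
    refine hfl.trans ?_
    rw [mul_assoc]
    refine mul_le_mul_of_nonneg_left ((Real.sqrt_le_sqrt hsq).trans_eq ?_) (by norm_num)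
    rw [Real.sqrt_mul (sq_nonneg _), Real.sqrt_sq (by positivity)]
  have iD : Integrable (fun ω => ∑ m ∈ Finset.range n, (X m ω - (P[X m | F m]) ω)) P :=
    integrable_finsetSum _ fun m _ => ((hX2 m).sub (hC2 m)).integrable (by norm_num)
  have iB : ∀ m, Integrable (fun ω => (P[X m | F m]) ω - L m * σ) P := fun m =>
    ((hC2 m).integrable (by norm_num)).sub (integrable_const _)
  have iB' : Integrable (fun ω => ∑ m ∈ Finset.range n, |(P[X m | F m]) ω - L m * σ|) P :=
    integrable_finsetSum _ fun m _ => (iB m).abs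
  calc _ ≤ ∫ ω, (|∑ m ∈ Finset.range n, (X m ω - (P[X m | F m]) ω)| +
        ∑ m ∈ Finset.range n, |(P[X m | F m]) ω - L m * σ|) ∂P := by
        refine integral_mono_of_nonneg (.of_forall fun ω => abs_nonneg _) (iD.abs.add iB')
          (.of_forall fun ω => ?_)
        have e : ∑ m ∈ Finset.range n,
          (inner ℝ a (∑ k ∈ Finset.Ico (τ m) (τ (m + 1)), orbit θ A b 0 v k ω) *
            inner ℝ c (∑ k ∈ Finset.Ico (τ m) (τ (m + 1)), orbit θ A b 0 v k ω) -
            ((τ (m + 1) - τ m : ℕ) : ℝ) * longRun P B (Z 0) a c) =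
          ∑ m ∈ Finset.range n, (X m ω - (P[X m | F m]) ω) +
            ∑ m ∈ Finset.range n, ((P[X m | F m]) ω - L m * σ) := by
          rw [← Finset.sum_add_distrib]
          refine Finset.sum_congr rfl fun m _ => ?_
          rw [sum_Ico_orbit]
          ring
        exact (le_of_eq (congrArg abs e)).trans ((abs_add_le _ _).trans
          (add_le_add_right (Finset.abs_sum_le_sum_abs _ _) _))
    _ = ∫ ω, |∑ m ∈ Finset.range n, (X m ω - (P[X m | F m]) ω)| ∂P +
        ∑ m ∈ Finset.range n, ∫ ω, |(P[X m | F m]) ω - L m * σ| ∂P := by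
        rw [integral_add iD.abs iB', integral_finsetSum _ fun m _ => (iB m).abs]
    _ ≤ 2 * (‖a‖ * ‖c‖ * κ ^ 2) * √(∑ m ∈ Finset.range n, (L m : ℝ) ^ 2) + n * C := by
        refine add_le_add hfl' ((Finset.sum_le_sum fun m _ => hbias m).trans ?_)
        simp
    _ ≤ _ := by
        rw [mul_add, mul_comm (n : ℝ)]
        gcongr
        · exact le_max_left _ _
        · exact le_max_right _ _

end IsStationary

namespace AffineRecursion

variable (R : AffineRecursion P θ A b B r) [IsProbabilityMeasure P]
include R

/-- Centring the block sums at the sample average changes batch means by a term of smaller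
order. -/
theorem exists_integral_abs_centred_sub_le {v : Ω → Vec d} (hv : Measurable[past θ 0] v)
    (hv4 : MemLp v 4 P) (a c : Vec d) :
    ∃ C : ℝ, 0 ≤ C ∧ ∀ n : ℕ, 1 ≤ n → ∀ s t : ℕ, s ≤ t → t ≤ n + 1 → ∀ T S : Ω → Vec d,
      (∀ ω, T ω = ∑ k ∈ Finset.Ico s t, orbit θ A b 0 v k ω) →
      (∀ ω, S ω = T ω - ((t - s : ℕ) : ℝ) • (1 / (n : ℝ)) •
        ∑ k ∈ Finset.Ico 1 (n + 1), orbit θ A b 0 v k ω) →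
      MemLp S 4 P ∧ MemLp T 4 P ∧
      ∫ ω, |inner ℝ a (S ω) * inner ℝ c (S ω) - inner ℝ a (T ω) * inner ℝ c (T ω)| ∂P ≤
        C * ((t - s : ℕ) : ℝ) * √((t - s : ℕ) : ℝ) / √n := by
  have h1 : 0 < 1 - r := sub_pos.2 R.lt_one
  set β := lpNorm (fun ω => b (θ 0 ω)) 4 P / (1 - r)
  have hβ : 0 ≤ β := div_nonneg lpNorm_nonneg h1.le
  set N := lpNorm v 4 P + β
  have hN : 0 ≤ N := add_nonneg lpNorm_nonneg hβ
  set κ := 6 * (N + β) / (1 - r)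
  have hκ : 0 ≤ κ := div_nonneg (by positivity) h1.le
  refine ⟨‖a‖ * ‖c‖ * (4 * κ ^ 2), by positivity, ?_⟩
  intro n hn s t hst htn T S hT hS
  have hUm : ∀ k : ℕ, Measurable[past θ k] (orbit θ A b 0 v k) := fun k => by
    have := R.measurable_orbit_past hv k
    rwa [zero_add] at this
  have hU4 : ∀ k, MemLp (orbit θ A b 0 v k) 4 P := R.memLp_orbit hv hv4
  have hTN : ∀ s L : ℕ, lpNorm (blockSum θ A b s (orbit θ A b 0 v s) L) 4 P ≤ κ * √L := fun s L => by
    refine (R.lpNorm_blockSum_le (hUm _) (hU4 _) _).trans ?_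
    simp only [κ]
    gcongr
    exact R.lpNorm_orbit_le hv hv4 s
  set L := t - s
  have eT : T = blockSum θ A b s (orbit θ A b 0 v s) L := by
    funext ω; rw [hT, sum_Ico_orbit]
  have hT4 : MemLp T 4 P := by rw [eT]; exact R.memLp_blockSum (hUm _) (hU4 _) _
  set G := blockSum θ A b (1 : ℕ) (orbit θ A b 0 v 1) n
  have hG4 : MemLp G 4 P := R.memLp_blockSum (hUm _) (hU4 _) _
  have eS : S = T - ((L : ℝ) * (1 / (n : ℝ))) • G := by
    funext ω
    rw [hS, sum_Ico_orbit, Pi.sub_apply, Pi.smul_apply, mul_smul]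
    rfl
  have hD4 : MemLp (((L : ℝ) * (1 / (n : ℝ))) • G) 4 P := hG4.const_smul _
  have hS4 : MemLp S 4 P := by rw [eS]; exact hT4.sub hD4
  refine ⟨hS4, hT4, ?_⟩
  have hn0 : (0 : ℝ) < n := by exact_mod_cast hn
  have hsn : 0 < √(n : ℝ) := Real.sqrt_pos.2 hn0
  have hsn2 : √(n : ℝ) * √n = n := Real.mul_self_sqrt hn0.le
  have hL2 : √(L : ℝ) * √L = L := Real.mul_self_sqrt (Nat.cast_nonneg _)
  -- A block may contain time `0`, so `L` can reach `n + 1`, which is at most `2 n`.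
  have hLn : (L : ℝ) ≤ 2 * n := by
    have : L ≤ 2 * n := by simp only [L]; omega
    exact_mod_cast this
  -- The total `G` has `n` terms and size `κ √n`; the centring correction is therefore of size `κ L
  -- / √n`, smaller than a block sum by the factor `√(L / n)`.
  have hD : lpNorm (((L : ℝ) * (1 / (n : ℝ))) • G) 4 P ≤ κ * L / √n := by
    rw [lpNorm_const_smul, coe_nnnorm, Real.norm_of_nonneg (by positivity)]
    calc _ ≤ (L : ℝ) * (1 / (n : ℝ)) * (κ * √n) := by gcongr; exact hTN 1 n
      _ = _ := by
        rw [eq_div_iff hsn.ne']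
        calc _ = (L : ℝ) * (1 / (n : ℝ)) * κ * (√n * √n) := by ring
          _ = _ := by rw [hsn2]; field_simp
  have hTN' : lpNorm T 4 P ≤ κ * √L := by rw [eT]; exact hTN s L
  have hratio : (L : ℝ) / √n ≤ 2 * √L := by
    rw [div_le_iff₀ hsn]
    have : √(L : ℝ) ≤ 2 * √n := by
      rw [show (2 : ℝ) = √4 by rw [show (4 : ℝ) = 2 ^ 2 by norm_num]; simp,
        ← Real.sqrt_mul (by norm_num)]
      exact Real.sqrt_le_sqrt (by linarith)
    nlinarith [Real.sqrt_nonneg (L : ℝ)]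
  have hSN : lpNorm S 4 P ≤ 3 * κ * √L := by
    rw [eS]
    have h2 := lpNorm_sub_le (g := ((L : ℝ) * (1 / (n : ℝ))) • G) hT4 (by norm_num)
    have h3 : κ * L / √n ≤ κ * (2 * √L) := by rw [mul_div_assoc]; gcongr
    linarith
  have hST : lpNorm (S - T) 4 P ≤ κ * L / √n := by
    have e : S - T = -(((L : ℝ) * (1 / (n : ℝ))) • G) := by rw [eS]; abel
    rw [e, lpNorm_neg]
    exact hD
  have hST4 := hS4.sub hT4
  have i1 := integrable_norm_mul_norm (memLp_two_of_four hST4) (memLp_two_of_four hS4)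
  have i2 := integrable_norm_mul_norm (memLp_two_of_four hST4) (memLp_two_of_four hT4)
  calc _ ≤ ∫ ω, ‖a‖ * ‖c‖ * (‖(S - T) ω‖ * ‖S ω‖ + ‖(S - T) ω‖ * ‖T ω‖) ∂P := by
        refine integral_mono_of_nonneg (.of_forall fun ω => abs_nonneg _)
          ((i1.add i2).const_mul _) (.of_forall fun ω => ?_)
        have e : inner ℝ a (S ω) * inner ℝ c (S ω) - inner ℝ a (T ω) * inner ℝ c (T ω) =
            inner ℝ a ((S - T) ω) * inner ℝ c (S ω) + inner ℝ a (T ω) * inner ℝ c ((S - T) ω) := by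
          simp only [Pi.sub_apply, inner_sub_right]; ring
        simp only [e]
        refine (abs_add_le _ _).trans ?_
        rw [abs_mul, abs_mul]
        calc _ ≤ (‖a‖ * ‖(S - T) ω‖) * (‖c‖ * ‖S ω‖) + (‖a‖ * ‖T ω‖) * (‖c‖ * ‖(S - T) ω‖) := by
              gcongr <;> exact abs_real_inner_le_norm _ _
          _ = _ := by ring
    _ = ‖a‖ * ‖c‖ * (∫ ω, ‖(S - T) ω‖ * ‖S ω‖ ∂P + ∫ ω, ‖(S - T) ω‖ * ‖T ω‖ ∂P) := by
        rw [integral_const_mul, integral_add i1 i2]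
    _ ≤ ‖a‖ * ‖c‖ * ((κ * L / √n) * (3 * κ * √L) + (κ * L / √n) * (κ * √L)) := by
        gcongr
        · refine (integral_norm_mul_norm_le hST4 hS4).trans ?_
          exact mul_le_mul hST hSN lpNorm_nonneg (by positivity)
        · refine (integral_norm_mul_norm_le hST4 hT4).trans ?_
          exact mul_le_mul hST hTN' lpNorm_nonneg (by positivity)
    _ = _ := by ring

end AffineRecursion

end DropoutSGD

/-! ### The rate of batch means and the choice of block lengths -/

namespace DropoutSGD

variable {Ω Θ : Type*} [mΩ : MeasurableSpace Ω] [MeasurableSpace Θ] {P : Measure Ω}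
  {d : ℕ} {θ : ℤ → Ω → Θ} {A : Θ → Vec d →L[ℝ] Vec d} {b : Θ → Vec d}
  {B : Vec d →L[ℝ] Vec d} {r : ℝ}

/-- The precision of centred batch means, in terms of the number and the sizes of the blocks. -/
theorem IsStationary.exists_integral_abs_batchMeans_sub_le {K : ℝ} {Z : ℤ → Ω → Vec d}
    (hZ : IsStationary P θ A b r K Z) (R : AffineRecursion P θ A b B r) [IsProbabilityMeasure P]
    {v : Ω → Vec d} (hv : Measurable[past θ 0] v) (hv4 : MemLp v 4 P) (a c : Vec d) :
    ∃ C : ℝ, 0 ≤ C ∧ ∀ n : ℕ, 1 ≤ n → ∀ τ : ℕ → ℕ, Monotone τ → ∀ M : ℕ, τ M = n + 1 →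
      ∀ Λ : ℝ, (∀ m < M, ((τ (m + 1) - τ m : ℕ) : ℝ) ≤ Λ) → 0 ≤ Λ → ∀ S : ℕ → Ω → Vec d,
      (∀ m ω, S m ω = ∑ k ∈ Finset.Ico (τ m) (τ (m + 1)), orbit θ A b 0 v k ω -
        ((τ (m + 1) - τ m : ℕ) : ℝ) • (1 / (n : ℝ)) •
          ∑ k ∈ Finset.Ico 1 (n + 1), orbit θ A b 0 v k ω) →
      Integrable (fun ω => (1 / (n : ℝ)) * ∑ m ∈ Finset.range M,
        inner ℝ a (S m ω) * inner ℝ c (S m ω) - longRun P B (Z 0) a c) P ∧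
      ∫ ω, |(1 / (n : ℝ)) * ∑ m ∈ Finset.range M, inner ℝ a (S m ω) * inner ℝ c (S m ω) -
        longRun P B (Z 0) a c| ∂P ≤ C * (√(n * Λ) / n + M / n + (τ 0 + 1) / n) := by
  obtain ⟨C1, hC1, h1⟩ := hZ.exists_integral_abs_sum_blocks_le R hv hv4 a c
  obtain ⟨C2, hC2, h2⟩ := R.exists_integral_abs_centred_sub_le hv hv4 a c
  set σ := longRun P B (Z 0) a c
  refine ⟨2 * C1 + 2 * C2 + |σ|, by positivity, ?_⟩
  intro n hn τ hτ M hM Λ hΛ hΛ0 S hS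
  have hn0 : (0 : ℝ) < n := by exact_mod_cast hn
  set L : ℕ → ℕ := fun m => τ (m + 1) - τ m
  set T : ℕ → Ω → Vec d := fun m ω => ∑ k ∈ Finset.Ico (τ m) (τ (m + 1)), orbit θ A b 0 v k ω
  have hcen : ∀ m < M, MemLp (S m) 4 P ∧ MemLp (T m) 4 P ∧
      ∫ ω, |inner ℝ a (S m ω) * inner ℝ c (S m ω) - inner ℝ a (T m ω) * inner ℝ c (T m ω)| ∂P ≤
        C2 * (L m : ℝ) * √(L m : ℝ) / √n := fun m hm =>
    h2 n hn _ _ (hτ (show m ≤ m + 1 by omega)) ((hτ (show m + 1 ≤ M by omega)).trans hM.le)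
      (T m) (S m) (fun ω => rfl) (hS m)
  have hblk := h1 τ hτ M
  -- The blocks cover `τ 0, …, n`, hence `n + 1 - τ 0` times rather than `n`. The difference is the
  -- origin of the term `(τ 0 + 1) / n` in the bound.
  have hLsum : ∑ m ∈ Finset.range M, (L m : ℝ) = n + 1 - τ 0 := by
    have : ∀ m, (L m : ℝ) = (τ (m + 1) : ℝ) - τ m := fun m => by
      simp only [L]
      rw [Nat.cast_sub (hτ (show m ≤ m + 1 by omega))]
    simp only [this]
    rw [Finset.sum_range_sub (fun m => (τ m : ℝ)), hM]
    push_cast; ring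
  have hLsum2 : ∑ m ∈ Finset.range M, (L m : ℝ) ≤ 2 * n := by
    have : (1 : ℝ) ≤ n := by exact_mod_cast hn
    have : (0 : ℝ) ≤ τ 0 := Nat.cast_nonneg _
    rw [hLsum]; linarith
  have iS : ∀ m < M, Integrable (fun ω => inner ℝ a (S m ω) * inner ℝ c (S m ω)) P := fun m hm =>
    integrable_inner_mul_inner (hcen m hm).1 (hcen m hm).1 a c
  have iT : ∀ m < M, Integrable (fun ω => inner ℝ a (T m ω) * inner ℝ c (T m ω)) P := fun m hm =>
    integrable_inner_mul_inner (hcen m hm).2.1 (hcen m hm).2.1 a c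
  have iSum : Integrable (fun ω => (1 / (n : ℝ)) * ∑ m ∈ Finset.range M,
        inner ℝ a (S m ω) * inner ℝ c (S m ω) - σ) P :=
    ((integrable_finsetSum _ fun m hm => iS m (Finset.mem_range.1 hm)).const_mul _).sub
      (integrable_const _)
  refine ⟨iSum, ?_⟩
  have iST : ∀ m ∈ Finset.range M, Integrable (fun ω =>
      |inner ℝ a (S m ω) * inner ℝ c (S m ω) - inner ℝ a (T m ω) * inner ℝ c (T m ω)|) P :=
    fun m hm => ((iS m (Finset.mem_range.1 hm)).sub (iT m (Finset.mem_range.1 hm))).abs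
  have iBl : Integrable (fun ω => |∑ m ∈ Finset.range M,
      (inner ℝ a (T m ω) * inner ℝ c (T m ω) - (L m : ℝ) * σ)|) P :=
    (integrable_finsetSum _ fun m hm =>
      (iT m (Finset.mem_range.1 hm)).sub (integrable_const _)).abs
  have iSTs := integrable_finsetSum _ iST
  have hsplit : ∫ ω, |(1 / (n : ℝ)) * ∑ m ∈ Finset.range M,
      inner ℝ a (S m ω) * inner ℝ c (S m ω) - σ| ∂P ≤
      (1 / (n : ℝ)) * (∑ m ∈ Finset.range M, ∫ ω, |inner ℝ a (S m ω) * inner ℝ c (S m ω) -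
        inner ℝ a (T m ω) * inner ℝ c (T m ω)| ∂P + ∫ ω, |∑ m ∈ Finset.range M,
      (inner ℝ a (T m ω) * inner ℝ c (T m ω) - (L m : ℝ) * σ)| ∂P + (τ 0 + 1) * |σ|) := by
    have ic : Integrable (fun _ : Ω => ((τ 0 : ℝ) + 1) * |σ|) P := integrable_const _
    have i2 : Integrable (fun ω => ∑ m ∈ Finset.range M, |inner ℝ a (S m ω) * inner ℝ c (S m ω) -
        inner ℝ a (T m ω) * inner ℝ c (T m ω)| + |∑ m ∈ Finset.range M,
      (inner ℝ a (T m ω) * inner ℝ c (T m ω) - (L m : ℝ) * σ)|) P := iSTs.add iBl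
    rw [← integral_finsetSum _ iST, ← integral_add iSTs iBl]
    have e0 : ((τ 0 : ℝ) + 1) * |σ| = ∫ _ : Ω, ((τ 0 : ℝ) + 1) * |σ| ∂P := by simp
    rw [e0, ← integral_add i2 ic, ← integral_const_mul]
    refine integral_mono iSum.abs ((i2.add ic).const_mul _) fun ω => ?_
    have e : (1 / (n : ℝ)) * ∑ m ∈ Finset.range M, inner ℝ a (S m ω) * inner ℝ c (S m ω) - σ =
        (1 / (n : ℝ)) * (∑ m ∈ Finset.range M, (inner ℝ a (S m ω) * inner ℝ c (S m ω) -
          inner ℝ a (T m ω) * inner ℝ c (T m ω)) + ∑ m ∈ Finset.range M,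
          (inner ℝ a (T m ω) * inner ℝ c (T m ω) - (L m : ℝ) * σ) + (1 - τ 0) * σ) := by
      rw [Finset.sum_sub_distrib, Finset.sum_sub_distrib, ← Finset.sum_mul, hLsum]
      field_simp
      ring
    simp only [e, abs_mul, abs_of_pos (one_div_pos.2 hn0)]
    refine mul_le_mul_of_nonneg_left ?_ (one_div_pos.2 hn0).le
    refine (abs_add_le _ _).trans (add_le_add ((abs_add_le _ _).trans
      (add_le_add (Finset.abs_sum_le_sum_abs _ _) le_rfl)) ?_)
    rw [abs_mul]
    gcongr
    have : (0 : ℝ) ≤ τ 0 := Nat.cast_nonneg _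
    rw [abs_le]; constructor <;> linarith
  have hsn : 0 < √(n : ℝ) := Real.sqrt_pos.2 hn0
  have hsnΛ : √((n : ℝ) * Λ) = √n * √Λ := Real.sqrt_mul hn0.le _
  have hA : ∑ m ∈ Finset.range M, ∫ ω, |inner ℝ a (S m ω) * inner ℝ c (S m ω) -
        inner ℝ a (T m ω) * inner ℝ c (T m ω)| ∂P ≤ 2 * C2 * √(n * Λ) := by
    calc _ ≤ ∑ m ∈ Finset.range M, (C2 * √Λ / √n) * (L m : ℝ) := by
          refine Finset.sum_le_sum fun m hm => ((hcen m (Finset.mem_range.1 hm)).2.2).trans ?_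
          have : √(L m : ℝ) ≤ √Λ := Real.sqrt_le_sqrt (hΛ m (Finset.mem_range.1 hm))
          calc C2 * (L m : ℝ) * √(L m : ℝ) / √n ≤ C2 * (L m : ℝ) * √Λ / √n := by gcongr
            _ = _ := by ring
      _ ≤ (C2 * √Λ / √n) * (2 * n) := by
          rw [← Finset.mul_sum]
          gcongr
      _ = _ := by
          rw [hsnΛ]
          have : (n : ℝ) = √n * √n := (Real.mul_self_sqrt hn0.le).symm
          rw [div_mul_eq_mul_div, div_eq_iff hsn.ne']
          nth_rewrite 1 [this]
          ring
  -- One factor of `L_m²` is bounded by `Λ`, and the other sums to at most `2 n`.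
  have hB : √(∑ m ∈ Finset.range M, (L m : ℝ) ^ 2) ≤ 2 * √(n * Λ) := by
    rw [show (2 : ℝ) = √4 by rw [show (4 : ℝ) = 2 ^ 2 by norm_num]; simp,
      ← Real.sqrt_mul (by norm_num)]
    refine Real.sqrt_le_sqrt ?_
    calc _ ≤ ∑ m ∈ Finset.range M, Λ * (L m : ℝ) := by
          refine Finset.sum_le_sum fun m hm => ?_
          rw [sq]
          exact mul_le_mul_of_nonneg_right (hΛ m (Finset.mem_range.1 hm)) (Nat.cast_nonneg _)
      _ ≤ Λ * (2 * n) := by rw [← Finset.mul_sum]; gcongr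
      _ ≤ _ := by nlinarith [mul_nonneg hn0.le hΛ0]
  refine hsplit.trans ?_
  have hq := Real.sqrt_nonneg ((n : ℝ) * Λ)
  have hM0 : (0 : ℝ) ≤ M := Nat.cast_nonneg _
  have hτ0 : (0 : ℝ) ≤ τ 0 := Nat.cast_nonneg _
  have hblk' : ∫ ω, |∑ m ∈ Finset.range M,
      (inner ℝ a (T m ω) * inner ℝ c (T m ω) - (L m : ℝ) * σ)| ∂P ≤ C1 * (2 * √(n * Λ) + M) :=
    hblk.trans (by gcongr)
  have e : (2 * C1 + 2 * C2 + |σ|) * (√(n * Λ) / n + M / n + (τ 0 + 1) / n) =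
      (1 / (n : ℝ)) * ((2 * C1 + 2 * C2 + |σ|) * (√(n * Λ) + M + (τ 0 + 1))) := by ring
  rw [e]
  refine mul_le_mul_of_nonneg_left ?_ (one_div_pos.2 hn0).le
  have hs := abs_nonneg σ
  nlinarith [mul_nonneg hC1 hM0, mul_nonneg hC1 hτ0, mul_nonneg hC2 hM0, mul_nonneg hC2 hτ0,
    mul_nonneg hs hM0, mul_nonneg hs hq]

section Blocks

variable {c ζ : ℝ}

lemma blockStart_mono (hc : 0 < c) (hζ : 1 < ζ) : Monotone (blockStart c ζ) := fun i j hij => by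
  have : (i : ℝ) ≤ j := by exact_mod_cast hij
  unfold blockStart
  gcongr

/-- The supremum in `ℕ` is attained because the set is nonempty (it contains `1`) and bounded: `m ≤
m^ζ` and `c m^ζ < n + 1`. -/
lemma lastBlock_spec (hc : 0 < c) (hζ : 1 < ζ) {n : ℕ} (hn1 : blockStart c ζ 1 ≤ n) :
    1 ≤ lastBlock (blockStart c ζ) n ∧ blockStart c ζ (lastBlock (blockStart c ζ) n) ≤ n ∧
      n < blockStart c ζ (lastBlock (blockStart c ζ) n + 1) := by
  set s := {m : ℕ | 1 ≤ m ∧ blockStart c ζ m ≤ n}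
  have hne : s.Nonempty := ⟨1, le_rfl, hn1⟩
  have hbd : BddAbove s := by
    refine ⟨⌈((n : ℝ) + 1) / c⌉₊, fun m hm => ?_⟩
    have h1 : (1 : ℝ) ≤ m := by exact_mod_cast hm.1
    have h2 : c * (m : ℝ) ^ ζ < n + 1 := by
      have h3 := Nat.lt_floor_add_one (c * (m : ℝ) ^ ζ)
      have h4 : ((⌊c * (m : ℝ) ^ ζ⌋₊ : ℕ) : ℝ) ≤ n := by exact_mod_cast hm.2
      linarith
    have h5 : (m : ℝ) ≤ (m : ℝ) ^ ζ := Real.self_le_rpow_of_one_le h1 hζ.le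
    have h6 : (m : ℝ) ≤ ((n : ℝ) + 1) / c := by
      rw [le_div_iff₀ hc]
      nlinarith
    exact_mod_cast h6.trans (Nat.le_ceil _)
  have hmem : lastBlock (blockStart c ζ) n ∈ s := Nat.sSup_mem hne hbd
  refine ⟨hmem.1, hmem.2, ?_⟩
  by_contra h
  have h1 : lastBlock (blockStart c ζ) n + 1 ∈ s := ⟨by omega, not_lt.1 h⟩
  have h2 : lastBlock (blockStart c ζ) n + 1 ≤ lastBlock (blockStart c ζ) n := le_csSup hbd h1
  omega

/-- Bernoulli's inequality at `-1 / (m + 1)` replaces the mean value theorem for `x ↦ x^ζ`; the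
extra `1` pays for rounding down. -/
lemma blockStart_succ_sub_le (hc : 0 < c) (hζ : 1 < ζ) (m : ℕ) :
    ((blockStart c ζ (m + 1) - blockStart c ζ m : ℕ) : ℝ) ≤
      c * ζ * ((m : ℝ) + 1) ^ (ζ - 1) + 1 := by
  have hm : (0 : ℝ) < (m : ℝ) + 1 := by positivity
  have hbern := one_add_mul_self_le_rpow_one_add (s := -1 / ((m : ℝ) + 1)) (by
    rw [le_div_iff₀ hm]; linarith [Nat.cast_nonneg (α := ℝ) m]) hζ.le
  have e1 : 1 + -1 / ((m : ℝ) + 1) = m / ((m : ℝ) + 1) := by field_simp; ring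
  rw [e1, Real.div_rpow (Nat.cast_nonneg m) hm.le, le_div_iff₀ (Real.rpow_pos_of_pos hm _)] at hbern
  have e2 : ((m : ℝ) + 1) ^ ζ = ((m : ℝ) + 1) ^ (ζ - 1) * (m + 1) := by
    rw [← Real.rpow_add_one hm.ne']; congr 1; ring
  have e3 : (1 + ζ * (-1 / ((m : ℝ) + 1))) * ((m : ℝ) + 1) ^ ζ =
      ((m : ℝ) + 1) ^ ζ - ζ * ((m : ℝ) + 1) ^ (ζ - 1) := by
    rw [e2]; field_simp; ring
  rw [e3] at hbern
  rw [Nat.cast_sub (blockStart_mono hc hζ (Nat.le_succ m))]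
  have h1 : (blockStart c ζ (m + 1) : ℝ) ≤ c * ((m : ℝ) + 1) ^ ζ := by
    have := Nat.floor_le (a := c * ((m + 1 : ℕ) : ℝ) ^ ζ) (by positivity)
    push_cast at this
    exact_mod_cast this
  have h2 : c * (m : ℝ) ^ ζ < blockStart c ζ m + 1 := Nat.lt_floor_add_one _
  nlinarith

/-- The number of blocks and the block sizes, as powers of the sample size. -/
lemma exists_block_bounds (hc : 0 < c) (hζ : 1 < ζ) : ∃ C : ℝ, 0 ≤ C ∧ ∀ n : ℕ, 1 ≤ n →
    blockStart c ζ 1 ≤ n →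
    (lastBlock (blockStart c ζ) n : ℝ) ≤ C * (n : ℝ) ^ (1 / ζ) ∧
    ∀ m ≤ lastBlock (blockStart c ζ) n,
      ((blockStart c ζ (m + 1) - blockStart c ζ m : ℕ) : ℝ) ≤ C * (n : ℝ) ^ (1 - 1 / ζ) := by
  have hζ0 : 0 < ζ := by linarith
  -- From `c ψ^ζ < n + 1 ≤ 2 n` one gets `ψ ≤ (2 n / c)^(1/ζ)`.
  set C1 := (2 / c) ^ (1 / ζ)
  have hC1 : 0 ≤ C1 := by positivity
  set C2 := c * ζ * (2 * C1) ^ (ζ - 1) + 1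
  have hC2 : 0 ≤ C2 := by positivity
  refine ⟨C1 + C2, by positivity, fun n hn hn1 => ?_⟩
  have hn0 : (1 : ℝ) ≤ n := by exact_mod_cast hn
  obtain ⟨hψ1, hψ2, -⟩ := lastBlock_spec hc hζ hn1
  set ψ := lastBlock (blockStart c ζ) n
  have hψ1' : (1 : ℝ) ≤ ψ := by exact_mod_cast hψ1
  have h1 : c * (ψ : ℝ) ^ ζ ≤ 2 * n := by
    have h3 : c * (ψ : ℝ) ^ ζ < blockStart c ζ ψ + 1 := Nat.lt_floor_add_one _
    have h4 : (blockStart c ζ ψ : ℝ) ≤ n := by exact_mod_cast hψ2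
    linarith
  have hψ : (ψ : ℝ) ≤ C1 * (n : ℝ) ^ (1 / ζ) := by
    have h2 : (ψ : ℝ) ^ ζ ≤ 2 / c * n := by
      rw [div_mul_eq_mul_div, le_div_iff₀ hc]; linarith
    calc (ψ : ℝ) = ((ψ : ℝ) ^ ζ) ^ (1 / ζ) := by
          rw [← Real.rpow_mul (by positivity), mul_one_div_cancel hζ0.ne', Real.rpow_one]
      _ ≤ (2 / c * n) ^ (1 / ζ) := by gcongr
      _ = _ := Real.mul_rpow (by positivity) (by positivity)
  have hp1 : 0 ≤ (n : ℝ) ^ (1 / ζ) := by positivity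
  have hp2 : 1 ≤ (n : ℝ) ^ (1 - 1 / ζ) := Real.one_le_rpow hn0 (by
    rw [sub_nonneg, div_le_one hζ0]; exact hζ.le)
  refine ⟨hψ.trans (by nlinarith), fun m hm => ?_⟩
  -- Since `m ≤ ψ` and `1 ≤ ψ`, one has `m + 1 ≤ 2 ψ`; this explains the factor `2 * C1` in `C2`.
  have hm' : (m : ℝ) + 1 ≤ 2 * C1 * (n : ℝ) ^ (1 / ζ) := by
    have : (m : ℝ) ≤ ψ := by exact_mod_cast hm
    linarith
  have h5 : ((m : ℝ) + 1) ^ (ζ - 1) ≤ (2 * C1) ^ (ζ - 1) * (n : ℝ) ^ (1 - 1 / ζ) := by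
    calc _ ≤ (2 * C1 * (n : ℝ) ^ (1 / ζ)) ^ (ζ - 1) :=
          Real.rpow_le_rpow (by positivity) hm' (by linarith)
      _ = _ := by
          rw [Real.mul_rpow (by positivity) hp1, ← Real.rpow_mul (by positivity)]
          congr 2
          field_simp
  refine (blockStart_succ_sub_le hc hζ m).trans ?_
  calc c * ζ * ((m : ℝ) + 1) ^ (ζ - 1) + 1 ≤
        c * ζ * ((2 * C1) ^ (ζ - 1) * (n : ℝ) ^ (1 - 1 / ζ)) + (n : ℝ) ^ (1 - 1 / ζ) := by gcongr
    _ = C2 * (n : ℝ) ^ (1 - 1 / ζ) := by simp only [C2]; ring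
    _ ≤ _ := by
        have : 0 ≤ C1 * (n : ℝ) ^ (1 - 1 / ζ) := by positivity
        linarith

/-- The blocks of the estimator after `n` iterations, the last one cut off at `n`. -/
noncomputable def cutBlock (c ζ : ℝ) (n m : ℕ) : ℕ :=
  if m < lastBlock (blockStart c ζ) n then blockStart c ζ (m + 1) else n + 1

lemma cutBlock_mono (hc : 0 < c) (hζ : 1 < ζ) {n : ℕ} (hn1 : blockStart c ζ 1 ≤ n) :
    Monotone (cutBlock c ζ n) := fun i j hij => by
  unfold cutBlock
  split_ifs with h1 h2 h2
  · exact blockStart_mono hc hζ (by omega)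
  · exact (blockStart_mono hc hζ (by omega)).trans
      ((lastBlock_spec hc hζ hn1).2.1.trans (Nat.le_succ n))
  · omega
  · exact le_rfl

/-- `cutBlock` numbers the blocks from `0`, so its block `m` is the estimator's block `m + 1`; the
half-open convention makes the last endpoint `n + 1`. -/
lemma sum_cutBlock {E : Type*} [AddCommMonoid E] (hc : 0 < c) (hζ : 1 < ζ) {n : ℕ}
    (hn1 : blockStart c ζ 1 ≤ n) (f : ℕ → ℕ → E) :
    ∑ m ∈ Finset.range (lastBlock (blockStart c ζ) n), f (cutBlock c ζ n m)
        (cutBlock c ζ n (m + 1)) =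
      ∑ m ∈ Finset.Ico 1 (lastBlock (blockStart c ζ) n),
          f (blockStart c ζ m) (blockStart c ζ (m + 1)) +
        f (blockStart c ζ (lastBlock (blockStart c ζ) n)) (n + 1) := by
  obtain ⟨h1, -, -⟩ := lastBlock_spec hc hζ hn1
  obtain ⟨k, hk⟩ : ∃ k, lastBlock (blockStart c ζ) n = k + 1 := ⟨_, (Nat.sub_add_cancel h1).symm⟩
  simp only [cutBlock, hk]
  rw [Finset.sum_range_succ, Finset.sum_Ico_eq_sum_range]
  congr 1
  · refine Finset.sum_congr rfl fun m hm => ?_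
    have hm' := Finset.mem_range.1 hm
    rw [if_pos (by omega), if_pos (by omega), add_comm 1 m]
  · rw [if_pos (by omega), if_neg (by omega)]

/-- Cutting only shortens the last block: `n < η_{ψ(n)+1}` means that its new endpoint `n + 1` does
not exceed the old one. -/
lemma cutBlock_sub_le (hc : 0 < c) (hζ : 1 < ζ) {n : ℕ} (hn1 : blockStart c ζ 1 ≤ n) {m : ℕ}
    (hm : m < lastBlock (blockStart c ζ) n) :
    cutBlock c ζ n (m + 1) - cutBlock c ζ n m ≤ blockStart c ζ (m + 2) - blockStart c ζ (m + 1) := by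
  obtain ⟨-, -, h3⟩ := lastBlock_spec hc hζ hn1
  unfold cutBlock
  rw [if_pos hm]
  split_ifs with h
  · exact le_rfl
  · have : lastBlock (blockStart c ζ) n + 1 = m + 2 := by omega
    rw [this] at h3
    omega

end Blocks

/-- The precision of batch means with block endpoints `⌊c m^ζ⌋`. -/
theorem IsStationary.exists_integral_abs_batchMeans_sub_le_rpow {K : ℝ} {Z : ℤ → Ω → Vec d}
    (hZ : IsStationary P θ A b r K Z) (R : AffineRecursion P θ A b B r) [IsProbabilityMeasure P]
    {v : Ω → Vec d} (hv : Measurable[past θ 0] v) (hv4 : MemLp v 4 P) {c ζ : ℝ} (hc : 0 < c)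
    (hζ : 1 < ζ) (a a' : Vec d) :
    ∃ C : ℝ, 0 ≤ C ∧ ∀ n : ℕ, 1 ≤ n → blockStart c ζ 1 ≤ n → ∀ S : ℕ → Ω → Vec d,
      (∀ m ω, S m ω = ∑ k ∈ Finset.Ico (cutBlock c ζ n m) (cutBlock c ζ n (m + 1)),
          orbit θ A b 0 v k ω -
        ((cutBlock c ζ n (m + 1) - cutBlock c ζ n m : ℕ) : ℝ) • (1 / (n : ℝ)) •
          ∑ k ∈ Finset.Ico 1 (n + 1), orbit θ A b 0 v k ω) →
      Integrable (fun ω => (1 / (n : ℝ)) * ∑ m ∈ Finset.range (lastBlock (blockStart c ζ) n),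
        inner ℝ a (S m ω) * inner ℝ a' (S m ω) - longRun P B (Z 0) a a') P ∧
      ∫ ω, |(1 / (n : ℝ)) * ∑ m ∈ Finset.range (lastBlock (blockStart c ζ) n),
        inner ℝ a (S m ω) * inner ℝ a' (S m ω) - longRun P B (Z 0) a a'| ∂P ≤
          C * (n : ℝ) ^ (max (1 / ζ - 1) (-1 / (2 * ζ))) := by
  obtain ⟨C1, hC1, h1⟩ := hZ.exists_integral_abs_batchMeans_sub_le R hv hv4 a a'
  obtain ⟨C2, hC2, h2⟩ := exists_block_bounds hc hζ
  have hζ0 : 0 < ζ := by linarith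
  refine ⟨C1 * (√C2 + C2 + (blockStart c ζ 1 + 1)), by positivity, fun n hn hn1 S hS => ?_⟩
  have hn0 : (1 : ℝ) ≤ n := by exact_mod_cast hn
  have hnpos : (0 : ℝ) < n := by linarith
  obtain ⟨hψ1, hψ2, hψ3⟩ := lastBlock_spec hc hζ hn1
  obtain ⟨hb1, hb2⟩ := h2 n hn hn1
  obtain ⟨hi, hle⟩ := h1 n hn (cutBlock c ζ n) (cutBlock_mono hc hζ hn1)
    (lastBlock (blockStart c ζ) n) (by simp [cutBlock]) (C2 * (n : ℝ) ^ (1 - 1 / ζ))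
    (fun m hm => (Nat.cast_le.2 (cutBlock_sub_le hc hζ hn1 hm)).trans (hb2 (m + 1) hm))
    (by positivity) S hS
  refine ⟨hi, hle.trans ?_⟩
  rw [mul_assoc]
  refine mul_le_mul_of_nonneg_left ?_ hC1
  set γ := max (1 / ζ - 1) (-1 / (2 * ζ))
  have e0 : cutBlock c ζ n 0 = blockStart c ζ 1 := by
    unfold cutBlock; rw [if_pos (by omega)]
  have g1 : (n : ℝ) ^ (1 / ζ - 1) ≤ (n : ℝ) ^ γ :=
    Real.rpow_le_rpow_of_exponent_le hn0 (le_max_left _ _)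
  have g2 : (n : ℝ) ^ (-1 / (2 * ζ)) ≤ (n : ℝ) ^ γ :=
    Real.rpow_le_rpow_of_exponent_le hn0 (le_max_right _ _)
  -- The three terms are fluctuation together with centring, of order `n^(-1/(2ζ))`; bias, of order
  -- `n^(1/ζ - 1)`; and the covering mismatch, of order `n⁻¹`, which the bias term dominates.
  have t1 : √(n * (C2 * (n : ℝ) ^ (1 - 1 / ζ))) / n ≤ √C2 * (n : ℝ) ^ γ := by
    have e : √(n * (C2 * (n : ℝ) ^ (1 - 1 / ζ))) / n = √C2 * (n : ℝ) ^ (-1 / (2 * ζ)) := by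
      rw [show (n : ℝ) * (C2 * (n : ℝ) ^ (1 - 1 / ζ)) = C2 * ((n : ℝ) ^ (1 - 1 / ζ) * n) by ring,
        ← Real.rpow_add_one hnpos.ne', Real.sqrt_mul hC2, Real.sqrt_eq_rpow ((n : ℝ) ^ _),
        ← Real.rpow_mul hnpos.le, mul_div_assoc, ← Real.rpow_sub_one hnpos.ne']
      congr 2
      field_simp
      ring
    rw [e]
    gcongr
  have t2 : (lastBlock (blockStart c ζ) n : ℝ) / n ≤ C2 * (n : ℝ) ^ γ := by
    calc _ ≤ C2 * (n : ℝ) ^ (1 / ζ) / n := by gcongr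
      _ = C2 * (n : ℝ) ^ (1 / ζ - 1) := by
          rw [mul_div_assoc, ← Real.rpow_sub_one hnpos.ne']
      _ ≤ _ := by gcongr
  have t3 : ((cutBlock c ζ n 0 : ℝ) + 1) / n ≤ (blockStart c ζ 1 + 1) * (n : ℝ) ^ γ := by
    rw [e0, div_eq_mul_inv, ← Real.rpow_neg_one]
    gcongr
    refine le_trans ?_ (le_max_left _ _)
    have : 0 ≤ 1 / ζ := by positivity
    linarith
  calc _ ≤ √C2 * (n : ℝ) ^ γ + C2 * (n : ℝ) ^ γ + (blockStart c ζ 1 + 1) * (n : ℝ) ^ γ :=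
        add_le_add (add_le_add t1 t2) t3
    _ = _ := by ring

end DropoutSGD

/-! ### SGD with dropout as an affine recursion -/

namespace DropoutSGD

/-- Products of two `L^(2q)` variables lie in `L^q`; this is why moments of order `2q` are assumed.
-/
lemma holderTriple_two_mul {q : ℝ} (hq : 0 < q) :
    ENNReal.HolderTriple (ENNReal.ofReal (2 * q)) (ENNReal.ofReal (2 * q)) (ENNReal.ofReal q) where
  inv_add_inv_eq_inv := by
    rw [← ENNReal.ofReal_inv_of_pos (by positivity), ← ENNReal.ofReal_inv_of_pos hq,
      ← ENNReal.ofReal_add (by positivity) (by positivity)]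
    congr 1
    field_simp
    norm_num

/-- The covariate vector after dropout, `D x`. -/
noncomputable def masked {d : ℕ} (t : Vec d × ℝ × (Fin d → ℝ)) : Vec d :=
  WithLp.toLp 2 fun i => t.2.2 i * t.1 i

/-- The linear part `u ↦ u - α ⟨D x, u⟩ D x` of the SGD step. -/
noncomputable def stepLin {d : ℕ} (α : ℝ) (t : Vec d × ℝ × (Fin d → ℝ)) : Vec d →L[ℝ] Vec d :=
  ContinuousLinearMap.id ℝ (Vec d) - α • (innerSL ℝ (masked t)).smulRight (masked t)

/-- The constant part of the SGD step centred at `βm`. -/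
noncomputable def stepConst {d : ℕ} (α : ℝ) (βstar βm : Vec d) (t : Vec d × ℝ × (Fin d → ℝ)) :
    Vec d :=
  (α * (inner ℝ t.1 βstar + t.2.1 - inner ℝ (masked t) βm)) • masked t

lemma stepLin_apply {d : ℕ} (α : ℝ) (t : Vec d × ℝ × (Fin d → ℝ)) (u : Vec d) :
    stepLin α t u = u - α • (inner ℝ (masked t) u • masked t) := by
  simp [stepLin]

lemma measurable_masked {d : ℕ} : Measurable (masked : Vec d × ℝ × (Fin d → ℝ) → Vec d) := by
  unfold masked
  fun_prop

lemma measurable_stepLin {d : ℕ} (α : ℝ) (v : Vec d) : Measurable fun t => stepLin α t v := by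
  have := measurable_masked (d := d)
  simp only [stepLin_apply]
  fun_prop

lemma measurable_stepConst {d : ℕ} (α : ℝ) (βstar βm : Vec d) :
    Measurable (stepConst α βstar βm) := by
  have := measurable_masked (d := d)
  unfold stepConst
  fun_prop

namespace Inputs

variable {Ω : Type*} {d : ℕ} (I : Inputs Ω d)

/-- The triple of covariate, noise and mask at time `k`. -/
def input (k : ℤ) (ω : Ω) : Vec d × ℝ × (Fin d → ℝ) := (I.x k ω, I.noise k ω, I.mask k ω)

lemma mulV_D_x (k : ℤ) (ω : Ω) : mulV (I.D k ω) (I.x k ω) = masked (I.input k ω) := by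
  ext i
  simp [mulV, D, masked, input, Matrix.mulVec_diagonal]

lemma dotProduct_mulV_D (k : ℤ) (ω : Ω) (u : Vec d) :
    (I.x k ω).ofLp ⬝ᵥ (mulV (I.D k ω) u).ofLp = inner ℝ (masked (I.input k ω)) u := by
  simp only [mulV, D, masked, input, PiLp.inner_apply, dotProduct, Matrix.mulVec_diagonal]
  refine Finset.sum_congr rfl fun i _ => ?_
  simp
  ring

lemma y_eq (βstar : Vec d) (k : ℤ) (ω : Ω) :
    I.y βstar k ω = inner ℝ (I.x k ω) βstar + I.noise k ω := by
  simp only [y, PiLp.inner_apply, dotProduct]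
  congr 1
  exact Finset.sum_congr rfl fun i _ => by simp [mul_comm]

/-- The step is affine, so moving the origin to `βm` changes only its constant part. That part has
mean zero when `βm` solves the normal equations. -/
lemma step_add (βstar βm : Vec d) (α : ℝ) (k : ℤ) (ω : Ω) (u : Vec d) :
    I.step βstar α k ω (βm + u) =
      βm + (stepLin α (I.input k ω) u + stepConst α βstar βm (I.input k ω)) := by
  rw [step, dotProduct_mulV_D, mulV_D_x, y_eq, stepLin_apply, stepConst, inner_add_right]
  simp only [input]
  module

lemma iterate_eq (βstar βm β₀ : Vec d) (α : ℝ) (k : ℕ) (ω : Ω) :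
    I.iterate βstar α β₀ k ω = βm + orbit I.input (stepLin α) (stepConst α βstar βm) 0
      (fun _ => β₀ - βm) k ω := by
  induction k with
  | zero => simp [iterate, orbit_zero]
  | succ k ih =>
    rw [iterate, ih, step_add, orbit_succ, zero_add]

/-- Index `m` of `backward` stands for `m + 1` steps, so the matching orbit starts at time `k - (m +
1)`. -/
lemma backward_eq (βstar βm : Vec d) (α : ℝ) (k : ℤ) (ω : Ω) (m : ℕ) (u : Vec d) :
    I.backward βstar α k ω m u = βm + orbit I.input (stepLin α) (stepConst α βstar βm)
      (k - (m + 1 : ℕ)) (fun _ => u - βm) (m + 1) ω := by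
  induction m generalizing u with
  | zero =>
    rw [backward, orbit_succ, orbit_zero]
    have e : k - ((0 + 1 : ℕ) : ℤ) + ((0 : ℕ) : ℤ) + 1 = k := by push_cast; ring
    rw [e, ← step_add, add_sub_cancel]
  | succ m ih =>
    have e1 : k - ((m + 1 + 1 : ℕ) : ℤ) + (1 : ℕ) = k - (m + 1 : ℕ) := by push_cast; ring
    have eo := orbit_add (θ := I.input) (A := stepLin α) (b := stepConst α βstar βm)
      (k - ((m + 1 + 1 : ℕ) : ℤ)) (fun _ => u - βm) 1 (m + 1)
    rw [e1, add_comm 1 (m + 1)] at eo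
    rw [backward, ih, eo]
    congr 1
    -- An orbit is computed path by path, so it suffices that the two starting values agree at this
    -- `ω`.
    have key : ∀ (v v' : Ω → Vec d) (s : ℤ) (j : ℕ), v ω = v' ω →
        orbit I.input (stepLin α) (stepConst α βstar βm) s v j ω =
        orbit I.input (stepLin α) (stepConst α βstar βm) s v' j ω := by
      intro v v' s j h
      induction j with
      | zero => exact h
      | succ j ih => rw [orbit_succ, orbit_succ, ih]
    refine key _ _ _ _ ?_
    rw [orbit_succ, orbit_zero]
    have e2 : k - ((m + 1 + 1 : ℕ) : ℤ) + ((0 : ℕ) : ℤ) + 1 = k - ((m : ℤ) + 1) := by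
      push_cast; ring
    rw [e2]
    have := I.step_add βstar βm α (k - ((m : ℤ) + 1)) ω (u - βm)
    rw [add_sub_cancel] at this
    rw [this]
    abel

variable [MeasurableSpace Ω] {P : Measure Ω} [IsProbabilityMeasure P] {p q α : ℝ}

namespace IsModel

variable {I} (hI : I.IsModel P p)
include hI

omit [IsProbabilityMeasure P] in
lemma measurable_input (k : ℤ) : Measurable (I.input k) :=
  (hI.measurable_x k).prodMk ((hI.measurable_noise k).prodMk (hI.measurable_mask k))

/-- The model asks for equal laws of covariates and of noises separately. Independence within each
triple and the Bernoulli product law of the mask then determine the joint law. -/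
lemma map_input (k l : ℤ) : P.map (I.input k) = P.map (I.input l) := by
  have hmask : ∀ k, P.map (I.mask k) = Measure.pi fun _ : Fin d =>
      ENNReal.ofReal p • Measure.dirac (1 : ℝ) + ENNReal.ofReal (1 - p) • Measure.dirac (0 : ℝ) :=
    fun k => by
    have h := (iIndepFun_iff_map_fun_eq_pi_map (fun i =>
      ((measurable_pi_apply i).comp (hI.measurable_mask k)).aemeasurable)).1 (hI.indep_mask k)
    simp only [Function.comp_def] at h
    refine Eq.trans h ?_
    congr 1
    funext i
    exact hI.mask_law k i
  have key : ∀ k, P.map (I.input k) = ((((P.map (I.x 1)).prod (P.map (I.noise 1))).prod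
      (Measure.pi fun _ : Fin d =>
      ENNReal.ofReal p • Measure.dirac (1 : ℝ) + ENNReal.ofReal (1 - p) • Measure.dirac (0 : ℝ))).map
      fun z => (z.1.1, z.1.2, z.2)) := fun k => by
    have mx := hI.measurable_x k
    have mn := hI.measurable_noise k
    have mm := hI.measurable_mask k
    rw [← hmask k, ← (hI.ident_x k).map_eq, ← (hI.ident_noise k).map_eq,
      ← (hI.indep_x_noise k).map_prod_eq_prod_map_map mx.aemeasurable mn.aemeasurable,
      ← (hI.indep_data_mask k).map_prod_eq_prod_map_map (mx.prodMk mn).aemeasurable mm.aemeasurable,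
      Measure.map_map (by fun_prop) ((mx.prodMk mn).prodMk mm)]
    rfl
  rw [key k, key l]

omit [IsProbabilityMeasure P] in
lemma ae_mask (k : ℤ) : ∀ᵐ ω ∂P, ∀ i, I.mask k ω i = 0 ∨ I.mask k ω i = 1 := by
  rw [ae_all_iff]
  intro i
  have hm : Measurable fun ω => I.mask k ω i := (measurable_pi_apply i).comp (hI.measurable_mask k)
  have h : ∀ᵐ z ∂(P.map fun ω => I.mask k ω i), z = 0 ∨ z = 1 := by
    rw [hI.mask_law, ae_add_measure_iff]
    have hs : MeasurableSet {z : ℝ | z = 0 ∨ z = 1} :=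
      (measurableSet_singleton 0).union (measurableSet_singleton 1)
    exact ⟨Measure.ae_smul_measure ((ae_dirac_iff hs).2 (Or.inr rfl)) _,
      Measure.ae_smul_measure ((ae_dirac_iff hs).2 (Or.inl rfl)) _⟩
  exact ae_of_ae_map hm.aemeasurable h

omit [IsProbabilityMeasure P] in
lemma ae_norm_masked_le (k : ℤ) : ∀ᵐ ω ∂P, ‖masked (I.input k ω)‖ ≤ ‖I.x k ω‖ := by
  filter_upwards [hI.ae_mask k] with ω h
  rw [EuclideanSpace.norm_eq, EuclideanSpace.norm_eq]
  refine Real.sqrt_le_sqrt (Finset.sum_le_sum fun i _ => ?_)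
  rcases h i with h | h <;> simp [masked, input, h]
  positivity

omit [IsProbabilityMeasure P] in
lemma integral_mask (hp : p ∈ Set.Ioo (0 : ℝ) 1) (k : ℤ) (i : Fin d) :
    ∫ ω, I.mask k ω i ∂P = p := by
  have hm : Measurable fun ω => I.mask k ω i := (measurable_pi_apply i).comp (hI.measurable_mask k)
  have h := integral_map (μ := P) hm.aemeasurable (f := fun z : ℝ => z)
    aestronglyMeasurable_id
  have d1 : Integrable (fun z : ℝ => z) (Measure.dirac (1 : ℝ)) := integrable_dirac (by simp)
  have d0 : Integrable (fun z : ℝ => z) (Measure.dirac (0 : ℝ)) := integrable_dirac (by simp)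
  rw [hI.mask_law, integral_add_measure (d1.smul_measure (by simp)) (d0.smul_measure (by simp)),
    integral_smul_measure, integral_smul_measure, integral_dirac, integral_dirac] at h
  rw [← h]
  simp [ENNReal.toReal_ofReal hp.1.le]

lemma integrable_mask (k : ℤ) (i : Fin d) : Integrable (fun ω => I.mask k ω i) P := by
  have hm : Measurable fun ω => I.mask k ω i := (measurable_pi_apply i).comp (hI.measurable_mask k)
  refine (integrable_const (1 : ℝ)).mono' hm.aestronglyMeasurable ?_
  filter_upwards [hI.ae_mask k] with ω h
  rcases h i with h | h <;> simp [h]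

lemma integral_mask_mul (hp : p ∈ Set.Ioo (0 : ℝ) 1) (k : ℤ) (i j : Fin d) :
    ∫ ω, I.mask k ω i * I.mask k ω j ∂P = if i = j then p else p ^ 2 := by
  split_ifs with h
  · subst h
    rw [← hI.integral_mask hp k i]
    refine integral_congr_ae ?_
    filter_upwards [hI.ae_mask k] with ω h
    rcases h i with h | h <;> simp [h]
  · have := ((hI.indep_mask k).indepFun h).integral_fun_mul_eq_mul_integral
      (hI.integrable_mask k i).1 (hI.integrable_mask k j).1
    rw [this, hI.integral_mask hp, hI.integral_mask hp, sq]

end IsModel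

end Inputs

end DropoutSGD

/-! ### Moments, positive definiteness and the `L⁴` contraction -/

namespace DropoutSGD

namespace Inputs

variable {Ω : Type*} {d : ℕ} {I : Inputs Ω d} [MeasurableSpace Ω] {P : Measure Ω}
  [IsProbabilityMeasure P] {p q α : ℝ}

omit [IsProbabilityMeasure P] in
lemma memLp_smul_of_two_mul {X : Ω → Vec d} {f : Ω → ℝ} (hq : 4 ≤ q)
    (hf : MemLp f (ENNReal.ofReal (2 * q)) P) (hX : MemLp X (ENNReal.ofReal (2 * q)) P) :
    MemLp (fun ω => f ω • X ω) (ENNReal.ofReal q) P := by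
  have := holderTriple_two_mul (q := q) (by linarith)
  exact hX.smul hf

lemma four_le_ofReal (hq : 4 ≤ q) : (4 : ℝ≥0∞) ≤ ENNReal.ofReal q := by
  rw [show (4 : ℝ≥0∞) = ENNReal.ofReal 4 by simp]
  exact ENNReal.ofReal_le_ofReal hq

lemma two_le_ofReal (hq : 4 ≤ q) : (2 : ℝ≥0∞) ≤ ENNReal.ofReal (2 * q) := by
  rw [show (2 : ℝ≥0∞) = ENNReal.ofReal 2 by simp]
  exact ENNReal.ofReal_le_ofReal (by linarith)

omit [IsProbabilityMeasure P] in
lemma memLp_apply {X : Ω → Vec d} {s : ℝ≥0∞} (hX : MemLp X s P) (i : Fin d) :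
    MemLp (fun ω => X ω i) s P :=
  (EuclideanSpace.proj i : Vec d →L[ℝ] ℝ).comp_memLp' hX

lemma inner_sq_eq_sum (w v : Vec d) :
    (inner ℝ w v) ^ 2 = ∑ i, ∑ j, v i * v j * (w i * w j) := by
  rw [PiLp.inner_apply, sq, Finset.sum_mul_sum]
  refine Finset.sum_congr rfl fun i _ => Finset.sum_congr rfl fun j _ => ?_
  simp
  ring

omit [IsProbabilityMeasure P] in
lemma integral_inner_sq {X : Ω → Vec d} (hX : MemLp X 2 P) (v : Vec d) :
    ∫ ω, (inner ℝ (X ω) v) ^ 2 ∂P = ∑ i, ∑ j, v i * v j * ∫ ω, X ω i * X ω j ∂P := by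
  have hi : ∀ i j, Integrable (fun ω => v i * v j * (X ω i * X ω j)) P := fun i j =>
    ((memLp_apply hX i).integrable_mul (memLp_apply hX j)).const_mul _
  simp only [inner_sq_eq_sum]
  rw [integral_finsetSum _ fun i _ => integrable_finsetSum _ fun j _ => hi i j]
  refine Finset.sum_congr rfl fun i _ => ?_
  rw [integral_finsetSum _ fun j _ => hi i j]
  exact Finset.sum_congr rfl fun j _ => integral_const_mul _ _

lemma dotProduct_mulV (A : Matrix (Fin d) (Fin d) ℝ) (v : Vec d) :
    v.ofLp ⬝ᵥ (mulV A v).ofLp = ∑ i, ∑ j, v i * v j * A i j := by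
  simp only [mulV, dotProduct, Matrix.mulVec]
  refine Finset.sum_congr rfl fun i _ => ?_
  rw [Finset.mul_sum]
  exact Finset.sum_congr rfl fun j _ => by ring

omit [MeasurableSpace Ω] in
lemma mulV_D_gram_D (k : ℤ) (ω : Ω) (v : Vec d) :
    mulV (I.D k ω * I.gram k ω * I.D k ω) v =
      inner ℝ (masked (I.input k ω)) v • masked (I.input k ω) := by
  ext i
  simp only [mulV, D, gram, outer, masked, input, Matrix.mulVec, dotProduct,
    Matrix.mul_diagonal, Matrix.diagonal_mul, Matrix.vecMulVec_apply, PiLp.inner_apply,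
    PiLp.smul_apply, smul_eq_mul, Finset.sum_mul]
  refine Finset.sum_congr rfl fun j _ => ?_
  simp
  ring

namespace IsModel

variable (hI : I.IsModel P p) (hmom : I.FiniteMoments P q) (hq : 4 ≤ q)
include hI hmom hq

omit hq [IsProbabilityMeasure P] in
lemma memLp_masked : MemLp (fun ω => masked (I.input 1 ω)) (ENNReal.ofReal (2 * q)) P :=
  hmom.2.mono (measurable_masked.comp (hI.measurable_input 1)).aestronglyMeasurable
    (hI.ae_norm_masked_le 1)

omit [IsProbabilityMeasure P] in
lemma memLp_inner_smul_masked (v : Vec d) :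
    MemLp (fun ω => inner ℝ (masked (I.input 1 ω)) v • masked (I.input 1 ω))
      (ENNReal.ofReal q) P := by
  have hw := hI.memLp_masked hmom
  have h1 : MemLp (fun ω => inner ℝ (masked (I.input 1 ω)) v) (ENNReal.ofReal (2 * q)) P := by
    have := (innerSL ℝ v).comp_memLp' hw
    refine this.congr_norm (by have := hw.1; exact this.inner aestronglyMeasurable_const) ?_
    exact .of_forall fun ω => by simp [real_inner_comm]
  exact memLp_smul_of_two_mul hq h1 hw

lemma memLp_stepLin (v : Vec d) : MemLp (fun ω => stepLin α (I.input 1 ω) v) 4 P := by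
  simp only [stepLin_apply]
  exact (memLp_const v).sub
    (((hI.memLp_inner_smul_masked hmom hq v).mono_exponent (four_le_ofReal hq)).const_smul α)

omit hq [IsProbabilityMeasure P] in
lemma memLp_residual (βstar βm : Vec d) :
    MemLp (fun ω => inner ℝ (I.x 1 ω) βstar + I.noise 1 ω - inner ℝ (masked (I.input 1 ω)) βm)
      (ENNReal.ofReal (2 * q)) P := by
  have key : ∀ {X : Ω → Vec d} (v : Vec d), MemLp X (ENNReal.ofReal (2 * q)) P →
      MemLp (fun ω => inner ℝ (X ω) v) (ENNReal.ofReal (2 * q)) P := fun {X} v hX => by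
    have := (innerSL ℝ v).comp_memLp' hX
    refine this.congr_norm (by have := hX.1; exact this.inner aestronglyMeasurable_const) ?_
    exact .of_forall fun ω => by simp [real_inner_comm]
  exact ((key βstar hmom.2).add hmom.1).sub (key βm (hI.memLp_masked hmom))

lemma memLp_stepConst (βstar βm : Vec d) :
    MemLp (fun ω => stepConst α βstar βm (I.input 1 ω)) 4 P :=
  (memLp_smul_of_two_mul hq ((hI.memLp_residual hmom βstar βm).const_mul α)
    (hI.memLp_masked hmom)).mono_exponent (four_le_ofReal hq)

/-- The mask contributes `p` on the diagonal and `p²` off it, which is `p` times the weights of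
`rescale`. -/
lemma integral_masked_mul (hp : p ∈ Set.Ioo (0 : ℝ) 1) (i j : Fin d) :
    ∫ ω, masked (I.input 1 ω) i * masked (I.input 1 ω) j ∂P = p * I.meanGram P p i j := by
  have hx2 : MemLp (I.x 1) 2 P := hmom.2.mono_exponent (two_le_ofReal hq)
  have ix : ∀ i j, Integrable (fun ω => I.x 1 ω i * I.x 1 ω j) P := fun i j =>
    (memLp_apply hx2 i).integrable_mul (memLp_apply hx2 j)
  have hind := ((hI.indep_data_mask 1).comp
    (φ := fun z : Vec d × ℝ => z.1 i * z.1 j) (ψ := fun m : Fin d → ℝ => m i * m j)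
    (by fun_prop) (by fun_prop)).symm
  have hmm : AEStronglyMeasurable (fun ω => I.mask 1 ω i * I.mask 1 ω j) P :=
    (hI.integrable_mask 1 i).1.mul (hI.integrable_mask 1 j).1
  have h1 : ∫ ω, masked (I.input 1 ω) i * masked (I.input 1 ω) j ∂P =
      (if i = j then p else p ^ 2) * ∫ ω, I.x 1 ω i * I.x 1 ω j ∂P := by
    rw [← hI.integral_mask_mul hp 1 i j]
    refine Eq.trans ?_ (hind.integral_fun_mul_eq_mul_integral hmm (ix i j).1)
    refine integral_congr_ae (.of_forall fun ω => ?_)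
    simp only [masked, input, Function.comp_apply]
    ring
  rw [h1, meanGram, Matrix.of_apply]
  by_cases hij : i = j
  · subst hij
    rw [if_pos rfl]
    congr 1
    refine integral_congr_ae (.of_forall fun ω => ?_)
    simp only [rescale, gram, outer, Matrix.add_apply, Matrix.smul_apply, Matrix.diagonal_apply_eq,
      Matrix.diag_apply, Matrix.vecMulVec_apply, smul_eq_mul]
    ring
  · rw [if_neg hij, sq, mul_assoc, ← integral_const_mul]
    congr 1
    refine integral_congr_ae (.of_forall fun ω => ?_)
    simp only [rescale, gram, outer, Matrix.add_apply, Matrix.smul_apply, Matrix.vecMulVec_apply,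
      smul_eq_mul, Matrix.diagonal_apply_ne _ hij]
    ring

lemma integral_inner_masked_sq (hp : p ∈ Set.Ioo (0 : ℝ) 1) (v : Vec d) :
    ∫ ω, (inner ℝ (masked (I.input 1 ω)) v) ^ 2 ∂P =
      p * (v.ofLp ⬝ᵥ (mulV (I.meanGram P p) v).ofLp) := by
  rw [integral_inner_sq ((hI.memLp_masked hmom).mono_exponent (two_le_ofReal hq)),
    dotProduct_mulV, Finset.mul_sum]
  refine Finset.sum_congr rfl fun i _ => ?_
  rw [Finset.mul_sum]
  refine Finset.sum_congr rfl fun j _ => ?_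
  rw [hI.integral_masked_mul hmom hq hp]
  ring

/-- The matrix `E[D x xᵀ D]` is positive definite. -/
lemma exists_pos_le_integral_inner_masked_sq (hp : p ∈ Set.Ioo (0 : ℝ) 1) :
    ∃ m : ℝ, 0 < m ∧ ∀ v : Vec d,
      m * ‖v‖ ^ 2 ≤ ∫ ω, (inner ℝ (masked (I.input 1 ω)) v) ^ 2 ∂P := by
  have hx2 : MemLp (I.x 1) 2 P := hmom.2.mono_exponent (two_le_ofReal hq)
  have ix : ∀ i j, Integrable (fun ω => I.x 1 ω i * I.x 1 ω j) P := fun i j =>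
    (memLp_apply hx2 i).integrable_mul (memLp_apply hx2 j)
  -- The smallest second moment of a covariate; for `d = 0` any positive constant serves.
  obtain ⟨m, hm, hmi⟩ : ∃ m : ℝ, 0 < m ∧ ∀ i : Fin d, m ≤ ∫ ω, I.x 1 ω i * I.x 1 ω i ∂P := by
    have hred : ∀ i : Fin d, 0 < ∫ ω, I.x 1 ω i * I.x 1 ω i ∂P := hI.reduced
    rcases isEmpty_or_nonempty (Fin d) with h | h
    · exact ⟨1, one_pos, fun i => h.elim i⟩
    · obtain ⟨i0, h0⟩ := Finite.exists_min fun i : Fin d => ∫ ω, I.x 1 ω i * I.x 1 ω i ∂P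
      exact ⟨_, hred i0, h0⟩
  have hp0 := hp.1
  have hp1 : 0 < 1 - p := sub_pos.2 hp.2
  refine ⟨p * ((1 - p) * m), by positivity, fun v => ?_⟩
  rw [hI.integral_inner_masked_sq hmom hq hp, dotProduct_mulV, mul_assoc]
  refine mul_le_mul_of_nonneg_left ?_ hp0.le
  have hG : ∀ i j, I.meanGram P p i j = p * ∫ ω, I.x 1 ω i * I.x 1 ω j ∂P +
      if i = j then (1 - p) * ∫ ω, I.x 1 ω i * I.x 1 ω i ∂P else 0 := fun i j => by
    rw [meanGram, Matrix.of_apply]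
    by_cases hij : i = j
    · subst hij
      rw [if_pos rfl, ← integral_const_mul, ← integral_const_mul,
        ← integral_add ((ix i i).const_mul _) ((ix i i).const_mul _)]
      refine integral_congr_ae (.of_forall fun ω => ?_)
      simp [rescale, gram, outer, Matrix.vecMulVec_apply]
    · rw [if_neg hij, add_zero, ← integral_const_mul]
      refine integral_congr_ae (.of_forall fun ω => ?_)
      simp [rescale, gram, outer, Matrix.vecMulVec_apply, Matrix.diagonal_apply_ne _ hij]
  have e : ∑ i, ∑ j, v i * v j * I.meanGram P p i j = p * ∫ ω, (inner ℝ (I.x 1 ω) v) ^ 2 ∂P +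
      ∑ i, v i ^ 2 * ((1 - p) * ∫ ω, I.x 1 ω i * I.x 1 ω i ∂P) := by
    rw [integral_inner_sq hx2, Finset.mul_sum, ← Finset.sum_add_distrib]
    refine Finset.sum_congr rfl fun i _ => ?_
    simp only [hG, mul_add, mul_ite, mul_zero, Finset.sum_add_distrib, Finset.sum_ite_eq,
      Finset.mem_univ, if_true, Finset.mul_sum]
    congr 1
    · exact Finset.sum_congr rfl fun j _ => by ring
    · ring
  rw [e, EuclideanSpace.real_norm_sq_eq, Finset.mul_sum]
  -- The full-matrix part of `E[X_p]` is nonnegative and is dropped; dropout makes the diagonal part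
  -- alone positive definite.
  have h0 : 0 ≤ p * ∫ ω, (inner ℝ (I.x 1 ω) v) ^ 2 ∂P :=
    mul_nonneg hp0.le (integral_nonneg fun ω => sq_nonneg _)
  refine le_add_of_nonneg_of_le h0 (Finset.sum_le_sum fun i _ => ?_)
  rw [mul_comm]
  gcongr
  exact hmi i

/-- The learning-rate condition makes the SGD step a contraction in `L⁴`. -/
lemma exists_contraction (hp : p ∈ Set.Ioo (0 : ℝ) 1) (hα : 0 < α)
    (hrate : I.LearningRateCondition P p q α) :
    ∃ r : ℝ, 0 ≤ r ∧ r < 1 ∧ ∀ v : Vec d,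
      ∫ ω, ‖stepLin α (I.input 1 ω) v‖ ^ 4 ∂P ≤ r ^ 4 * ‖v‖ ^ 4 := by
  obtain ⟨m, hm, hmv⟩ := hI.exists_pos_le_integral_inner_masked_sq hmom hq hp
  have hq0 : 0 < q := by linarith
  unfold LearningRateCondition at hrate
  set Kᵣ := ENNReal.ofReal (α * (q - 1) / 2) *
    (⨆ (v : Vec d) (_ : ‖v‖ = 1),
      ENNReal.ofReal ((1 + α * I.mu P q v) ^ (q - 2) * I.mu P q v ^ 2 /
        (p * (v.ofLp ⬝ᵥ (mulV (I.meanGram P p) v).ofLp))))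
  set κ := Kᵣ.toReal
  have hκ1 : κ < 1 := by
    have := (ENNReal.toReal_lt_toReal hrate.ne_top ENNReal.one_ne_top).2 hrate
    simpa using this
  have hκ0 : 0 ≤ κ := ENNReal.toReal_nonneg
  set w : Ω → Vec d := fun ω => masked (I.input 1 ω)
  have hw2 : MemLp w 2 P := (hI.memLp_masked hmom).mono_exponent (two_le_ofReal hq)
  -- The bound for unit vectors; the maximum with `0` allows taking its fourth root.
  set ρ := max 0 (1 - 4 * α * (1 - κ) * m)
  have hρ0 : 0 ≤ ρ := le_max_left _ _
  have hρ1 : ρ < 1 := max_lt one_pos (by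
    have : 0 < 4 * α * (1 - κ) * m := by
      have := sub_pos.2 hκ1
      positivity
    linarith)
  have hunit : ∀ v : Vec d, ‖v‖ = 1 → ∫ ω, ‖stepLin α (I.input 1 ω) v‖ ^ 4 ∂P ≤ ρ := by
    intro v hv
    set M : Ω → Vec d := fun ω => inner ℝ (w ω) v • w ω
    have hMq : MemLp M (ENNReal.ofReal q) P := hI.memLp_inner_smul_masked hmom hq v
    have hM4 : MemLp M 4 P := hMq.mono_exponent (four_le_ofReal hq)
    have hM2 : MemLp M 2 P := memLp_two_of_four hM4
    set μ := I.mu P q v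
    have hμ : μ = lpNorm M (ENNReal.ofReal q) P := by
      rw [lpNorm_eq_integral_norm_rpow_toReal (by simpa using hq0) ENNReal.ofReal_ne_top hMq.1,
        ENNReal.toReal_ofReal hq0.le]
      simp only [μ, mu, mulV_D_gram_D, one_div, M, w]
    have hμ0 : 0 ≤ μ := by rw [hμ]; exact lpNorm_nonneg
    set a := ∫ ω, (inner ℝ (w ω) v) ^ 2 ∂P
    have ha : m ≤ a := by simpa [hv] using hmv v
    have ha0 : 0 < a := hm.trans_le ha
    have hpa : p * (v.ofLp ⬝ᵥ (mulV (I.meanGram P p) v).ofLp) = a :=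
      (hI.integral_inner_masked_sq hmom hq hp v).symm
    have hcond : α * (q - 1) / 2 * ((1 + α * μ) ^ (q - 2) * μ ^ 2 / a) ≤ κ := by
      have h1 : ENNReal.ofReal (α * (q - 1) / 2) *
          ENNReal.ofReal ((1 + α * μ) ^ (q - 2) * μ ^ 2 / a) ≤ Kᵣ := by
        refine mul_le_mul_right ?_ _
        rw [← hpa]
        exact le_iSup₂_of_le (f := fun (v : Vec d) (_ : ‖v‖ = 1) =>
          ENNReal.ofReal ((1 + α * I.mu P q v) ^ (q - 2) * I.mu P q v ^ 2 /
            (p * (v.ofLp ⬝ᵥ (mulV (I.meanGram P p) v).ofLp)))) v hv le_rfl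
      have hq1 : 0 ≤ α * (q - 1) / 2 := by
        have : 0 ≤ q - 1 := by linarith
        positivity
      rw [← ENNReal.ofReal_mul hq1] at h1
      exact (ENNReal.ofReal_le_iff_le_toReal hrate.ne_top).1 h1
    -- Here `q - 2 ≥ 2` is used. Together with `q - 1 ≥ 3`, the rate condition then dominates the
    -- second- and fourth-order terms in `α` below.
    have hpow : 1 + α ^ 2 * μ ^ 2 ≤ (1 + α * μ) ^ (q - 2) := by
      have h1 : (1 : ℝ) ≤ 1 + α * μ := by
        have : 0 ≤ α * μ := by positivity
        linarith
      calc 1 + α ^ 2 * μ ^ 2 ≤ (1 + α * μ) ^ (2 : ℕ) := by nlinarith [mul_nonneg hα.le hμ0]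
        _ = (1 + α * μ) ^ (2 : ℝ) := by norm_cast
        _ ≤ _ := Real.rpow_le_rpow_of_exponent_le h1 (by linarith)
    have hmain : 6 * α ^ 2 * μ ^ 2 + α ^ 4 * μ ^ 4 ≤ 4 * α * (κ * a) := by
      have h1 : α * (q - 1) / 2 * ((1 + α * μ) ^ (q - 2) * μ ^ 2) ≤ κ * a := by
        rw [← mul_div_assoc, div_le_iff₀ ha0] at hcond
        exact hcond
      have h2 : 3 / 2 * α * ((1 + α ^ 2 * μ ^ 2) * μ ^ 2) ≤ κ * a := by
        refine le_trans ?_ h1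
        have : 3 / 2 * α ≤ α * (q - 1) / 2 := by nlinarith
        have hq1 : 0 ≤ α * (q - 1) / 2 := by
          have : 0 ≤ q - 1 := by linarith
          positivity
        gcongr
      have h3 := mul_le_mul_of_nonneg_left h2 (by positivity : 0 ≤ 4 * α)
      have h4 : 0 ≤ α ^ 4 * μ ^ 4 := by positivity
      nlinarith
    have hE4 : ∫ ω, ‖M ω‖ ^ 4 ∂P ≤ μ ^ 4 := by
      rw [← lpNorm_four_pow hM4, hμ]
      exact pow_le_pow_left₀ lpNorm_nonneg (lpNorm_mono_exponent (four_le_ofReal hq) hMq) 4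
    have hE2 : ∫ ω, ‖M ω‖ ^ 2 ∂P ≤ μ ^ 2 := by
      rw [← lpNorm_two_sq hM2, hμ]
      exact pow_le_pow_left₀ lpNorm_nonneg (lpNorm_mono_exponent
        ((by norm_num : (2 : ℝ≥0∞) ≤ 4).trans (four_le_ofReal hq)) hMq) 2
    have i4 := integrable_norm_pow_four hM4
    have i2 : Integrable (fun ω => ‖M ω‖ ^ 2) P := hM2.integrable_norm_pow (by norm_num)
    have ia : Integrable (fun ω => (inner ℝ (w ω) v) ^ 2) P := by
      have h := (innerSL ℝ v).comp_memLp' hw2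
      refine h.integrable_sq.congr (.of_forall fun ω => ?_)
      simp [real_inner_comm]
    -- Square `‖v - α M‖² = 1 - 2 α s + α² ‖M‖²`, drop the negative term `-4 α³ s ‖M‖²`, and use `s²
    -- ≤ ‖M‖²`; thus `6 = 4 + 2`.
    have hpt : ∀ ω, ‖stepLin α (I.input 1 ω) v‖ ^ 4 ≤
        1 - 4 * α * (inner ℝ (w ω) v) ^ 2 + 6 * α ^ 2 * ‖M ω‖ ^ 2 + α ^ 4 * ‖M ω‖ ^ 4 := by
      intro ω
      rw [stepLin_apply]
      change ‖v - α • M ω‖ ^ 4 ≤ _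
      set s := (inner ℝ (w ω) v) ^ 2
      have hs : inner ℝ v (M ω) = s := by
        simp only [M, inner_smul_right, s]
        rw [real_inner_comm]; ring
      have hs0 : 0 ≤ s := sq_nonneg _
      have hsM : s ≤ ‖M ω‖ := by
        rw [← hs]
        have := real_inner_le_norm v (M ω)
        rwa [hv, one_mul] at this
      have hn : ‖v - α • M ω‖ ^ 2 = 1 - 2 * α * s + α ^ 2 * ‖M ω‖ ^ 2 := by
        rw [norm_sub_sq_real, inner_smul_right, hs, hv, norm_smul, Real.norm_of_nonneg hα.le]
        ring
      have hn4 : ‖v - α • M ω‖ ^ 4 = (1 - 2 * α * s + α ^ 2 * ‖M ω‖ ^ 2) ^ 2 := by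
        rw [← hn]; ring
      rw [hn4]
      have hss : s ^ 2 ≤ ‖M ω‖ ^ 2 := pow_le_pow_left₀ hs0 hsM 2
      have h1 : 0 ≤ α ^ 3 * s * ‖M ω‖ ^ 2 := by positivity
      have h2 : α ^ 2 * s ^ 2 ≤ α ^ 2 * ‖M ω‖ ^ 2 := by gcongr
      nlinarith
    have iAv := integrable_norm_pow_four (hI.memLp_stepLin (α := α) hmom hq v)
    calc _ ≤ ∫ ω, (1 - 4 * α * (inner ℝ (w ω) v) ^ 2 + 6 * α ^ 2 * ‖M ω‖ ^ 2 +
            α ^ 4 * ‖M ω‖ ^ 4) ∂P :=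
          integral_mono iAv ((((integrable_const 1).sub (ia.const_mul _)).add
            (i2.const_mul _)).add (i4.const_mul _)) hpt
      _ = 1 - 4 * α * a + 6 * α ^ 2 * ∫ ω, ‖M ω‖ ^ 2 ∂P + α ^ 4 * ∫ ω, ‖M ω‖ ^ 4 ∂P := by
          have j1 : Integrable (fun ω => (1 : ℝ) - 4 * α * (inner ℝ (w ω) v) ^ 2) P :=
            (integrable_const 1).sub (ia.const_mul _)
          have j2 : Integrable (fun ω => (1 : ℝ) - 4 * α * (inner ℝ (w ω) v) ^ 2 +
            6 * α ^ 2 * ‖M ω‖ ^ 2) P := j1.add (i2.const_mul _)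
          rw [integral_add j2 (i4.const_mul _), integral_add j1 (i2.const_mul _),
            integral_sub (integrable_const 1) (ia.const_mul _), integral_const_mul,
            integral_const_mul, integral_const_mul]
          simp [a]
      _ ≤ 1 - 4 * α * a + 6 * α ^ 2 * μ ^ 2 + α ^ 4 * μ ^ 4 := by gcongr
      _ ≤ 1 - 4 * α * (1 - κ) * a := by linarith
      _ ≤ 1 - 4 * α * (1 - κ) * m := by
          have : 0 ≤ 4 * α * (1 - κ) := by
            have := (sub_pos.2 hκ1).le
            positivity
          have := mul_le_mul_of_nonneg_left ha this
          linarith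
      _ ≤ ρ := le_max_right _ _
  -- Homogeneity extends the bound from unit vectors to all vectors.
  refine ⟨√√ρ, Real.sqrt_nonneg _, ?_, fun v => ?_⟩
  · rw [Real.sqrt_lt' one_pos, Real.sqrt_lt' (by norm_num)]
    simpa using hρ1
  · have hr4 : √√ρ ^ 4 = ρ := by
      rw [show 4 = 2 * 2 by norm_num, pow_mul, Real.sq_sqrt (Real.sqrt_nonneg _), Real.sq_sqrt hρ0]
    rw [hr4]
    by_cases hv : v = 0
    · simp [hv]
    · have hv' : ‖v‖ ≠ 0 := norm_ne_zero_iff.2 hv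
      have h := hunit (‖v‖⁻¹ • v) (by rw [norm_smul, norm_inv, norm_norm, inv_mul_cancel₀ hv'])
      simp only [map_smul, norm_smul, norm_inv, norm_norm, mul_pow] at h
      rw [integral_const_mul, inv_pow, inv_mul_le_iff₀ (by positivity)] at h
      linarith

end IsModel

end Inputs

end DropoutSGD

/-! ### The risk minimizer and the centred recursion -/

namespace DropoutSGD

namespace Inputs

variable {Ω : Type*} {d : ℕ} {I : Inputs Ω d} [MeasurableSpace Ω] {P : Measure Ω}
  [IsProbabilityMeasure P] {p q α : ℝ}

omit [IsProbabilityMeasure P] in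
lemma risk_eq (βstar b : Vec d) : I.risk P βstar b = ∫ ω, (1 / 2 : ℝ) *
    (inner ℝ (I.x 1 ω) βstar + I.noise 1 ω - inner ℝ (masked (I.input 1 ω)) b) ^ 2 ∂P := by
  simp only [risk, y_eq, dotProduct_mulV_D]

namespace IsModel

variable (hI : I.IsModel P p) (hmom : I.FiniteMoments P q) (hq : 4 ≤ q)
include hI hmom hq

lemma exists_gram : ∃ G : Vec d →L[ℝ] Vec d, ∀ v,
    ∫ ω, inner ℝ (masked (I.input 1 ω)) v • masked (I.input 1 ω) ∂P = G v := by
  have hi : ∀ v, Integrable (fun ω => inner ℝ (masked (I.input 1 ω)) v • masked (I.input 1 ω)) P :=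
    fun v => ((hI.memLp_inner_smul_masked hmom hq v).mono_exponent
      (four_le_ofReal hq)).integrable (by norm_num)
  refine ⟨LinearMap.toContinuousLinearMap
    { toFun := fun v => ∫ ω, inner ℝ (masked (I.input 1 ω)) v • masked (I.input 1 ω) ∂P
      map_add' := fun u v => by
        simp only [inner_add_right, add_smul]
        exact integral_add (hi u) (hi v)
      map_smul' := fun a v => by
        simp only [inner_smul_right, mul_smul, RingHom.id_apply]
        exact integral_smul a _ }, fun v => rfl⟩

lemma integrable_residual_smul (βstar b : Vec d) : Integrable (fun ω =>
    (inner ℝ (I.x 1 ω) βstar + I.noise 1 ω - inner ℝ (masked (I.input 1 ω)) b) •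
      masked (I.input 1 ω)) P :=
  ((memLp_smul_of_two_mul hq (hI.memLp_residual hmom βstar b)
    (hI.memLp_masked hmom)).mono_exponent (four_le_ofReal hq)).integrable (by norm_num)

/-- The normal equations have a solution. -/
lemma exists_integral_residual_smul_eq_zero (hp : p ∈ Set.Ioo (0 : ℝ) 1) (βstar : Vec d) :
    ∃ βm : Vec d, ∫ ω,
      (inner ℝ (I.x 1 ω) βstar + I.noise 1 ω - inner ℝ (masked (I.input 1 ω)) βm) •
        masked (I.input 1 ω) ∂P = 0 := by
  obtain ⟨G, hG⟩ := hI.exists_gram hmom hq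
  obtain ⟨m, hm, hmv⟩ := hI.exists_pos_le_integral_inner_masked_sq hmom hq hp
  have hi : ∀ v, Integrable (fun ω => inner ℝ (masked (I.input 1 ω)) v • masked (I.input 1 ω)) P :=
    fun v => ((hI.memLp_inner_smul_masked hmom hq v).mono_exponent
      (four_le_ofReal hq)).integrable (by norm_num)
  have hGv : ∀ v, inner ℝ v (G v) = ∫ ω, (inner ℝ (masked (I.input 1 ω)) v) ^ 2 ∂P := fun v => by
    rw [← hG, ← integral_inner (hi v)]
    refine integral_congr_ae (.of_forall fun ω => ?_)
    simp only [inner_smul_right]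
    rw [real_inner_comm]; ring
  -- Positive definiteness makes the Gram operator injective, hence surjective in finite dimension,
  -- so the normal equations are solvable.
  have hinj : Function.Injective (G : Vec d →ₗ[ℝ] Vec d) := by
    rw [injective_iff_map_eq_zero]
    intro v hv
    have h1 := hmv v
    have hv' : G v = 0 := hv
    rw [← hGv, hv', inner_zero_right] at h1
    by_contra hne
    have : 0 < ‖v‖ := norm_pos_iff.2 hne
    have : 0 < m * ‖v‖ ^ 2 := by positivity
    linarith
  obtain ⟨βm, hβm⟩ := LinearMap.injective_iff_surjective.1 hinj
    (∫ ω, (inner ℝ (I.x 1 ω) βstar + I.noise 1 ω - inner ℝ (masked (I.input 1 ω)) (0 : Vec d)) •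
      masked (I.input 1 ω) ∂P)
  refine ⟨βm, ?_⟩
  have hβm' : G βm = _ := hβm
  rw [← hG] at hβm'
  rw [← sub_self (G βm), ← hG]
  nth_rewrite 1 [hβm']
  rw [← integral_sub (hI.integrable_residual_smul hmom hq βstar 0) (hi βm)]
  refine integral_congr_ae (.of_forall fun ω => ?_)
  simp only [inner_zero_right, sub_zero, sub_smul]

lemma integrable_inner_masked_sq (v : Vec d) :
    Integrable (fun ω => (inner ℝ (masked (I.input 1 ω)) v) ^ 2) P := by
  have h := (innerSL ℝ v).comp_memLp' ((hI.memLp_masked hmom).mono_exponent (two_le_ofReal hq))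
  refine h.integrable_sq.congr (.of_forall fun ω => ?_)
  simp [real_inner_comm]

/-- Pythagoras: the normal equations kill the cross term, and the excess risk is a positive definite
quadratic form in `b - βm`. -/
lemma risk_eq_add {βstar βm : Vec d} (h0 : ∫ ω,
      (inner ℝ (I.x 1 ω) βstar + I.noise 1 ω - inner ℝ (masked (I.input 1 ω)) βm) •
        masked (I.input 1 ω) ∂P = 0) (b : Vec d) :
    I.risk P βstar b = I.risk P βstar βm +
      (1 / 2) * ∫ ω, (inner ℝ (masked (I.input 1 ω)) (b - βm)) ^ 2 ∂P := by
  rw [risk_eq, risk_eq]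
  set ρ : Ω → ℝ := fun ω =>
    inner ℝ (I.x 1 ω) βstar + I.noise 1 ω - inner ℝ (masked (I.input 1 ω)) βm
  have i1 : Integrable (fun ω => (1 / 2 : ℝ) * ρ ω ^ 2) P :=
    (((hI.memLp_residual hmom βstar βm).mono_exponent (two_le_ofReal hq)).integrable_sq).const_mul _
  have i2 : Integrable (fun ω => (1 / 2 : ℝ) * (inner ℝ (masked (I.input 1 ω)) (b - βm)) ^ 2) P :=
    (hI.integrable_inner_masked_sq hmom hq _).const_mul _
  have i0 := hI.integrable_residual_smul hmom hq βstar βm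
  have i3 : Integrable (fun ω => inner ℝ (b - βm) (ρ ω • masked (I.input 1 ω))) P :=
    i0.const_inner _
  have e3 : ∫ ω, inner ℝ (b - βm) (ρ ω • masked (I.input 1 ω)) ∂P = 0 := by
    rw [integral_inner i0, h0, inner_zero_right]
  have i12 : Integrable (fun ω => (1 / 2 : ℝ) * ρ ω ^ 2 +
      (1 / 2 : ℝ) * (inner ℝ (masked (I.input 1 ω)) (b - βm)) ^ 2) P := i1.add i2
  rw [← integral_const_mul, ← integral_add i1 i2, ← sub_zero (∫ ω, _ + _ ∂P), ← e3,
    ← integral_sub i12 i3]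
  refine integral_congr_ae (.of_forall fun ω => ?_)
  simp only [ρ, inner_smul_right, real_inner_comm (b - βm)]
  rw [inner_sub_left, real_inner_comm b, real_inner_comm βm]
  ring

/-- A solution of the normal equations is the unique minimizer of the risk. -/
lemma forall_risk_le_iff {βstar βm : Vec d} (hp : p ∈ Set.Ioo (0 : ℝ) 1) (h0 : ∫ ω,
      (inner ℝ (I.x 1 ω) βstar + I.noise 1 ω - inner ℝ (masked (I.input 1 ω)) βm) •
        masked (I.input 1 ω) ∂P = 0) (b : Vec d) :
    (∀ b', I.risk P βstar b ≤ I.risk P βstar b') ↔ b = βm := by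
  constructor
  · intro h
    obtain ⟨m, hm, hmv⟩ := hI.exists_pos_le_integral_inner_masked_sq hmom hq hp
    have h1 := h βm
    rw [hI.risk_eq_add hmom hq h0 b] at h1
    have h2 := hmv (b - βm)
    by_contra hne
    have : 0 < ‖b - βm‖ := norm_pos_iff.2 (sub_ne_zero.2 hne)
    have : 0 < m * ‖b - βm‖ ^ 2 := by positivity
    linarith
  · rintro rfl b'
    rw [hI.risk_eq_add hmom hq h0 b']
    have : 0 ≤ ∫ ω, (inner ℝ (masked (I.input 1 ω)) (b' - b)) ^ 2 ∂P :=
      integral_nonneg fun ω => sq_nonneg _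
    linarith

lemma forall_risk_le_iff_eq_minimizer (hp : p ∈ Set.Ioo (0 : ℝ) 1) (βstar b : Vec d) :
    (∀ b', I.risk P βstar b ≤ I.risk P βstar b') ↔ b = I.minimizer P βstar := by
  obtain ⟨βm, h0⟩ := hI.exists_integral_residual_smul_eq_zero hmom hq hp βstar
  have h := hI.forall_risk_le_iff hmom hq hp h0
  have hmin : I.minimizer P βstar = βm :=
    (h _).1 (Classical.epsilon_spec (p := fun b => ∀ b', I.risk P βstar b ≤ I.risk P βstar b')
      ⟨βm, (h βm).2 rfl⟩)
  rw [hmin, h]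

lemma integral_residual_minimizer (hp : p ∈ Set.Ioo (0 : ℝ) 1) (βstar : Vec d) :
    ∫ ω, (inner ℝ (I.x 1 ω) βstar + I.noise 1 ω -
      inner ℝ (masked (I.input 1 ω)) (I.minimizer P βstar)) • masked (I.input 1 ω) ∂P = 0 := by
  obtain ⟨βm, h0⟩ := hI.exists_integral_residual_smul_eq_zero hmom hq hp βstar
  rwa [← (hI.forall_risk_le_iff_eq_minimizer hmom hq hp βstar βm).1
    ((hI.forall_risk_le_iff hmom hq hp h0 βm).2 rfl)]

/-- The SGD recursion centred at the minimizer of the risk. -/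
theorem exists_affineRecursion (hp : p ∈ Set.Ioo (0 : ℝ) 1) (hα : 0 < α)
    (hrate : I.LearningRateCondition P p q α) (βstar : Vec d) :
    ∃ (B : Vec d →L[ℝ] Vec d) (r : ℝ), AffineRecursion P I.input (stepLin α)
      (stepConst α βstar (I.minimizer P βstar)) B r := by
  obtain ⟨G, hG⟩ := hI.exists_gram hmom hq
  obtain ⟨r, hr0, hr1, hr⟩ := hI.exists_contraction hmom hq hp hα hrate
  have hm := hI.measurable_input
  have hmap := hI.map_input
  have hb0 := hI.integral_residual_minimizer hmom hq hp βstar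
  refine ⟨ContinuousLinearMap.id ℝ (Vec d) - α • G, r, hm, hI.indep_time, hmap,
    measurable_stepLin α, measurable_stepConst α _ _, fun k v => ?_, fun k => ?_, fun k => ?_,
    fun k v => ?_, hr0, hr1⟩
  -- Each property at time `k` depends only on the law of the input, so it is transferred to time
  -- `1`, where the moment assumptions are stated.
  · have hA := measurable_stepLin (d := d) α v
    rw [← integral_map (hm k).aemeasurable (f := fun t => stepLin α t v)
      hA.aestronglyMeasurable, hmap k 1,
      integral_map (hm 1).aemeasurable hA.aestronglyMeasurable]
    simp only [stepLin_apply]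
    have hi : Integrable
        (fun ω => α • inner ℝ (masked (I.input 1 ω)) v • masked (I.input 1 ω)) P :=
      (((hI.memLp_inner_smul_masked hmom hq v).mono_exponent
        (four_le_ofReal hq)).integrable (by norm_num)).smul α
    rw [integral_sub (integrable_const v) hi, integral_smul, hG]
    simp
  · have hA := measurable_stepConst α βstar (I.minimizer P βstar)
    rw [← integral_map (hm k).aemeasurable (f := stepConst α βstar (I.minimizer P βstar))
      hA.aestronglyMeasurable, hmap k 1,
      integral_map (hm 1).aemeasurable hA.aestronglyMeasurable]
    simp only [stepConst, mul_smul]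
    rw [integral_smul]
    exact (congrArg (α • ·) hb0).trans (smul_zero α)
  · have hA := measurable_stepConst α βstar (I.minimizer P βstar)
    refine (memLp_map_measure_iff (f := I.input k)
      (g := stepConst α βstar (I.minimizer P βstar)) hA.aestronglyMeasurable (hm k).aemeasurable).1 ?_
    rw [hmap k 1]
    exact (memLp_map_measure_iff hA.aestronglyMeasurable (hm 1).aemeasurable).2
      (hI.memLp_stepConst hmom hq βstar _)
  · have hA : Measurable fun t => ‖stepLin (d := d) α t v‖ₑ ^ 4 :=
      (measurable_stepLin α v).enorm.pow_const 4
    rw [← lintegral_map (f := fun t => ‖stepLin α t v‖ₑ ^ 4) hA (hm k), hmap k 1,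
      lintegral_map hA (hm 1)]
    have h4 := integrable_norm_pow_four (hI.memLp_stepLin (α := α) hmom hq v)
    have e : ∀ u : Vec d, ‖u‖ₑ ^ 4 = ENNReal.ofReal (‖u‖ ^ 4) := fun u => by
      rw [ENNReal.ofReal_pow (norm_nonneg u), ofReal_norm]
    simp only [e]
    rw [← ofReal_integral_eq_lintegral_ofReal h4 (.of_forall fun ω => by positivity),
      ← ENNReal.ofReal_pow hr0, ← ENNReal.ofReal_mul (by positivity)]
    exact ENNReal.ofReal_le_ofReal (hr v)

end IsModel

end Inputs

end DropoutSGD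

/-! ### From entries to the operator norm, and the theorem -/

namespace DropoutSGD

lemma toEuclideanCLM_eq_sum {d : ℕ} (A : Matrix (Fin d) (Fin d) ℝ) :
    Matrix.toEuclideanCLM (n := Fin d) (𝕜 := ℝ) A = ∑ i, ∑ j,
      A i j • Matrix.toEuclideanCLM (n := Fin d) (𝕜 := ℝ) (Matrix.single i j 1) := by
  conv_lhs => rw [Matrix.matrix_eq_sum_single A]
  simp only [map_sum]
  refine Finset.sum_congr rfl fun i _ => Finset.sum_congr rfl fun j _ => ?_
  rw [← map_smul, Matrix.smul_single, smul_eq_mul, mul_one]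

/-- Expanding in matrix units bounds the operator norm by the entries, and also yields its
integrability. -/
lemma integral_opNorm_le {Ω : Type*} [MeasurableSpace Ω] {P : Measure Ω} {d : ℕ}
    {A : Ω → Matrix (Fin d) (Fin d) ℝ} (hA : ∀ i j, Integrable (fun ω => A ω i j) P) :
    Integrable (fun ω => opNorm (A ω)) P ∧ ∫ ω, opNorm (A ω) ∂P ≤ ∑ i, ∑ j,
      opNorm (Matrix.single i j 1 : Matrix (Fin d) (Fin d) ℝ) * ∫ ω, |A ω i j| ∂P := by
  have hi : Integrable (fun ω => opNorm (A ω)) P := by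
    refine Integrable.norm ?_
    simp only [toEuclideanCLM_eq_sum (A _)]
    exact integrable_finsetSum _ fun i _ => integrable_finsetSum _ fun j _ =>
      (hA i j).smul_const _
  have hs : ∀ i j, Integrable (fun ω =>
      opNorm (Matrix.single i j 1 : Matrix (Fin d) (Fin d) ℝ) * |A ω i j|) P :=
    fun i j => (hA i j).abs.const_mul _
  refine ⟨hi, ?_⟩
  simp only [← integral_const_mul]
  simp only [← integral_finsetSum Finset.univ fun j _ => hs _ j]
  rw [← integral_finsetSum Finset.univ fun i _ => integrable_finsetSum _ fun j _ => hs i j]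
  refine integral_mono hi
    (integrable_finsetSum _ fun i _ => integrable_finsetSum _ fun j _ => hs i j) fun ω => ?_
  simp only [opNorm]
  rw [toEuclideanCLM_eq_sum (A ω)]
  refine (norm_sum_le _ _).trans (Finset.sum_le_sum fun i _ => (norm_sum_le _ _).trans
    (Finset.sum_le_sum fun j _ => ?_))
  rw [norm_smul, mul_comm, Real.norm_eq_abs]

lemma inner_single_left {d : ℕ} (i : Fin d) (v : Vec d) :
    inner ℝ (EuclideanSpace.single i (1 : ℝ)) v = v i := by
  simp [EuclideanSpace.inner_single_left]

namespace Inputs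

variable {Ω : Type*} {d : ℕ} {I : Inputs Ω d}

/-- Centring at the average removes the shift by `βm`, so the estimator is the same for the centred
orbit. -/
lemma sum_iterate_sub_average (βstar βm β₀ : Vec d) (α : ℝ) {n : ℕ} (hn : 1 ≤ n) (s t : ℕ)
    (ω : Ω) :
    ∑ k ∈ Finset.Ico s t, (I.iterate βstar α β₀ k ω - I.average βstar α β₀ n ω) =
      ∑ k ∈ Finset.Ico s t, orbit I.input (stepLin α) (stepConst α βstar βm) 0
        (fun _ => β₀ - βm) k ω - ((t - s : ℕ) : ℝ) • (1 / (n : ℝ)) •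
        ∑ k ∈ Finset.Ico 1 (n + 1), orbit I.input (stepLin α) (stepConst α βstar βm) 0
          (fun _ => β₀ - βm) k ω := by
  have hn0 : (n : ℝ) ≠ 0 := by positivity
  have hI : Finset.Icc 1 n = Finset.Ico 1 (n + 1) := rfl
  simp only [average, I.iterate_eq βstar βm β₀ α, hI, Finset.sum_add_distrib, Finset.sum_const,
    Nat.card_Ico, Finset.sum_sub_distrib, Nat.add_sub_cancel]
  simp only [← Nat.cast_smul_eq_nsmul ℝ, smul_add, smul_smul, one_div, inv_mul_cancel₀ hn0,
    one_smul]
  abel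

lemma estimator_apply (βstar βm β₀ : Vec d) (α : ℝ) {c ζ : ℝ} (hc : 0 < c) (hζ : 1 < ζ) {n : ℕ}
    (hn : 1 ≤ n) (hn1 : blockStart c ζ 1 ≤ n) (ω : Ω) {S : ℕ → Ω → Vec d}
    (hS : ∀ m ω, S m ω = ∑ k ∈ Finset.Ico (cutBlock c ζ n m) (cutBlock c ζ n (m + 1)),
        orbit I.input (stepLin α) (stepConst α βstar βm) 0 (fun _ => β₀ - βm) k ω -
      ((cutBlock c ζ n (m + 1) - cutBlock c ζ n m : ℕ) : ℝ) • (1 / (n : ℝ)) •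
        ∑ k ∈ Finset.Ico 1 (n + 1),
          orbit I.input (stepLin α) (stepConst α βstar βm) 0 (fun _ => β₀ - βm) k ω)
    (i j : Fin d) :
    I.estimator βstar α β₀ (blockStart c ζ) n ω i j =
      (1 / (n : ℝ)) * ∑ m ∈ Finset.range (lastBlock (blockStart c ζ) n),
        inner ℝ (EuclideanSpace.single i (1 : ℝ)) (S m ω) *
          inner ℝ (EuclideanSpace.single j (1 : ℝ)) (S m ω) := by
  simp only [inner_single_left, hS, ← I.sum_iterate_sub_average βstar βm β₀ α hn]
  have hI : ∀ s, Finset.Icc s n = Finset.Ico s (n + 1) := fun _ => rfl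
  rw [sum_cutBlock hc hζ hn1 fun s t =>
    (∑ k ∈ Finset.Ico s t, (I.iterate βstar α β₀ k ω - I.average βstar α β₀ n ω)) i *
    (∑ k ∈ Finset.Ico s t, (I.iterate βstar α β₀ k ω - I.average βstar α β₀ n ω)) j, mul_add]
  simp only [estimator, Matrix.add_apply, Matrix.smul_apply, Matrix.sum_apply, outer,
    Matrix.vecMulVec_apply, smul_eq_mul, hI]

variable [MeasurableSpace Ω] {P : Measure Ω} {α r K : ℝ} {βstar βm : Vec d} {Z : ℤ → Ω → Vec d}

lemma ae_tendsto_backward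
    (hZ : IsStationary P I.input (stepLin α) (stepConst α βstar βm) r K Z) :
    ∀ᵐ ω ∂P, ∀ (k : ℤ) (u : Vec d), Tendsto (fun m : ℕ => I.backward βstar α k ω m u) atTop
      (𝓝 (βm + Z k ω)) := by
  filter_upwards [hZ.tendsto] with ω h k u
  simp only [I.backward_eq βstar βm]
  exact ((h k (u - βm)).comp (tendsto_add_atTop_nat 1)).const_add βm

lemma ae_stationary_eq (hZ : IsStationary P I.input (stepLin α) (stepConst α βstar βm) r K Z) :
    ∀ᵐ ω ∂P, ∀ k : ℤ, I.stationary βstar α k ω = βm + Z k ω := by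
  filter_upwards [ae_tendsto_backward hZ] with ω h k
  exact (h k 0).limUnder_eq

lemma lagProduct_ae_eq
    (hZ : IsStationary P I.input (stepLin α) (stepConst α βstar (I.minimizer P βstar)) r K Z)
    (k : ℤ) (i j : Fin d) : I.lagProduct P βstar α k i j =ᵐ[P] fun ω =>
      inner ℝ (EuclideanSpace.single i (1 : ℝ)) (Z 0 ω) *
        inner ℝ (EuclideanSpace.single j (1 : ℝ)) (Z k ω) := by
  filter_upwards [ae_stationary_eq hZ] with ω h
  simp only [lagProduct, h, inner_single_left, PiLp.add_apply, add_sub_cancel_left]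

end Inputs

end DropoutSGD

theorem mainTheorem8 {Ω : Type*} [MeasurableSpace Ω] (P : Measure Ω) [IsProbabilityMeasure P]
    {d : ℕ} (I : DropoutSGD.Inputs Ω d) (βstar β₀ : DropoutSGD.Vec d) (p q α c ζ : ℝ)
    (hp : p ∈ Set.Ioo (0 : ℝ) 1) (hq : 4 ≤ q) (hα : 0 < α) (hc : 0 < c) (hζ : 1 < ζ)
    (hmodel : I.IsModel P p) (hmom : I.FiniteMoments P q)
    (hrate : I.LearningRateCondition P p q α) :
    -- the risk has exactly one minimizer, namely the vector used for centring
    (∀ b, (∀ b', I.risk P βstar b ≤ I.risk P βstar b') ↔ b = I.minimizer P βstar) ∧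
    -- almost surely, the limits that define the stationary sequence exist, from every start
    (∀ᵐ ω ∂P, ∀ (k : ℤ) (u : DropoutSGD.Vec d),
      Tendsto (fun m : ℕ => I.backward βstar α k ω m u) atTop
        (𝓝 (I.stationary βstar α k ω))) ∧
    -- the series that defines the long-run covariance matrix is well defined
    (∀ (i j : Fin d),
      (∀ k : ℤ, Integrable (I.lagProduct P βstar α k i j) P) ∧
      Summable fun k : ℤ => ∫ ω, I.lagProduct P βstar α k i j ω ∂P) ∧
    -- the rate of the estimator
    (∃ C : ℝ, ∀ n : ℕ, 1 ≤ n → DropoutSGD.blockStart c ζ 1 ≤ n →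
      Integrable (fun ω => DropoutSGD.opNorm
        (I.estimator βstar α β₀ (DropoutSGD.blockStart c ζ) n ω - I.longRunCov P βstar α)) P ∧
      ∫ ω, DropoutSGD.opNorm
        (I.estimator βstar α β₀ (DropoutSGD.blockStart c ζ) n ω - I.longRunCov P βstar α) ∂P ≤
          C * (n : ℝ) ^ (max (1 / ζ - 1) (-1 / (2 * ζ)))) ∧
    -- the special case of the exponent 3/2
    (ζ = 3 / 2 → ∃ C : ℝ, ∀ n : ℕ, 1 ≤ n → DropoutSGD.blockStart c ζ 1 ≤ n →
      ∫ ω, DropoutSGD.opNorm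
        (I.estimator βstar α β₀ (DropoutSGD.blockStart c ζ) n ω - I.longRunCov P βstar α) ∂P ≤
          C * (n : ℝ) ^ (-1 / 3 : ℝ)) := by

  obtain ⟨B, r, R⟩ := hmodel.exists_affineRecursion hmom hq hp hα hrate βstar
  obtain ⟨K, Z, hZ⟩ := R.exists_isStationary
  have hlag := fun i j : Fin d => hZ.hasSum_longRun R
    (EuclideanSpace.single i (1 : ℝ)) (EuclideanSpace.single j (1 : ℝ))
  have hint := fun (k : ℤ) (i j : Fin d) =>
    integral_congr_ae (DropoutSGD.Inputs.lagProduct_ae_eq hZ k i j)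
  have hLR : ∀ i j : Fin d, I.longRunCov P βstar α i j = DropoutSGD.longRun P B (Z 0)
      (EuclideanSpace.single i (1 : ℝ)) (EuclideanSpace.single j (1 : ℝ)) := fun i j => by
    simp only [DropoutSGD.Inputs.longRunCov, Matrix.of_apply, hint]
    exact (hlag i j).tsum_eq
  have hrateC : ∃ C : ℝ, ∀ n : ℕ, 1 ≤ n → DropoutSGD.blockStart c ζ 1 ≤ n →
      Integrable (fun ω => DropoutSGD.opNorm
        (I.estimator βstar α β₀ (DropoutSGD.blockStart c ζ) n ω - I.longRunCov P βstar α)) P ∧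
      ∫ ω, DropoutSGD.opNorm (I.estimator βstar α β₀ (DropoutSGD.blockStart c ζ) n ω -
        I.longRunCov P βstar α) ∂P ≤ C * (n : ℝ) ^ (max (1 / ζ - 1) (-1 / (2 * ζ))) := by
    have hb := fun i j : Fin d => hZ.exists_integral_abs_batchMeans_sub_le_rpow R
      (v := fun _ => β₀ - I.minimizer P βstar) measurable_const (memLp_const _) hc hζ
      (EuclideanSpace.single i (1 : ℝ)) (EuclideanSpace.single j (1 : ℝ))
    choose C hC0 hC using hb
    refine ⟨∑ i, ∑ j, DropoutSGD.opNorm (Matrix.single i j 1 : Matrix (Fin d) (Fin d) ℝ) * C i j,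
      fun n hn hn1 => ?_⟩
    have hn2 := fun i j => hC i j n hn hn1 _ fun m ω => rfl
    have hest := fun (ω : Ω) (i j : Fin d) => I.estimator_apply βstar (I.minimizer P βstar) β₀ α
      hc hζ hn hn1 ω (fun m ω => rfl) i j
    obtain ⟨h1, h2⟩ := DropoutSGD.integral_opNorm_le (P := P)
      (A := fun ω => I.estimator βstar α β₀ (DropoutSGD.blockStart c ζ) n ω -
        I.longRunCov P βstar α)
      fun i j => by simpa only [Matrix.sub_apply, hest, hLR] using (hn2 i j).1
    refine ⟨h1, h2.trans ?_⟩
    simp only [Finset.sum_mul]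
    refine Finset.sum_le_sum fun i _ => Finset.sum_le_sum fun j _ => ?_
    rw [mul_assoc]
    refine mul_le_mul_of_nonneg_left ?_ (norm_nonneg _)
    simpa only [Matrix.sub_apply, hest, hLR] using (hn2 i j).2
  refine ⟨hmodel.forall_risk_le_iff_eq_minimizer hmom hq hp βstar, ?_, fun i j => ⟨fun k => ?_, ?_⟩,
    hrateC, fun h => ?_⟩
  · filter_upwards [DropoutSGD.Inputs.ae_tendsto_backward hZ,
      DropoutSGD.Inputs.ae_stationary_eq hZ] with ω h1 h2 k u
    rw [h2]
    exact h1 k u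
  · exact (DropoutSGD.integrable_inner_mul_inner (hZ.memLp 0) (hZ.memLp k) _ _).congr
      (DropoutSGD.Inputs.lagProduct_ae_eq hZ k i j).symm
  · simp only [hint]
    exact (hlag i j).summable
  · obtain ⟨C, hC⟩ := hrateC
    refine ⟨C, fun n hn hn1 => (hC n hn hn1).2.trans_eq ?_⟩
    -- At `ζ = 3/2` the exponents `1/ζ - 1` and `-1/(2ζ)` coincide.
    rw [h]
    norm_num
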